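/- A \emph{reverse semistandard Young tableau} (RSSYT) is a filling of the diagram of a partition by positive integers that weakly decreases along rows from left to right and strictly decreases down columns. A \emph{Knuth biword} is a pair $(a,i)$ of words $a=a_1\cdots a_n$, $i=i_1\cdots i_n$ of positive integers of the same length $n\ge 0$ such that $i$ is weakly decreasing and $i_j=i_{j+1}$ implies $a_j\le a_{j+1}$; it is \emph{bounded} if $i_j\le a_j$ for all $j$. Value-reversed column insertion of a positive integer $x$ into an RSSYT inserts $x$ into the first column: if $x$ is smaller than all entries of the column, $x$ is appended at its bottom and the procedure stops; otherwise $x$ replaces the largest entry $y\le x$ of the column, and $y$ is inserted into the next column in the same way. For a Knuth biword $(a,i)$ let $\mathrm{Insert}(a,i)=(P,Q)$, where $P$ is obtained from the empty tableau by inserting $a_1,\dots,a_n$ successively, and $Q$ is the tableau of the same shape that has $i_j$ in the box created by the insertion of $a_j$. The map $\mathrm{RevInsert}$ takes a pair $(P,Q)$ of RSSYT of the same shape and repeatedly removes the rightmost occurrence of the smallest entry $y$ of $Q$, removes the corresponding box of $P$, and reverse inserts its entry into the columns to the left, one after the other (a number $z$ reverse inserted into a column replaces the smallest entry $\ge z$,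 which is passed to the previous column); if $x$ is the number that finally leaves the first column, $x$ and $y$ become the last letters, in front of which the letters of the later steps are written, of $a$ and $i$. For an RSSYT $T$ let $\mathrm{word}(T)$ be its column-reading word (columns from left to right, each read from bottom to top), and let $\equiv$ be Knuth equivalence for the reversed order of the alphabet, generated by $yxz\equiv yzx$ for $x>y\ge z$ and $xzy\equiv zxy$ for $x\ge y>z$ (inside longer words). A \emph{frank word} of $T$ is a word $v_1v_2\cdots v_m\equiv\mathrm{word}(T)$ whose factors $v_k$ are strictly increasing words (columns read from bottom to top) with lengths that form a permutation of the column lengths of $T$. The (Lascoux--Sch\"utzenberger) right key $K_+(T)$, resp. left key $K_-(T)$, is the tableau of the same shape as $T$ whose $j$-th column is the last factor, resp. first factor, of any frank word of $T$ whose last, resp. first, factor has the same length as the $j$-th column of $T$. For tableaux $K,L$ of the same shape, $K\ge L$ means entrywise comparison. \textbf{Theorem.} The map $\mathrm{Insert}$ restricts to a bijection from the set of bounded Knuth biwords onto the set of pairs $(P,Q)$ of RSSYT of the same shape such that $K_+(P)\ge K_-(Q)$, and the inverse of this bijection is the restriction of $\mathrm{RevInsert}$. -/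

import Mathlib

/-! Reverse semistandard tableaux, column insertion with the order of the values reversed, and
left and right keys.  All entries are positive integers.

A (possibly skew) column is the list of its entries from top to bottom.  A tableau is the list of
its columns from left to right. -/

namespace PlacticKeys

/-- A column: a nonempty list of positive integers, strictly decreasing from top to bottom. -/
def IsColumn (c : List ℕ+) : Prop :=
  c ≠ [] ∧ c.Pairwise (· > ·)

/-- The column `d` may stand immediately to the right of the column `b` (with tops aligned):
`d` is not longer than `c`, and rows weakly decrease from left to right. -/
def RowsWeaklyDecrease (b d : List ℕ+) : Prop :=
  ∀ (r : ℕ) (hd : r < d.length), ∃ hb : r < b.length, d[r] ≤ b[r]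

/-- Reverse semistandard Young tableaux (of partition shape), as lists of columns: entries strictly
decrease down the columns and weakly decrease along the rows. -/
def IsRSSYT (T : List (List ℕ+)) : Prop :=
  (∀ c ∈ T, IsColumn c) ∧ T.IsChain RowsWeaklyDecrease

/-- The shape, recorded by the column lengths (that is, by the conjugate partition). -/
def shape (T : List (List ℕ+)) : List ℕ := T.map List.length

/-! ### Biwords -/

/-- A biword is the list of its letter pairs `(a_j, i_j)`.  It is a Knuth biword if `i` is weakly
decreasing and `i_j = i_{j+1}` implies `a_j ≤ a_{j+1}`. -/
def IsKnuthBiword (w : List (ℕ+ × ℕ+)) : Prop :=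
  w.IsChain fun p q => q.2 ≤ p.2 ∧ (p.2 = q.2 → p.1 ≤ q.1)

/-- A biword `(a, i)` is bounded if `i_j ≤ a_j` for all `j`. -/
def IsBounded (w : List (ℕ+ × ℕ+)) : Prop :=
  ∀ p ∈ w, p.2 ≤ p.1

/-! ### Insertion -/

/-- Insert `x` into a column.  If `x` is smaller than all entries it is appended at the bottom and
nothing is bumped; otherwise `x` replaces the largest entry `y ≤ x` (the topmost such entry, as
columns decrease), and `y` is bumped. -/
def insertColumn (x : ℕ+) : List ℕ+ → List ℕ+ × Option ℕ+
  | [] => ([x], none)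
  | y :: c =>
    if y ≤ x then (x :: c, some y)
    else (y :: (insertColumn x c).1, (insertColumn x c).2)

/-- Column insertion of `x` into a tableau: insert into the first column, the bumped entry into the
next column, and so on.  The second output is the index of the column of the new box. -/
def insertTableau : ℕ+ → List (List ℕ+) → List (List ℕ+) × ℕ
  | x, [] => ([[x]], 0)
  | x, c :: T =>
    match insertColumn x c with
    | (c', none) => (c' :: T, 0)
    | (c', some y) => (c' :: (insertTableau y T).1, (insertTableau y T).2 + 1)

/-- Append `y` at the bottom of column `k` (a new column if `k` is the number of columns). -/
def appendBox (y : ℕ+) : ℕ → List (List ℕ+) → List (List ℕ+)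
  | _, [] => [[y]]
  | 0, c :: T => (c ++ [y]) :: T
  | k + 1, c :: T => c :: appendBox y k T

/-- One step of column insertion RSK for the letter pair `p = (x, y)`: insert `x` into the insertion
tableau, and record `y` in the new box of the recording tableau. -/
def insertStep (PQ : List (List ℕ+) × List (List ℕ+)) (p : ℕ+ × ℕ+) :
    List (List ℕ+) × List (List ℕ+) :=
  ((insertTableau p.1 PQ.1).1, appendBox p.2 (insertTableau p.1 PQ.1).2 PQ.2)

/-- Column insertion RSK (values reversed): the letter pairs are processed from left to right,
starting with a pair of empty tableaux. -/
def rskInsert (w : List (ℕ+ × ℕ+)) : List (List ℕ+) × List (List ℕ+) :=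
  w.foldl insertStep ([], [])

/-! ### Reverse insertion -/

/-- Reverse insert `z` into a column: `z` replaces the smallest entry `y ≥ z` (the lowest such
entry), and `y` is the second output. -/
def revInsertColumn (z : ℕ+) : List ℕ+ → List ℕ+ × ℕ+
  | [] => ([], z)
  | y :: c =>
    if ∃ v ∈ c, z ≤ v then (y :: (revInsertColumn z c).1, (revInsertColumn z c).2)
    else (z :: c, y)

/-- Remove the bottom box of column `k`; the second output is the entry of that box. -/
def removeBox : ℕ → List (List ℕ+) → List (List ℕ+) × ℕ+
  | _, [] => ([], 1)
  | 0, c :: T => (if c.length ≤ 1 then T else c.dropLast :: T, c.getLastD 1)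
  | k + 1, c :: T => (c :: (removeBox k T).1, (removeBox k T).2)

/-- Reverse column insertion starting from the bottom box of column `k`: this box is removed, its
entry is reverse inserted into the previous column, and so on; the second output is the number that
leaves the first column. -/
def revInsertTableau : ℕ → List (List ℕ+) → List (List ℕ+) × ℕ+
  | _, [] => ([], 1)
  | 0, c :: T => removeBox 0 (c :: T)
  | k + 1, c :: T =>
    ((revInsertColumn (revInsertTableau k T).2 c).1 :: (revInsertTableau k T).1,
      (revInsertColumn (revInsertTableau k T).2 c).2)

/-- The smallest entry of a nonempty tableau. -/
def minEntry (T : List (List ℕ+)) : ℕ+ := T.flatten.min?.getD 1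

/-- The index of the rightmost column that contains the smallest entry. -/
def minColumn (T : List (List ℕ+)) : ℕ :=
  ((List.range T.length).filter fun k => minEntry T ∈ T.getD k []).getLastD 0

/-- Reverse RSK, run for `n` steps: each step removes the rightmost smallest entry `y` of `Q`,
reverse inserts in `P` from the corresponding box, with output `x`, and puts `(x, y)` at the end
of the biword. -/
def rskReverseSteps : ℕ → List (List ℕ+) → List (List ℕ+) → List (ℕ+ × ℕ+)
  | 0, _, _ => []
  | n + 1, P, Q =>
    rskReverseSteps n (revInsertTableau (minColumn Q) P).1 (removeBox (minColumn Q) Q).1 ++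
      [((revInsertTableau (minColumn Q) P).2, minEntry Q)]

/-- Reverse RSK, run until all boxes are removed. -/
def rskReverse (PQ : List (List ℕ+) × List (List ℕ+)) : List (ℕ+ × ℕ+) :=
  rskReverseSteps PQ.2.flatten.length PQ.1 PQ.2

/-! ### Knuth equivalence and keys -/

/-- The column-reading word: each column is read from bottom to top, the columns from left to
right. -/
def word (T : List (List ℕ+)) : List ℕ+ := (T.map List.reverse).flatten

/-- The elementary Knuth relations `y x z ≡ y z x` (for `x < y ≤ z`) and `x z y ≡ z x y`
(for `x ≤ y < z`), with the order of the alphabet reversed. -/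
inductive KnuthStep : List ℕ+ → List ℕ+ → Prop
  | first (u v : List ℕ+) (x y z : ℕ+) (hxy : x > y) (hyz : y ≥ z) :
      KnuthStep (u ++ [y, x, z] ++ v) (u ++ [y, z, x] ++ v)
  | second (u v : List ℕ+) (x y z : ℕ+) (hxy : x ≥ y) (hyz : y > z) :
      KnuthStep (u ++ [x, z, y] ++ v) (u ++ [z, x, y] ++ v)

/-- Knuth (plactic) equivalence of words, for the reversed order. -/
def KnuthEquiv : List ℕ+ → List ℕ+ → Prop := Relation.EqvGen KnuthStep

/-- A frank word Knuth equivalent to `T`, given by its factorization `v` into columns: the lengths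
of the columns are a permutation of the column lengths of `T`. -/
def IsFrank (T v : List (List ℕ+)) : Prop :=
  (∀ c ∈ v, IsColumn c) ∧ (shape v).Perm (shape T) ∧ KnuthEquiv (word v) (word T)

/-- The last column of the frank words equivalent to `T` whose last column has length `l`; by
Lascoux and Schützenberger it depends only on `T` and `l`, and exists if `T` has a column of
length `l`. -/
noncomputable def lastFrankColumn (T : List (List ℕ+)) (l : ℕ) : List ℕ+ :=
  Classical.epsilon fun c => c.length = l ∧ ∃ v, IsFrank T (v ++ [c])

/-- The first column of the frank words equivalent to `T` whose first column has length `l`. -/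
noncomputable def firstFrankColumn (T : List (List ℕ+)) (l : ℕ) : List ℕ+ :=
  Classical.epsilon fun c => c.length = l ∧ ∃ v, IsFrank T (c :: v)

/-- The right key `K₊(T)`: the tableau of the same shape as `T` whose columns are the last columns
of the frank words equivalent to `T`. -/
noncomputable def rightKey (T : List (List ℕ+)) : List (List ℕ+) :=
  T.map fun c => lastFrankColumn T c.length

/-- The left key `K₋(T)`: the tableau of the same shape as `T` whose columns are the first columns
of the frank words equivalent to `T`. -/
noncomputable def leftKey (T : List (List ℕ+)) : List (List ℕ+) :=
  T.map fun c => firstFrankColumn T c.length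

/-- `K ≥ L`: the tableaux have the same shape, and each entry of `K` is at least the corresponding
entry of `L`. -/
def EntrywiseGE (K L : List (List ℕ+)) : Prop :=
  List.Forall₂ (List.Forall₂ (· ≥ ·)) K L

/-! ### The two sides of the bijection -/

/-- The bounded Knuth biwords. -/
def boundedBiwords : Set (List (ℕ+ × ℕ+)) :=
  {w | IsKnuthBiword w ∧ IsBounded w}

/-- The pairs `(P, Q)` of reverse semistandard Young tableaux of the same shape with
`K₊(P) ≥ K₋(Q)`. -/
def keyBoundedPairs : Set (List (List ℕ+) × List (List ℕ+)) :=
  {PQ | IsRSSYT PQ.1 ∧ IsRSSYT PQ.2 ∧ shape PQ.1 = shape PQ.2 ∧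
    EntrywiseGE (rightKey PQ.1) (leftKey PQ.2)}

end PlacticKeys

namespace PlacticKeys

/-! Without bounds and keys, the statement is the Robinson-Schensted-Knuth correspondence in its
column form: `IsKnuthBiword.rskReverse_rskInsert` and `rskReverseSteps_spec` show that insertion and
reverse insertion are inverse to each other between all Knuth biwords and all pairs of tableaux of
the same shape. What remains is that a Knuth biword is bounded exactly if `K₊(P) ≥ K₋(Q)`
(`IsKnuthBiword.entrywiseGE_iff_isBounded`).

Two decreasing columns of equal length compare entrywise iff, for every `k`, the larger one has at
most as many entries `≤ k`. So the keys are encoded by the numbers `p_k(j)`, `q_k(j)` of entries `≤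
k` in column `j` of `K₊(P)`, `K₋(Q)`. For the right key, `p_k(j)` is the maximal length of an
increasing subword with letters `≤ k` in the word of the columns from `j` on. These maxima are
plactic invariants (`KnuthEquiv.maxInc_eq`), and if a word ends with a column as long as its longest
increasing subword, they count the entries of that column (`maxInc_eq_countP`). For the left key,
reversal of words and complement of letters turn first factors of frank words into last factors, so
`q_k(j)` is read off from the evacuation of `Q`.

Now the biword grows by a letter pair `(x, y)`, with the new box in column `c`. By
`maxInc_insertTableau`, `p_k` changes only at `c`: it increases by 1, or it stays and `p_k(c) =
p_k(c + 1)`. By `evacuation_step`, for `k ≥ y` also `q_k` changes only at `c`: it increases by 1, or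
it stays and `q_k(c - 1) ≤ q_k(c)`; this is an analysis of a jeu de taquin slide in the evacuation
tableau. As both functions weakly decrease in `j`, `p_k ≤ q_k` holds after the step iff it held
before (`step_iff`). For `k < y` all `q_k` vanish, since `y` is the smallest letter of `Q`, and `p_k
= 0` survives for all these `k` iff `x ≥ y`. Hence each step preserves the key inequality exactly if
its pair satisfies the bound. -/

/-- Strictly decreasing lists, that is, possibly empty columns. -/
abbrev Desc (c : List ℕ+) : Prop := c.Pairwise (· > ·)

/-! ### Rows -/

theorem rowsWeaklyDecrease_nil (b : List ℕ+) : RowsWeaklyDecrease b [] := by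
  intro r hd
  simp at hd

theorem rowsWeaklyDecrease_nil_cons (y : ℕ+) (d : List ℕ+) :
    ¬ RowsWeaklyDecrease [] (y :: d) := by
  intro h
  obtain ⟨hb, _⟩ := h 0 (by simp)
  simp at hb

theorem rowsWeaklyDecrease_cons {x y : ℕ+} {b d : List ℕ+} :
    RowsWeaklyDecrease (x :: b) (y :: d) ↔ y ≤ x ∧ RowsWeaklyDecrease b d := by
  constructor
  · intro h
    refine ⟨?_, ?_⟩
    · obtain ⟨_, h0⟩ := h 0 (by simp)
      simpa using h0
    · intro r hd
      obtain ⟨hb, h1⟩ := h (r + 1) (by simpa using hd)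
      exact ⟨by simpa using hb, by simpa using h1⟩
  · rintro ⟨h0, h⟩ r hd
    cases r with
    | zero => exact ⟨by simp, by simpa using h0⟩
    | succ r =>
      obtain ⟨hb, h1⟩ := h r (by simpa using hd)
      exact ⟨by simpa using hb, by simpa using h1⟩

theorem RowsWeaklyDecrease.length_le {b d : List ℕ+} (h : RowsWeaklyDecrease b d) :
    d.length ≤ b.length := by
  by_contra! hlt
  obtain ⟨hb, _⟩ := h b.length hlt
  exact lt_irrefl _ hb

theorem RowsWeaklyDecrease.append_left {b d : List ℕ+} (h : RowsWeaklyDecrease b d)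
    (e : List ℕ+) : RowsWeaklyDecrease (b ++ e) d := by
  intro r hd
  obtain ⟨hb, h1⟩ := h r hd
  exact ⟨by simp; omega, by rw [List.getElem_append_left hb]; exact h1⟩

theorem RowsWeaklyDecrease.trans {b d e : List ℕ+} (h : RowsWeaklyDecrease b d)
    (h' : RowsWeaklyDecrease d e) : RowsWeaklyDecrease b e := by
  intro r he
  obtain ⟨hd, h1⟩ := h' r he
  obtain ⟨hb, h2⟩ := h r hd
  exact ⟨hb, h1.trans h2⟩

/-! ### Insertion into a column -/

theorem insertColumn_cases (x : ℕ+) (c : List ℕ+) :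
    ((∀ a ∈ c, x < a) ∧ insertColumn x c = (c ++ [x], none)) ∨
      ∃ a y b, c = a ++ y :: b ∧ y ≤ x ∧ (∀ u ∈ a, x < u) ∧
        insertColumn x c = (a ++ x :: b, some y) := by
  induction c with
  | nil => left; simp [insertColumn]
  | cons h t ih =>
    by_cases hx : h ≤ x
    · right
      exact ⟨[], h, t, by simp, hx, by simp, by simp [insertColumn, hx]⟩
    · have hx' : x < h := not_le.mp hx
      rcases ih with ⟨h1, h2⟩ | ⟨a, y, b, rfl, hy, hu, h2⟩
      · left
        refine ⟨?_, by simp [insertColumn, hx, h2]⟩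
        intro a ha
        rcases List.mem_cons.mp ha with rfl | ha
        · exact hx'
        · exact h1 a ha
      · right
        refine ⟨h :: a, y, b, by simp, hy, ?_, by simp [insertColumn, hx, h2]⟩
        intro u hu'
        rcases List.mem_cons.mp hu' with rfl | hu'
        · exact hx'
        · exact hu u hu'

theorem insertColumn_cons_of_le {x h : ℕ+} (t : List ℕ+) (hx : h ≤ x) :
    insertColumn x (h :: t) = (x :: t, some h) := by
  simp [insertColumn, hx]

theorem insertColumn_cons_of_lt {x h : ℕ+} (t : List ℕ+) (hx : x < h) :
    insertColumn x (h :: t) = (h :: (insertColumn x t).1, (insertColumn x t).2) := by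
  simp [insertColumn, hx]

theorem desc_insertColumn {x : ℕ+} {c : List ℕ+} (hc : Desc c) : Desc (insertColumn x c).1 := by
  rcases insertColumn_cases x c with ⟨h1, h2⟩ | ⟨a, y, b, rfl, hy, hu, h2⟩
  · rw [h2]
    simpa [List.pairwise_append] using ⟨hc, h1⟩
  · rw [h2]
    simp only [Desc, List.pairwise_append, List.pairwise_cons, List.mem_cons] at hc ⊢
    obtain ⟨h3, ⟨h4, h5⟩, h6⟩ := hc
    refine ⟨h3, ⟨fun b' hb' => (h4 b' hb').trans_le hy, h5⟩, ?_⟩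
    rintro u hu' v (rfl | hv)
    · exact hu u hu'
    · exact h6 u hu' v (Or.inr hv)

theorem insertColumn_ne_nil (x : ℕ+) (c : List ℕ+) : (insertColumn x c).1 ≠ [] := by
  rcases insertColumn_cases x c with ⟨h1, h2⟩ | ⟨a, y, b, rfl, hy, hu, h2⟩ <;> simp [h2]

theorem isColumn_insertColumn {x : ℕ+} {c : List ℕ+} (hc : Desc c) :
    IsColumn (insertColumn x c).1 :=
  ⟨insertColumn_ne_nil x c, desc_insertColumn hc⟩

/-! ### Knuth equivalence -/

namespace KnuthEquiv

theorem refl (w : List ℕ+) : KnuthEquiv w w := Relation.EqvGen.refl w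

theorem symm {w w' : List ℕ+} (h : KnuthEquiv w w') : KnuthEquiv w' w := Relation.EqvGen.symm _ _ h

theorem trans {w w' w'' : List ℕ+} (h : KnuthEquiv w w') (h' : KnuthEquiv w' w'') :
    KnuthEquiv w w'' := Relation.EqvGen.trans _ _ _ h h'

theorem step {w w' : List ℕ+} (h : KnuthStep w w') : KnuthEquiv w w' := Relation.EqvGen.rel _ _ h

theorem of_eq {w w' : List ℕ+} (h : w = w') : KnuthEquiv w w' := h ▸ refl w

theorem append {w w' : List ℕ+} (h : KnuthEquiv w w') (u v : List ℕ+) :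
    KnuthEquiv (u ++ w ++ v) (u ++ w' ++ v) := by
  induction h with
  | rel a b hab =>
    apply step
    cases hab with
    | first p q x y z hxy hyz =>
      have := KnuthStep.first (u ++ p) (q ++ v) x y z hxy hyz
      simpa [List.append_assoc] using this
    | second p q x y z hxy hyz =>
      have := KnuthStep.second (u ++ p) (q ++ v) x y z hxy hyz
      simpa [List.append_assoc] using this
  | refl a => exact refl _
  | symm a b _ ih => exact ih.symm
  | trans a b c _ _ ih1 ih2 => exact ih1.trans ih2

theorem append_left {w w' : List ℕ+} (h : KnuthEquiv w w') (u : List ℕ+) :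
    KnuthEquiv (u ++ w) (u ++ w') := by
  simpa using h.append u []

theorem append_right {w w' : List ℕ+} (h : KnuthEquiv w w') (v : List ℕ+) :
    KnuthEquiv (w ++ v) (w' ++ v) := by
  simpa using h.append [] v

theorem cons {w w' : List ℕ+} (h : KnuthEquiv w w') (x : ℕ+) :
    KnuthEquiv (x :: w) (x :: w') := by
  simpa using h.append_left [x]

theorem perm {w w' : List ℕ+} (h : KnuthEquiv w w') : w.Perm w' := by
  induction h with
  | rel a b hab =>
    cases hab with
    | first p q x y z hxy hyz =>
      simp only [List.append_assoc, List.cons_append, List.nil_append]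
      exact ((List.Perm.swap z x q).cons y).append_left p
    | second p q x y z hxy hyz =>
      simp only [List.append_assoc, List.cons_append, List.nil_append]
      exact (List.Perm.swap z x (y :: q)).append_left p
  | refl a => exact List.Perm.refl _
  | symm a b _ ih => exact ih.symm
  | trans a b c _ _ ih1 ih2 => exact ih1.trans ih2

end KnuthEquiv

theorem knuthEquiv_first {x y z : ℕ+} (hxy : y < x) (hyz : z ≤ y) (v : List ℕ+) :
    KnuthEquiv (y :: x :: z :: v) (y :: z :: x :: v) :=
  KnuthEquiv.step (by simpa using KnuthStep.first [] v x y z hxy hyz)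

theorem knuthEquiv_second {x y z : ℕ+} (hxy : y ≤ x) (hyz : z < y) (v : List ℕ+) :
    KnuthEquiv (x :: z :: y :: v) (z :: x :: y :: v) :=
  KnuthEquiv.step (by simpa using KnuthStep.second [] v x y z hxy hyz)

/-- `x` travels to the right past one letter of `s` at a time. The letter behind the one being
passed is at most `x` and serves as witness for `x z y ≡ z x y`; for the last letter of `s` this
witness is `y`. -/
theorem knuthEquiv_move_over_smaller {x y : ℕ+} (hy : y ≤ x) (s : List ℕ+)
    (hs : (s ++ [y]).Pairwise (· < ·)) : KnuthEquiv (x :: (s ++ [y])) (s ++ [x, y]) := by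
  induction s with
  | nil => exact KnuthEquiv.refl _
  | cons b s ih =>
    have hs' : (s ++ [y]).Pairwise (· < ·) := by
      simp only [List.cons_append, List.pairwise_cons] at hs; exact hs.2
    have hb : ∀ a ∈ s ++ [y], b < a := by
      simp only [List.cons_append, List.pairwise_cons] at hs; exact hs.1
    refine KnuthEquiv.trans ?_ ((ih hs').cons b)
    cases s with
    | nil => exact knuthEquiv_second hy (hb y (by simp)) []
    | cons e s =>
      refine knuthEquiv_second ?_ (hb e (by simp)) (s ++ [y])
      have : e < y := by
        simp only [List.cons_append, List.pairwise_cons] at hs'; exact hs'.1 y (by simp)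
      exact this.le.trans hy

/-- Here the small letter `y` travels: `x y a ≡ x a y` because `y ≤ x < a`, and then `a` takes over
the role of `x`. -/
theorem knuthEquiv_move_over_larger {x y : ℕ+} (hy : y ≤ x) (s : List ℕ+)
    (hs : (x :: s).Pairwise (· < ·)) : KnuthEquiv (x :: y :: s) (x :: (s ++ [y])) := by
  induction s generalizing x with
  | nil => exact KnuthEquiv.refl _
  | cons a s ih =>
    simp only [List.pairwise_cons, List.mem_cons] at hs
    have hxa : x < a := hs.1 a (Or.inl rfl)
    refine ((knuthEquiv_first hxa hy s).symm).trans ?_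
    refine KnuthEquiv.cons ?_ x
    refine ih (hy.trans hxa.le) ?_
    simpa using hs.2

/-- In the increasing reading word of the column, `x` moves right until it stands in front of the
bumped letter `y`, and then `y` moves on to the end. -/
theorem insertColumn_knuth (x : ℕ+) {c : List ℕ+} (hc : Desc c) :
    KnuthEquiv (x :: c.reverse)
      ((insertColumn x c).1.reverse ++ (insertColumn x c).2.toList) := by
  rcases insertColumn_cases x c with ⟨h1, h2⟩ | ⟨a, y, b, rfl, hy, hu, h2⟩
  · rw [h2]; exact KnuthEquiv.of_eq (by simp)
  · rw [h2]
    have hrev : ((a ++ y :: b).reverse).Pairwise (· < ·) := by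
      rw [List.pairwise_reverse]; exact hc
    simp only [List.reverse_append, List.reverse_cons, List.append_assoc, List.cons_append,
      List.nil_append, Option.toList_some] at hrev ⊢
    have e1 : KnuthEquiv (x :: (b.reverse ++ [y])) (b.reverse ++ [x, y]) := by
      apply knuthEquiv_move_over_smaller hy
      have := List.pairwise_append.mp (by simpa using hrev :
        ((b.reverse ++ [y]) ++ a.reverse).Pairwise (· < ·))
      exact this.1
    have e2 : KnuthEquiv (x :: y :: a.reverse) (x :: (a.reverse ++ [y])) := by
      apply knuthEquiv_move_over_larger hy
      have := (List.pairwise_append.mp hrev).2.1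
      simp only [List.pairwise_cons] at this ⊢
      exact ⟨fun u hu' => hu u (by simpa using hu'), this.2⟩
    have := (e1.append_right a.reverse).trans
      (by simpa using e2.append_left b.reverse)
    simpa using this

/-! ### Insertion of words -/

/-- Insert a word, starting from its last letter, into a column.  The second output is the word of
the bumped letters, in reading order. -/
def insWord : List ℕ+ → List ℕ+ → List ℕ+ × List ℕ+
  | [], c => (c, [])
  | x :: w, c =>
    ((insertColumn x (insWord w c).1).1, (insertColumn x (insWord w c).1).2.toList ++ (insWord w c).2)

/-- Insert a word, starting from its last letter, into a tableau. -/
def insTab (w : List ℕ+) (T : List (List ℕ+)) : List (List ℕ+) :=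
  w.foldr (fun x T => (insertTableau x T).1) T

@[simp] theorem insTab_nil (T : List (List ℕ+)) : insTab [] T = T := rfl

@[simp] theorem insTab_cons (x : ℕ+) (w : List ℕ+) (T : List (List ℕ+)) :
    insTab (x :: w) T = (insertTableau x (insTab w T)).1 := rfl

theorem insTab_append (u v : List ℕ+) (T : List (List ℕ+)) :
    insTab (u ++ v) T = insTab u (insTab v T) := by
  simp [insTab]

theorem insertTableau_cons (x : ℕ+) (c : List ℕ+) (T : List (List ℕ+)) :
    (insertTableau x (c :: T)).1 =
      (insertColumn x c).1 :: insTab (insertColumn x c).2.toList T := by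
  rcases insertColumn_cases x c with ⟨h1, h2⟩ | ⟨a, y, b, rfl, hy, hu, h2⟩ <;>
    simp [insertTableau, h2]

/-- A column sees only the letters that reach it, so a whole word can be pushed through the first
column before the bumped word enters the others. This makes inductions over the columns possible. -/
theorem insTab_cons_right (w c : List ℕ+) (T : List (List ℕ+)) :
    insTab w (c :: T) = (insWord w c).1 :: insTab (insWord w c).2 T := by
  induction w with
  | nil => simp [insWord]
  | cons x w ih => rw [insTab_cons, ih, insertTableau_cons, insWord, insTab_append]

theorem insTab_nil_right {w : List ℕ+} (hw : w ≠ []) : insTab w [] = insTab w [[]] := by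
  induction w with
  | nil => exact absurd rfl hw
  | cons x w ih =>
    cases w with
    | nil => simp [insertTableau, insertColumn]
    | cons y w => rw [insTab_cons, ih (by simp), ← insTab_cons]

theorem insWord_append (u v c : List ℕ+) :
    insWord (u ++ v) c =
      ((insWord u (insWord v c).1).1, (insWord u (insWord v c).1).2 ++ (insWord v c).2) := by
  induction u with
  | nil => simp [insWord]
  | cons x u ih => simp [insWord, ih]

theorem desc_insWord (w : List ℕ+) {c : List ℕ+} (hc : Desc c) : Desc (insWord w c).1 := by
  induction w with
  | nil => exact hc
  | cons x w ih => exact desc_insertColumn ih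

theorem insWord_knuth (w : List ℕ+) {c : List ℕ+} (hc : Desc c) :
    KnuthEquiv (w ++ c.reverse) ((insWord w c).1.reverse ++ (insWord w c).2) := by
  induction w with
  | nil => simpa [insWord] using KnuthEquiv.refl _
  | cons x w ih =>
    have h1 := ih.cons x
    have h2 := (insertColumn_knuth x (desc_insWord w hc)).append_right (insWord w c).2
    simpa [insWord] using h1.trans (by simpa using h2)

@[simp] theorem word_nil : word [] = [] := rfl

@[simp] theorem word_cons (c : List ℕ+) (T : List (List ℕ+)) :
    word (c :: T) = c.reverse ++ word T := by simp [word]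

theorem word_append (S T : List (List ℕ+)) : word (S ++ T) = word S ++ word T := by
  simp [word]

theorem desc_insertTableau (x : ℕ+) {T : List (List ℕ+)} (hT : ∀ c ∈ T, Desc c) :
    ∀ c ∈ (insertTableau x T).1, Desc c := by
  induction T generalizing x with
  | nil => simp [insertTableau]
  | cons c T ih =>
    rw [insertTableau_cons]
    simp only [List.mem_cons, forall_eq_or_imp] at hT ⊢
    refine ⟨desc_insertColumn hT.1, ?_⟩
    cases (insertColumn x c).2 with
    | none => simpa using hT.2
    | some y => simpa using ih y hT.2

theorem desc_insTab (w : List ℕ+) {T : List (List ℕ+)} (hT : ∀ c ∈ T, Desc c) :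
    ∀ c ∈ insTab w T, Desc c := by
  induction w with
  | nil => exact hT
  | cons x w ih => exact desc_insertTableau x ih

theorem insertTableau_knuth (x : ℕ+) {T : List (List ℕ+)} (hT : ∀ c ∈ T, Desc c) :
    KnuthEquiv (word (insertTableau x T).1) (x :: word T) := by
  induction T generalizing x with
  | nil => simpa [insertTableau] using KnuthEquiv.refl _
  | cons c T ih =>
    rw [insertTableau_cons]
    simp only [List.mem_cons, forall_eq_or_imp] at hT
    have h1 := (insertColumn_knuth x hT.1).append_right (word T)
    refine KnuthEquiv.trans ?_ (by simpa using h1.symm)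
    simp only [word_cons]
    apply KnuthEquiv.append_left
    cases (insertColumn x c).2 with
    | none => simpa using KnuthEquiv.refl _
    | some y => simpa using ih y hT.2

theorem insTab_knuth (w : List ℕ+) {T : List (List ℕ+)} (hT : ∀ c ∈ T, Desc c) :
    KnuthEquiv (word (insTab w T)) (w ++ word T) := by
  induction w with
  | nil => exact KnuthEquiv.refl _
  | cons x w ih =>
    exact (insertTableau_knuth x (desc_insTab w hT)).trans (ih.cons x)

/-! ### Knuth equivalent words have the same insertion tableau -/

/-- The two sides of an elementary Knuth relation, without context. -/
inductive KnuthTriple : List ℕ+ → List ℕ+ → Prop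
  | first (x y z : ℕ+) (hxy : y < x) (hyz : z ≤ y) : KnuthTriple [y, x, z] [y, z, x]
  | second (x y z : ℕ+) (hxy : y ≤ x) (hyz : z < y) : KnuthTriple [x, z, y] [z, x, y]

theorem insWord_cons_of_lt {w : List ℕ+} {h : ℕ+} (t : List ℕ+) (hw : ∀ a ∈ w, a < h) :
    insWord w (h :: t) = (h :: (insWord w t).1, (insWord w t).2) := by
  induction w with
  | nil => rfl
  | cons x w ih =>
    simp only [List.mem_cons, forall_eq_or_imp] at hw
    rw [insWord, ih hw.2, insWord, insertColumn_cons_of_lt _ hw.1]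

/-- After `z` has entered the column, `y ≥ z` always finds something to bump, possibly `z` itself,
and this is at least what `z` bumped. Used for the Knuth relations and again for the positions of
successive new boxes. -/
theorem exists_insertColumn_insertColumn {y z : ℕ+} (hzy : z ≤ y) {t : List ℕ+} :
    ∃ a, (insertColumn y (insertColumn z t).1).2 = some a ∧
      (∀ b, (insertColumn z t).2 = some b → b ≤ a) ∧ (a ∈ t ∨ a = z) := by
  induction t with
  | nil => exact ⟨z, by simp [insertColumn, hzy]⟩
  | cons h t ih =>
    rcases le_or_gt h z with hz | hz
    · rw [insertColumn_cons_of_le _ hz, insertColumn_cons_of_le _ hzy]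
      exact ⟨z, rfl, by simp [hz], by simp⟩
    · rw [insertColumn_cons_of_lt _ hz]
      rcases le_or_gt h y with hy | hy
      · rw [insertColumn_cons_of_le _ hy]
        refine ⟨h, rfl, ?_, by simp⟩
        intro b hb
        rcases insertColumn_cases z t with ⟨h1, h2⟩ | ⟨a, y', b', rfl, hy', hu, h2⟩
        · simp [h2] at hb
        · simp only [h2, Option.some.injEq] at hb
          exact (hb ▸ hy').trans hz.le
      · rw [insertColumn_cons_of_lt _ hy]
        obtain ⟨a, h1, h2, h3⟩ := ih
        exact ⟨a, h1, h2, h3.imp (fun h => by simp [h]) id⟩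

/-- On its way down the column the smaller letter `z` stops strictly below the place taken by `y`.
So if `z` bumps, `y` has bumped a higher, hence larger, entry. -/
theorem exists_of_insertColumn_insertColumn {y z b : ℕ+} (hzy : z < y) {t : List ℕ+}
    (ht : Desc t) (hb : (insertColumn z (insertColumn y t).1).2 = some b) :
    ∃ e, (insertColumn y t).2 = some e ∧ b < e ∧ e ∈ t := by
  induction t with
  | nil => simp [insertColumn, hzy.not_ge] at hb
  | cons h t ih =>
    rcases le_or_gt h y with hy | hy
    · rw [insertColumn_cons_of_le _ hy, insertColumn_cons_of_lt _ hzy] at hb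
      refine ⟨h, by rw [insertColumn_cons_of_le _ hy], ?_, by simp⟩
      rcases insertColumn_cases z t with ⟨h1, h2⟩ | ⟨a, y', b', rfl, hy', hu, h2⟩
      · simp [h2] at hb
      · simp only [h2, Option.some.injEq] at hb
        exact (List.pairwise_cons.mp ht).1 b (by simp [hb])
    · rw [insertColumn_cons_of_lt _ hy, insertColumn_cons_of_lt _ (hzy.trans hy)] at hb
      obtain ⟨e, h1, h2, h3⟩ := ih (List.pairwise_cons.mp ht).2 hb
      exact ⟨e, by rw [insertColumn_cons_of_lt _ hy]; exact h1, h2, by simp [h3]⟩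

theorem mem_of_insertColumn {x b : ℕ+} {c : List ℕ+} (h : (insertColumn x c).2 = some b) :
    b ∈ c := by
  rcases insertColumn_cases x c with ⟨h1, h2⟩ | ⟨a, y, b', rfl, hy, hu, h2⟩
  · simp [h2] at h
  · simp only [h2, Option.some.injEq] at h
    simp [h]

/-- Induction down the column. If all three letters are below the head, they pass on to the rest.
Otherwise the largest one ends up as the head on both sides, and it remains to compare the bumped
words; when fewer than three letters are bumped, these words agree. -/
theorem insWord_triple {t t' c : List ℕ+} (hk : KnuthTriple t t') (hc : Desc c) :
    (insWord t c).1 = (insWord t' c).1 ∧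
      ((insWord t c).2 = (insWord t' c).2 ∨ KnuthTriple (insWord t c).2 (insWord t' c).2 ∨
        KnuthTriple (insWord t' c).2 (insWord t c).2) := by
  induction c with
  | nil =>
    cases hk with
    | first x y z hxy hyz =>
      have hzx : z < x := hyz.trans_lt hxy
      simp [insWord, insertColumn, hyz, hxy.not_ge, hzx.le, hzx.not_ge]
    | second x y z hxy hyz =>
      have hzx : z < x := hyz.trans_le hxy
      simp [insWord, insertColumn, hxy, hyz.not_ge, hzx.not_ge]
  | cons h s ih =>
    have hs := List.pairwise_cons.mp hc
    cases hk with
    | first x y z hxy hyz =>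
      have hzx : z < x := hyz.trans_lt hxy
      rcases lt_or_ge x h with hx | hx
      · rw [insWord_cons_of_lt s (by simp; exact ⟨hxy.trans hx, hx, hzx.trans hx⟩),
          insWord_cons_of_lt s (by simp; exact ⟨hxy.trans hx, hzx.trans hx, hx⟩)]
        obtain ⟨h1, h2⟩ := ih hs.2
        exact ⟨by simp [h1], h2⟩
      rcases lt_or_ge z h with hz | hz
      · obtain ⟨a, h1, h2, h3⟩ := exists_insertColumn_insertColumn hyz (t := s)
        have hah : a < h := by
          rcases h3 with h3 | rfl
          · exact hs.1 a h3
          · exact hz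
        simp only [insWord, insertColumn_cons_of_lt _ hz, insertColumn_cons_of_le _ hx,
          insertColumn_cons_of_lt _ hzx, insertColumn_cons_of_lt _ hxy, h1]
        refine ⟨trivial, ?_⟩
        cases hb : (insertColumn z s).2 with
        | none => left; simp
        | some b =>
          right; left
          simpa using KnuthTriple.first h a b hah (h2 b hb)
      · simp only [insWord, insertColumn_cons_of_le _ hx, insertColumn_cons_of_le _ hz,
          insertColumn_cons_of_lt _ hzx, insertColumn_cons_of_lt _ hxy,
          insertColumn_cons_of_le _ hzx.le]
        cases s with
        | nil => simp [insertColumn, hyz]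
        | cons s0 s =>
          have h0 : s0 < h := hs.1 s0 (by simp)
          rw [insertColumn_cons_of_le _ (h0.le.trans hz), insertColumn_cons_of_le _ hyz,
            insertColumn_cons_of_le _ (h0.le.trans (hz.trans hyz))]
          -- Here the kind of the relation changes: a relation `first` among the inserted letters
          -- becomes a reversed `second` among the bumped ones.
          refine ⟨rfl, Or.inr (Or.inr ?_)⟩
          simpa using KnuthTriple.second z h s0 hz h0
    | second x y z hxy hyz =>
      have hzx : z < x := hyz.trans_le hxy
      rcases lt_or_ge x h with hx | hx
      · rw [insWord_cons_of_lt s (by simp; exact ⟨hx, hzx.trans hx, hxy.trans_lt hx⟩),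
          insWord_cons_of_lt s (by simp; exact ⟨hzx.trans hx, hx, hxy.trans_lt hx⟩)]
        obtain ⟨h1, h2⟩ := ih hs.2
        exact ⟨by simp [h1], h2⟩
      rcases lt_or_ge y h with hy | hy
      · simp only [insWord, insertColumn_cons_of_lt _ hy, insertColumn_cons_of_le _ hx,
          insertColumn_cons_of_lt _ hzx, insertColumn_cons_of_lt _ (hyz.trans hy)]
        refine ⟨trivial, ?_⟩
        cases hb : (insertColumn z (insertColumn y s).1).2 with
        | none => left; simp
        | some b =>
          right; left
          obtain ⟨e, h1, h2, h3⟩ := exists_of_insertColumn_insertColumn hyz hs.2 hb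
          simpa [h1] using KnuthTriple.second h e b (hs.1 e h3).le h2
      · simp only [insWord, insertColumn_cons_of_le _ hy, insertColumn_cons_of_le _ hxy,
          insertColumn_cons_of_lt _ hyz, insertColumn_cons_of_lt _ hzx]
        refine ⟨trivial, ?_⟩
        cases hb : (insertColumn z s).2 with
        | none => left; simp
        | some b =>
          right; left
          simpa using KnuthTriple.second y h b hy (hs.1 b (mem_of_insertColumn hb))

theorem insTab_triple {t t' : List ℕ+} (h : KnuthTriple t t') {T : List (List ℕ+)}
    (hT : ∀ c ∈ T, Desc c) : insTab t T = insTab t' T := by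
  induction T generalizing t t' with
  | nil =>
    cases h with
    | first x y z hxy hyz =>
      have hzx : z < x := hyz.trans_lt hxy
      simp [insertTableau, insertColumn, hyz, hxy.not_ge, hzx.le, hzx.not_ge]
    | second x y z hxy hyz =>
      have hzx : z < x := hyz.trans_le hxy
      simp [insertTableau, insertColumn, hxy, hyz.not_ge, hzx.not_ge]
  | cons c T ih =>
    simp only [List.mem_cons, forall_eq_or_imp] at hT
    rw [insTab_cons_right, insTab_cons_right]
    obtain ⟨h1, h2 | h2 | h2⟩ := insWord_triple h hT.1
    · rw [h1, h2]
    · rw [h1, ih h2 hT.2]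
    · rw [h1, ih h2 hT.2]

/-- Letters right of the triple are inserted before it and those left of it afterwards, so the
context does not matter. Together with `word_insTab_knuth` and `IsRSSYT.insTab_word`, every plactic
class contains the word of exactly one tableau. -/
theorem KnuthEquiv.insTab_eq {w w' : List ℕ+} (h : KnuthEquiv w w') :
    insTab w [] = insTab w' [] := by
  induction h with
  | rel a b hab =>
    have hd (v : List ℕ+) : ∀ c ∈ insTab v [], Desc c := desc_insTab v (by simp)
    cases hab with
    | first u v x y z hxy hyz =>
      simp only [insTab_append, insTab_triple (KnuthTriple.first x y z hxy hyz) (hd v)]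
    | second u v x y z hxy hyz =>
      simp only [insTab_append, insTab_triple (KnuthTriple.second x y z hxy hyz) (hd v)]
  | refl a => rfl
  | symm a b _ ih => exact ih.symm
  | trans a b c _ _ ih1 ih2 => exact ih1.trans ih2

theorem word_insTab_knuth (w : List ℕ+) : KnuthEquiv (word (insTab w [])) w := by
  simpa using insTab_knuth w (T := []) (by simp)

/-! ### Tableaux -/

theorem isRSSYT_nil : IsRSSYT [] := ⟨by simp, by simp⟩

/-- The empty list stands in for a missing next column; it satisfies the row condition trivially. -/
theorem isRSSYT_cons {c : List ℕ+} {T : List (List ℕ+)} :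
    IsRSSYT (c :: T) ↔ IsColumn c ∧ RowsWeaklyDecrease c (T.headD []) ∧ IsRSSYT T := by
  cases T with
  | nil => simp [IsRSSYT, rowsWeaklyDecrease_nil]
  | cons d T =>
    simp only [IsRSSYT, List.isChain_cons_cons, List.headD_cons, List.mem_cons, forall_eq_or_imp]
    tauto

theorem IsRSSYT.desc {T : List (List ℕ+)} (hT : IsRSSYT T) : ∀ c ∈ T, Desc c :=
  fun c hc => (hT.1 c hc).2

theorem IsRSSYT.drop {T : List (List ℕ+)} (hT : IsRSSYT T) (j : ℕ) : IsRSSYT (T.drop j) := by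
  induction j generalizing T with
  | zero => simpa using hT
  | succ j ih =>
    cases T with
    | nil => simpa using hT
    | cons c T => simpa using ih (isRSSYT_cons.mp hT).2.2

theorem rowsWeaklyDecrease_refl (c : List ℕ+) : RowsWeaklyDecrease c c :=
  fun _ hd => ⟨hd, le_rfl⟩

theorem rowsWeaklyDecrease_insertColumn (x : ℕ+) (c : List ℕ+) :
    RowsWeaklyDecrease (insertColumn x c).1 c := by
  induction c with
  | nil => exact rowsWeaklyDecrease_nil _
  | cons h t ih =>
    rcases le_or_gt h x with hx | hx
    · rw [insertColumn_cons_of_le _ hx]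
      exact rowsWeaklyDecrease_cons.mpr ⟨hx, rowsWeaklyDecrease_refl t⟩
    · rw [insertColumn_cons_of_lt _ hx]
      exact rowsWeaklyDecrease_cons.mpr ⟨le_rfl, ih⟩

theorem le_of_insertColumn {x y : ℕ+} {c : List ℕ+} (h : (insertColumn x c).2 = some y) :
    y ≤ x := by
  rcases insertColumn_cases x c with ⟨h1, h2⟩ | ⟨a, y', b', rfl, hy, hu, h2⟩
  · simp [h2] at h
  · simp only [h2, Option.some.injEq] at h
    exact h ▸ hy

/-- The bumped letter lands no lower than the row it left, because its right neighbour in that row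
is not larger than it. -/
theorem RowsWeaklyDecrease.insertColumn_insertColumn {x y : ℕ+} {c d : List ℕ+}
    (h : RowsWeaklyDecrease c d) (hy : (insertColumn x c).2 = some y) :
    RowsWeaklyDecrease (insertColumn x c).1 (insertColumn y d).1 := by
  induction c generalizing d with
  | nil => simp [insertColumn] at hy
  | cons g t ih =>
    rcases le_or_gt g x with hx | hx
    · rw [insertColumn_cons_of_le _ hx] at hy ⊢
      obtain rfl : g = y := by simpa using hy
      cases d with
      | nil => exact rowsWeaklyDecrease_cons.mpr ⟨hx, rowsWeaklyDecrease_nil _⟩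
      | cons e d =>
        obtain ⟨h1, h2⟩ := rowsWeaklyDecrease_cons.mp h
        rw [insertColumn_cons_of_le _ h1]
        exact rowsWeaklyDecrease_cons.mpr ⟨hx, h2⟩
    · rw [insertColumn_cons_of_lt _ hx] at hy ⊢
      have hyg : y ≤ g := (le_of_insertColumn hy).trans hx.le
      cases d with
      | nil => exact rowsWeaklyDecrease_cons.mpr ⟨hyg, rowsWeaklyDecrease_nil _⟩
      | cons e d =>
        obtain ⟨h1, h2⟩ := rowsWeaklyDecrease_cons.mp h
        rcases le_or_gt e y with he | he
        · rw [insertColumn_cons_of_le _ he]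
          exact rowsWeaklyDecrease_cons.mpr
            ⟨hyg, (rowsWeaklyDecrease_insertColumn x t).trans h2⟩
        · rw [insertColumn_cons_of_lt _ he]
          exact rowsWeaklyDecrease_cons.mpr ⟨h1, ih h2 hy⟩

theorem insertTableau_headD (x : ℕ+) (T : List (List ℕ+)) :
    (insertTableau x T).1.headD [] = (insertColumn x (T.headD [])).1 := by
  cases T with
  | nil => simp [insertTableau, insertColumn]
  | cons c T => simp [insertTableau_cons]

theorem IsRSSYT.insertTableau {T : List (List ℕ+)} (hT : IsRSSYT T) (x : ℕ+) :
    IsRSSYT (insertTableau x T).1 := by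
  induction T generalizing x with
  | nil =>
    simp only [PlacticKeys.insertTableau, isRSSYT_cons]
    exact ⟨⟨by simp, by simp⟩, rowsWeaklyDecrease_nil _, isRSSYT_nil⟩
  | cons c T ih =>
    rw [insertTableau_cons]
    obtain ⟨h1, h2, h3⟩ := isRSSYT_cons.mp hT
    refine isRSSYT_cons.mpr ⟨isColumn_insertColumn h1.2, ?_⟩
    cases hy : (insertColumn x c).2 with
    | none =>
      exact ⟨(rowsWeaklyDecrease_insertColumn x c).trans h2, h3⟩
    | some y =>
      refine ⟨?_, ih h3 y⟩
      simp only [Option.toList_some, insTab_cons, insTab_nil, insertTableau_headD]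
      exact h2.insertColumn_insertColumn hy

theorem IsRSSYT.insTab {T : List (List ℕ+)} (hT : IsRSSYT T) (w : List ℕ+) :
    IsRSSYT (insTab w T) := by
  induction w with
  | nil => exact hT
  | cons x w ih => exact ih.insertTableau x

/-! ### Inserting a column into a column -/

/-- The result of inserting the entries of the first column, from top to bottom, into the second
one: the new column and the column of the bumped entries. -/
def mergeColumns : List ℕ+ → List ℕ+ → List ℕ+ × List ℕ+
  | [], d => (d, [])
  | h :: t, [] => (h :: t, [])
  | h :: t, g :: d =>
    if g ≤ h then (h :: (mergeColumns t d).1, g :: (mergeColumns t d).2)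
    else (g :: (mergeColumns (h :: t) d).1, (mergeColumns (h :: t) d).2)

theorem mergeColumns_nil_right (c : List ℕ+) : mergeColumns c [] = (c, []) := by
  cases c <;> simp [mergeColumns]

theorem insWord_reverse_nil {c : List ℕ+} (hc : Desc c) : insWord c.reverse [] = (c, []) := by
  induction c with
  | nil => rfl
  | cons h t ih =>
    have hc' := List.pairwise_cons.mp hc
    rw [List.reverse_cons, insWord_append]
    simp only [insWord, insertColumn, Option.toList_none, List.append_nil]
    rw [insWord_cons_of_lt _ (by simpa using hc'.1), ih hc'.2]

/-- The largest letter of `c` is inserted first. If it takes the head of the column, the smaller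
ones can only go below; if it does not reach the head, none of them does. -/
theorem insWord_reverse {c : List ℕ+} (hc : Desc c) (d : List ℕ+) :
    insWord c.reverse d = ((mergeColumns c d).1, (mergeColumns c d).2.reverse) := by
  induction d generalizing c with
  | nil => rw [mergeColumns_nil_right, insWord_reverse_nil hc]; rfl
  | cons g d ih =>
    cases c with
    | nil => simp [insWord, mergeColumns]
    | cons h t =>
      have hc' := List.pairwise_cons.mp hc
      rcases le_or_gt g h with hg | hg
      · rw [List.reverse_cons, insWord_append]
        simp only [insWord, insertColumn_cons_of_le _ hg, mergeColumns, hg, if_true]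
        rw [insWord_cons_of_lt _ (by simpa using hc'.1), ih hc'.2]
        simp
      · rw [insWord_cons_of_lt, ih hc]
        · simp [mergeColumns, hg.not_ge]
        · intro a ha
          rcases List.mem_cons.mp (List.mem_reverse.mp ha) with rfl | ha
          · exact hg
          · exact (hc'.1 a ha).trans hg

theorem insTab_reverse_cons {c : List ℕ+} (hc : Desc c) (d : List ℕ+) (T : List (List ℕ+)) :
    insTab c.reverse (d :: T) =
      (mergeColumns c d).1 :: insTab (mergeColumns c d).2.reverse T := by
  rw [insTab_cons_right, insWord_reverse hc]

theorem insTab_reverse_nil {c : List ℕ+} (hc : IsColumn c) : insTab c.reverse [] = [c] := by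
  rw [insTab_nil_right (by simpa using hc.1), insTab_cons_right, insWord_reverse_nil hc.2]
  rfl

theorem desc_mergeColumns_fst {c d : List ℕ+} (hc : Desc c) (hd : Desc d) :
    Desc (mergeColumns c d).1 := by
  have := desc_insWord c.reverse hd
  rwa [insWord_reverse hc] at this

theorem mergeColumns_snd_sublist (c d : List ℕ+) : (mergeColumns c d).2.Sublist d := by
  induction c, d using mergeColumns.induct with
  | case1 d => simp [mergeColumns]
  | case2 h t => simp [mergeColumns]
  | case3 h t g d hg ih => simpa [mergeColumns, hg] using ih
  | case4 h t g d hg ih => simpa [mergeColumns, hg] using ih.cons g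

theorem desc_mergeColumns_snd {c d : List ℕ+} (hd : Desc d) : Desc (mergeColumns c d).2 :=
  hd.sublist (mergeColumns_snd_sublist c d)

theorem sublist_mergeColumns_fst (c d : List ℕ+) : c.Sublist (mergeColumns c d).1 := by
  induction c, d using mergeColumns.induct with
  | case1 d => simp
  | case2 h t => simp [mergeColumns]
  | case3 h t g d hg ih => simpa [mergeColumns, hg] using ih
  | case4 h t g d hg ih => simpa [mergeColumns, hg] using ih.cons g

theorem length_mergeColumns (c d : List ℕ+) :
    (mergeColumns c d).1.length + (mergeColumns c d).2.length = c.length + d.length := by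
  induction c, d using mergeColumns.induct with
  | case1 d => simp [mergeColumns]
  | case2 h t => simp [mergeColumns]
  | case3 h t g d hg ih => simp [mergeColumns, hg]; omega
  | case4 h t g d hg ih => simp [mergeColumns, hg] at ih ⊢; omega

theorem length_le_mergeColumns_right (c d : List ℕ+) :
    d.length ≤ (mergeColumns c d).1.length := by
  have h1 := length_mergeColumns c d
  induction c, d using mergeColumns.induct with
  | case1 d => simp [mergeColumns]
  | case2 h t => simp
  | case3 h t g d hg ih =>
    have := ih (length_mergeColumns _ _)
    simpa [mergeColumns, hg] using this
  | case4 h t g d hg ih =>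
    have := ih (length_mergeColumns _ _)
    simpa [mergeColumns, hg] using this

theorem length_le_mergeColumns_left (c d : List ℕ+) :
    c.length ≤ (mergeColumns c d).1.length :=
  (sublist_mergeColumns_fst c d).length_le

theorem RowsWeaklyDecrease.mergeColumns_eq {c d : List ℕ+} (h : RowsWeaklyDecrease c d) :
    mergeColumns c d = (c, d) := by
  induction c generalizing d with
  | nil =>
    cases d with
    | nil => rfl
    | cons g d => exact absurd h (rowsWeaklyDecrease_nil_cons _ _)
  | cons x c ih =>
    cases d with
    | nil => rfl
    | cons g d =>
      obtain ⟨h1, h2⟩ := rowsWeaklyDecrease_cons.mp h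
      simp [mergeColumns, h1, ih h2]

theorem mergeColumns_knuth {c d : List ℕ+} (hc : Desc c) (hd : Desc d) :
    KnuthEquiv (c.reverse ++ d.reverse)
      ((mergeColumns c d).1.reverse ++ (mergeColumns c d).2.reverse) := by
  have := insWord_knuth c.reverse hd
  rwa [insWord_reverse hc] at this

theorem IsRSSYT.insTab_reverse {c : List ℕ+} {T : List (List ℕ+)} (hT : IsRSSYT (c :: T)) :
    PlacticKeys.insTab c.reverse T = c :: T := by
  induction T generalizing c with
  | nil => exact insTab_reverse_nil (isRSSYT_cons.mp hT).1
  | cons d T ih =>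
    obtain ⟨h1, h2, h3⟩ := isRSSYT_cons.mp hT
    rw [insTab_reverse_cons h1.2]
    rw [List.headD_cons] at h2
    rw [h2.mergeColumns_eq, ih h3]

/-- Neighbouring columns of a tableau merge without change, so reinserting the columns from the
right reproduces the tableau: tableaux are normal forms. -/
theorem IsRSSYT.insTab_word {T : List (List ℕ+)} (hT : IsRSSYT T) :
    PlacticKeys.insTab (word T) [] = T := by
  induction T with
  | nil => rfl
  | cons c T ih =>
    rw [word_cons, insTab_append, ih (isRSSYT_cons.mp hT).2.2, hT.insTab_reverse]

theorem KnuthEquiv.insTab_eq_of_isRSSYT {w : List ℕ+} {T : List (List ℕ+)}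
    (h : KnuthEquiv w (word T)) (hT : IsRSSYT T) : insTab w [] = T := by
  rw [h.insTab_eq, hT.insTab_word]

/-- If a word that starts with a column of maximal length is inserted, then this column is the first
column of the tableau. -/
theorem insTab_strip {B C w : List ℕ+} {T : List (List ℕ+)} (hB : Desc B)
    (h : insTab (B.reverse ++ w) [] = C :: T) (hBC : B.length = C.length) (hC : C ≠ []) :
    B = C ∧ insTab w [] = T := by
  have hS : IsRSSYT (insTab w []) := isRSSYT_nil.insTab w
  rw [insTab_append] at h
  rcases hSw : insTab w [] with _ | ⟨d, S⟩
  · rw [hSw, insTab_reverse_nil ⟨by rintro rfl; exact hC (List.length_eq_zero_iff.mp hBC.symm), hB⟩] at h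
    simp at h
    exact ⟨h.1, h.2.symm⟩
  · rw [hSw] at h hS
    rw [insTab_reverse_cons hB] at h
    simp only [List.cons.injEq] at h
    obtain ⟨h1, h2⟩ := h
    -- `B` is a subsequence of the merged column, which has the same length. Consequently the bumped
    -- column has the length of `d` and is `d`.
    have h3 : B = C := by
      rw [← h1]
      exact (sublist_mergeColumns_fst B d).eq_of_length (by rw [hBC, h1])
    have h4 : (mergeColumns B d).2 = d := by
      apply (mergeColumns_snd_sublist B d).eq_of_length
      have := length_mergeColumns B d
      rw [h1, hBC] at this
      omega
    rw [h4, hS.insTab_reverse] at h2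
    exact ⟨h3, h2⟩

/-! ### Sums of squares of the column lengths -/

/-- The sum of the squares of the column lengths. -/
def squareSum (V : List (List ℕ+)) : ℕ := (V.map fun c => c.length ^ 2).sum

/-- A merge replaces two lengths by two with the same sum, the first of which is at least both old
ones; this cannot lower the sum of the squares. That sum takes the place of the dominance order when
the shape of the evacuation tableau is determined. -/
theorem squareSum_insTab_reverse {v : List ℕ+} (hv : Desc v) {T : List (List ℕ+)}
    (hT : ∀ c ∈ T, Desc c) : v.length ^ 2 + squareSum T ≤ squareSum (insTab v.reverse T) := by
  induction T generalizing v with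
  | nil =>
    by_cases h : v = []
    · subst h; simp
    · rw [insTab_reverse_nil ⟨h, hv⟩]; simp [squareSum]
  | cons d T ih =>
    simp only [List.mem_cons, forall_eq_or_imp] at hT
    rw [insTab_reverse_cons hv]
    have h1 := ih (desc_mergeColumns_snd (c := v) hT.1) hT.2
    simp only [squareSum, List.map_cons, List.sum_cons] at h1 ⊢
    have h2 := length_mergeColumns v d
    have h3 := length_le_mergeColumns_left v d
    have h4 := length_le_mergeColumns_right v d
    generalize (mergeColumns v d).1.length = p at *
    generalize (mergeColumns v d).2.length = q at *
    generalize v.length = a at *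
    generalize d.length = b at *
    have : a ^ 2 + b ^ 2 ≤ p ^ 2 + q ^ 2 := by
      obtain ⟨e, rfl⟩ := Nat.exists_eq_add_of_le h3
      obtain rfl : b = e + q := by omega
      -- With `p = a + e` and `b = e + q`, the two sides differ by `2 * e * (a - q)`.
      nlinarith [Nat.mul_le_mul_left e (by omega : q ≤ a)]
    omega

theorem squareSum_le_insTab {V : List (List ℕ+)} (hV : ∀ c ∈ V, Desc c) :
    squareSum V ≤ squareSum (insTab (word V) []) := by
  induction V with
  | nil => simp
  | cons v V ih =>
    simp only [List.mem_cons, forall_eq_or_imp] at hV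
    rw [word_cons, insTab_append]
    have h1 := squareSum_insTab_reverse hV.1 (desc_insTab (word V) (T := []) (by simp))
    have h2 := ih hV.2
    simp only [squareSum, List.map_cons, List.sum_cons] at h1 h2 ⊢
    omega

/-! ### Increasing subwords -/

/-- `s` is a strictly increasing subword of `w` with letters at most `k`. -/
def IsIncSubword (k : ℕ) (w s : List ℕ+) : Prop :=
  s.Sublist w ∧ s.Pairwise (· < ·) ∧ ∀ a ∈ s, (a : ℕ) ≤ k

/-- The maximal length of a strictly increasing subword with letters at most `k`. -/
noncomputable def maxInc (k : ℕ) (w : List ℕ+) : ℕ :=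
  sSup {n | ∃ s, IsIncSubword k w s ∧ s.length = n}

/-- All strictly increasing subwords of `w` have length at most `n`. -/
def IncBound (w : List ℕ+) (n : ℕ) : Prop :=
  ∀ s : List ℕ+, s.Sublist w → s.Pairwise (· < ·) → s.length ≤ n

theorem maxInc_bddAbove (k : ℕ) (w : List ℕ+) :
    BddAbove {n | ∃ s, IsIncSubword k w s ∧ s.length = n} := by
  refine ⟨w.length, ?_⟩
  rintro n ⟨s, hs, rfl⟩
  exact hs.1.length_le

theorem IsIncSubword.length_le {k : ℕ} {w s : List ℕ+} (h : IsIncSubword k w s) :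
    s.length ≤ maxInc k w :=
  le_csSup (maxInc_bddAbove k w) ⟨s, h, rfl⟩

theorem exists_isIncSubword (k : ℕ) (w : List ℕ+) :
    ∃ s, IsIncSubword k w s ∧ s.length = maxInc k w :=
  Nat.sSup_mem (s := {n | ∃ s, IsIncSubword k w s ∧ s.length = n})
    ⟨0, [], ⟨by simp, by simp, by simp⟩, rfl⟩ (maxInc_bddAbove k w)

theorem maxInc_mono {w w' : List ℕ+} (k : ℕ) (h : w.Sublist w') : maxInc k w ≤ maxInc k w' := by
  obtain ⟨s, hs, hl⟩ := exists_isIncSubword k w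
  rw [← hl]
  exact IsIncSubword.length_le ⟨hs.1.trans h, hs.2⟩

theorem maxInc_le_of_incBound {w : List ℕ+} {n : ℕ} (k : ℕ) (h : IncBound w n) :
    maxInc k w ≤ n := by
  obtain ⟨s, hs, hl⟩ := exists_isIncSubword k w
  rw [← hl]
  exact h s hs.1 hs.2.1

theorem IncBound.sublist {w w' : List ℕ+} {n : ℕ} (h : IncBound w n) (hw : w'.Sublist w) :
    IncBound w' n := fun s hs => h s (hs.trans hw)

theorem maxInc_cons_of_lt {k : ℕ} {x : ℕ+} (w : List ℕ+) (hx : k < x) :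
    maxInc k (x :: w) = maxInc k w := by
  refine le_antisymm ?_ (maxInc_mono k (List.sublist_cons_self x w))
  obtain ⟨s, hs, hl⟩ := exists_isIncSubword k (x :: w)
  rw [← hl]
  refine IsIncSubword.length_le ⟨?_, hs.2⟩
  rcases List.sublist_cons_iff.mp hs.1 with h | ⟨r, rfl, h⟩
  · exact h
  · have := hs.2.2 x (by simp)
    omega

theorem maxInc_eq_zero {k : ℕ} {w : List ℕ+} (h : ∀ a ∈ w, k < (a : ℕ)) : maxInc k w = 0 := by
  induction w with
  | nil =>
    obtain ⟨s, hs, hl⟩ := exists_isIncSubword k []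
    rw [← hl, List.sublist_nil.mp hs.1]; rfl
  | cons x w ih =>
    rw [maxInc_cons_of_lt w (h x (by simp))]
    exact ih fun a ha => h a (by simp [ha])

theorem maxInc_pos {k : ℕ} {w : List ℕ+} {a : ℕ+} (ha : a ∈ w) (hk : (a : ℕ) ≤ k) :
    1 ≤ maxInc k w :=
  IsIncSubword.length_le (s := [a]) ⟨by simpa using ha, by simp, by simpa using hk⟩

/-- Only a pair `z x` whose order is inverted has to be altered, and then `y` replaces one of its
letters. The last two clauses keep the new letters within the range of the old ones, so that they
fit between the other letters of a longer subword. -/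
theorem exists_increasing_of_triple {t t' s : List ℕ+} (h : KnuthTriple t t' ∨ KnuthTriple t' t)
    (hs : s.Sublist t) (hi : s.Pairwise (· < ·)) :
    ∃ s' : List ℕ+, s'.Sublist t' ∧ s'.Pairwise (· < ·) ∧ s'.length = s.length ∧
      (∀ a' ∈ s', ∃ a ∈ s, a ≤ a') ∧ (∀ a' ∈ s', ∃ a ∈ s, a' ≤ a) := by
  have key (hs' : s.Sublist t') : ∃ s' : List ℕ+, s'.Sublist t' ∧ s'.Pairwise (· < ·) ∧
      s'.length = s.length ∧ (∀ a' ∈ s', ∃ a ∈ s, a ≤ a') ∧ (∀ a' ∈ s', ∃ a ∈ s, a' ≤ a) :=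
    ⟨s, hs', hi, rfl, fun a ha => ⟨a, ha, le_rfl⟩, fun a ha => ⟨a, ha, le_rfl⟩⟩
  have hm := List.mem_sublists.mpr hs
  rcases h with h | h
  · cases h with
    | first x y z hxy hyz =>
      simp [List.sublists] at hm
      rcases hm with rfl | rfl | rfl | rfl | rfl | rfl | rfl | rfl
      all_goals first
        | (apply key; apply List.mem_sublists.mp; simp [List.sublists]; done)
        | (exfalso; simp at hi; order)
    | second x y z hxy hyz =>
      simp [List.sublists] at hm
      rcases hm with rfl | rfl | rfl | rfl | rfl | rfl | rfl | rfl
      all_goals first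
        | (apply key; apply List.mem_sublists.mp; simp [List.sublists]; done)
        | (exfalso; simp at hi; order)
  · cases h with
    | first x y z hxy hyz =>
      simp [List.sublists] at hm
      rcases hm with rfl | rfl | rfl | rfl | rfl | rfl | rfl | rfl
      all_goals first
        | (apply key; apply List.mem_sublists.mp; simp [List.sublists]; done)
        | (exfalso; simp at hi; order)
        | exact ⟨[y, x], by apply List.mem_sublists.mp; simp [List.sublists], by simpa using hxy,
            rfl, by simp [hyz], by simp [hxy.le]⟩
    | second x y z hxy hyz =>
      simp [List.sublists] at hm
      rcases hm with rfl | rfl | rfl | rfl | rfl | rfl | rfl | rfl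
      all_goals first
        | (apply key; apply List.mem_sublists.mp; simp [List.sublists]; done)
        | (exfalso; simp at hi; order)
        | exact ⟨[z, y], by apply List.mem_sublists.mp; simp [List.sublists], by simpa using hyz,
            rfl, by simp [hyz.le], by simp [hxy]⟩

theorem exists_isIncSubword_of_triple {k : ℕ} {u v t t' s : List ℕ+}
    (h : KnuthTriple t t' ∨ KnuthTriple t' t) (hs : IsIncSubword k (u ++ t ++ v) s) :
    ∃ s', IsIncSubword k (u ++ t' ++ v) s' ∧ s'.length = s.length := by
  obtain ⟨hs1, hs2, hs3⟩ := hs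
  obtain ⟨s12, s3, rfl, hs12, hsv⟩ := List.sublist_append_iff.mp hs1
  obtain ⟨s1, s2, rfl, hsu, hst⟩ := List.sublist_append_iff.mp hs12
  simp only [List.pairwise_append, List.mem_append] at hs2 hs3
  obtain ⟨⟨h1, h2, h3⟩, h4, h5⟩ := hs2
  obtain ⟨s2', g1, g2, g3, g4, g5⟩ := exists_increasing_of_triple h hst h2
  refine ⟨s1 ++ s2' ++ s3, ⟨(hsu.append g1).append hsv, ?_, ?_⟩, by simp [g3]⟩
  · simp only [List.pairwise_append, List.mem_append]
    refine ⟨⟨h1, g2, ?_⟩, h4, ?_⟩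
    · intro a ha b hb
      obtain ⟨c, hc, hcb⟩ := g4 b hb
      exact (h3 a ha c hc).trans_le hcb
    · rintro a (ha | ha) b hb
      · exact h5 a (Or.inl ha) b hb
      · obtain ⟨c, hc, hca⟩ := g5 a ha
        exact hca.trans_lt (h5 c (Or.inr hc) b hb)
  · intro a ha
    simp only [List.mem_append] at ha
    rcases ha with (ha | ha) | ha
    · exact hs3 a (Or.inl (Or.inl ha))
    · obtain ⟨c, hc, hca⟩ := g5 a ha
      have h6 : (a : ℕ) ≤ c := hca
      exact h6.trans (hs3 c (Or.inl (Or.inr hc)))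
    · exact hs3 a (Or.inr ha)

theorem maxInc_le_of_triple {t t' : List ℕ+} (k : ℕ) (u v : List ℕ+)
    (h : KnuthTriple t t' ∨ KnuthTriple t' t) :
    maxInc k (u ++ t ++ v) ≤ maxInc k (u ++ t' ++ v) := by
  obtain ⟨s, hs, hl⟩ := exists_isIncSubword k (u ++ t ++ v)
  obtain ⟨s', hs', hl'⟩ := exists_isIncSubword_of_triple h hs
  rw [← hl, ← hl']
  exact hs'.length_le

theorem KnuthStep.exists_triple {w w' : List ℕ+} (h : KnuthStep w w') :
    ∃ u v t t', w = u ++ t ++ v ∧ w' = u ++ t' ++ v ∧ KnuthTriple t t' := by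
  cases h with
  | first u v x y z hxy hyz => exact ⟨u, v, _, _, rfl, rfl, KnuthTriple.first x y z hxy hyz⟩
  | second u v x y z hxy hyz => exact ⟨u, v, _, _, rfl, rfl, KnuthTriple.second x y z hxy hyz⟩

theorem KnuthTriple.knuthEquiv {t t' : List ℕ+} (h : KnuthTriple t t') (u v : List ℕ+) :
    KnuthEquiv (u ++ t ++ v) (u ++ t' ++ v) := by
  cases h with
  | first x y z hxy hyz => exact KnuthEquiv.step (KnuthStep.first u v x y z hxy hyz)
  | second x y z hxy hyz => exact KnuthEquiv.step (KnuthStep.second u v x y z hxy hyz)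

/-- Greene's invariant for a single increasing subword, with the alphabet cut off at `k`. The
cut-off is what makes individual entries of the keys visible. -/
theorem KnuthEquiv.maxInc_eq {w w' : List ℕ+} (h : KnuthEquiv w w') (k : ℕ) :
    maxInc k w = maxInc k w' := by
  induction h with
  | rel a b hab =>
    obtain ⟨u, v, t, t', rfl, rfl, h⟩ := hab.exists_triple
    exact le_antisymm (maxInc_le_of_triple k u v (Or.inl h)) (maxInc_le_of_triple k u v (Or.inr h))
  | refl a => rfl
  | symm a b _ ih => exact ih.symm
  | trans a b c _ _ ih1 ih2 => exact ih1.trans ih2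

theorem exists_bound (w : List ℕ+) : ∃ N : ℕ, ∀ a ∈ w, (a : ℕ) ≤ N := by
  induction w with
  | nil => exact ⟨0, by simp⟩
  | cons x w ih =>
    obtain ⟨N, hN⟩ := ih
    refine ⟨max x N, ?_⟩
    simp only [List.mem_cons, forall_eq_or_imp, le_max_iff, le_refl, true_or, true_and]
    exact fun a ha => Or.inr (hN a ha)

theorem incBound_iff {w : List ℕ+} {n : ℕ} : IncBound w n ↔ ∀ k, maxInc k w ≤ n := by
  refine ⟨fun h k => maxInc_le_of_incBound k h, fun h s hs hi => ?_⟩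
  obtain ⟨N, hN⟩ := exists_bound s
  exact (IsIncSubword.length_le ⟨hs, hi, hN⟩).trans (h N)

theorem IncBound.knuthEquiv {w w' : List ℕ+} {n : ℕ} (h : IncBound w n) (hw : KnuthEquiv w w') :
    IncBound w' n := by
  rw [incBound_iff] at h ⊢
  intro k
  rw [← hw.maxInc_eq]
  exact h k

theorem pairwise_reverse_of_desc {c : List ℕ+} (hc : Desc c) : c.reverse.Pairwise (· < ·) := by
  rw [List.pairwise_reverse]; exact hc

theorem filter_le_append_filter_not_le {l : List ℕ+} (hl : l.Pairwise (· < ·)) (k : ℕ) :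
    (l.filter fun a : ℕ+ => (a : ℕ) ≤ k) ++ (l.filter fun a : ℕ+ => ¬ (a : ℕ) ≤ k) = l := by
  induction l with
  | nil => rfl
  | cons a l ih =>
    have hl' := List.pairwise_cons.mp hl
    by_cases ha : (a : ℕ) ≤ k
    · simpa [List.filter_cons, ha] using ih hl'.2
    · have h7 : l.filter (fun a : ℕ+ => decide ((a : ℕ) ≤ k)) = [] := by
        rw [List.filter_eq_nil_iff]
        intro b hb
        have h8 : (a : ℕ) < b := hl'.1 b hb
        simp
        omega
      have := ih hl'.2
      rw [h7] at this
      simpa [List.filter_cons, ha, not_le.mp ha, h7] using this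

/-- If a word ends with a column, then an increasing subword with letters at most `k` can be extended
by the letters of the column that are larger than `k`. -/
theorem maxInc_add_countP_le {w K : List ℕ+} {n : ℕ} (hK : Desc K)
    (h : IncBound (w ++ K.reverse) n) (k : ℕ) :
    maxInc k (w ++ K.reverse) + K.countP (fun a : ℕ+ => ¬ (a : ℕ) ≤ k) ≤ n := by
  have hKr := pairwise_reverse_of_desc hK
  obtain ⟨s, ⟨hs1, hs2, hs3⟩, hl⟩ := exists_isIncSubword k (w ++ K.reverse)
  rw [← hl]
  obtain ⟨s1, s2, rfl, h1, h2⟩ := List.sublist_append_iff.mp hs1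
  have h3 : s2.Sublist (K.reverse.filter fun a : ℕ+ => (a : ℕ) ≤ k) := by
    have := h2.filter (fun a : ℕ+ => decide ((a : ℕ) ≤ k))
    rwa [List.filter_eq_self.mpr] at this
    intro a ha
    simpa using hs3 a (by simp [ha])
  have h4 : ((s1 ++ s2) ++ K.reverse.filter fun a : ℕ+ => ¬ (a : ℕ) ≤ k).Pairwise (· < ·) := by
    rw [List.pairwise_append]
    refine ⟨hs2, hKr.sublist List.filter_sublist, ?_⟩
    intro a ha b hb
    have h5 := hs3 a ha
    have h6 : ¬ (b : ℕ) ≤ k := by simpa using (List.mem_filter.mp hb).2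
    have : (a : ℕ) < b := by omega
    exact this
  have h5 := h3.append (List.Sublist.refl (K.reverse.filter fun a : ℕ+ => ¬ (a : ℕ) ≤ k))
  rw [filter_le_append_filter_not_le hKr] at h5
  have h6 := h _ (by rw [List.append_assoc]; exact h1.append h5) h4
  simp only [List.length_append, ← List.countP_eq_length_filter, List.countP_reverse] at h6 ⊢
  omega

theorem length_eq_countP_le_add (K : List ℕ+) (k : ℕ) : K.length =
    K.countP (fun a : ℕ+ => (a : ℕ) ≤ k) + K.countP (fun a : ℕ+ => ¬ (a : ℕ) ≤ k) := by
  simpa using List.length_eq_countP_add_countP (fun a : ℕ+ => decide ((a : ℕ) ≤ k)) (l := K)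

/-- If a word ends with a column whose length is the maximal length of an increasing subword, then
the entries of the column are determined by the lengths of increasing subwords. -/
theorem maxInc_eq_countP {w K : List ℕ+} (hK : Desc K) (h : IncBound (w ++ K.reverse) K.length)
    (k : ℕ) : maxInc k (w ++ K.reverse) = K.countP (fun a : ℕ+ => (a : ℕ) ≤ k) := by
  have hKr := pairwise_reverse_of_desc hK
  apply le_antisymm
  · have h1 := maxInc_add_countP_le hK h k
    have h2 := length_eq_countP_le_add K k
    omega
  · have := IsIncSubword.length_le (k := k) (w := w ++ K.reverse)
      (s := K.reverse.filter fun a : ℕ+ => (a : ℕ) ≤ k)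
      ⟨List.filter_sublist.trans (List.sublist_append_right _ _),
        hKr.sublist List.filter_sublist, fun a ha => by simpa using (List.mem_filter.mp ha).2⟩
    rwa [← List.countP_eq_length_filter, List.countP_reverse] at this

/-! ### Increasing subwords of tableaux -/

theorem RowsWeaklyDecrease.countP_le {c d : List ℕ+} (h : RowsWeaklyDecrease c d) (v : ℕ+) :
    d.countP (fun a => v ≤ a) ≤ c.countP (fun a => v ≤ a) := by
  induction c generalizing d with
  | nil =>
    cases d with
    | nil => rfl
    | cons g d => exact absurd h (rowsWeaklyDecrease_nil_cons _ _)
  | cons x c ih =>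
    cases d with
    | nil => simp
    | cons g d =>
      obtain ⟨h1, h2⟩ := rowsWeaklyDecrease_cons.mp h
      have h3 := ih h2
      simp only [List.countP_cons, decide_eq_true_eq]
      split_ifs with h4 h5
      · omega
      · exact absurd (h4.trans h1) h5
      · omega
      · omega

/-- Let `b` be the first letter taken outside the first column. By induction the letters from `b` on
are at most as many as the entries `≥ b` of the second column, of which the first column has at
least as many; the earlier letters use entries of the first column in `[v, b)`. -/
theorem IsRSSYT.length_le_countP {T : List (List ℕ+)} (hT : IsRSSYT T) {s : List ℕ+} {v : ℕ+}
    (hs : s.Sublist (word T)) (hi : s.Pairwise (· < ·)) (hv : ∀ a ∈ s, v ≤ a) :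
    s.length ≤ (T.headD []).countP (fun a => v ≤ a) := by
  induction T generalizing s v with
  | nil =>
    rw [List.sublist_nil.mp hs]
    simp
  | cons c T ih =>
    obtain ⟨h1, h2, h3⟩ := isRSSYT_cons.mp hT
    rw [word_cons] at hs
    obtain ⟨s1, s2, rfl, hs1, hs2⟩ := List.sublist_append_iff.mp hs
    obtain ⟨hi1, hi2, hi3⟩ := List.pairwise_append.mp hi
    simp only [List.headD_cons, List.length_append]
    have hs1' : s1.length ≤ s1.countP (fun a => v ≤ a) := by
      rw [List.countP_eq_length.mpr]
      intro a ha
      simpa using hv a (by simp [ha])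
    cases s2 with
    | nil =>
      have := hs1.countP_le (p := fun a => decide (v ≤ a))
      rw [List.countP_reverse] at this
      simp only [List.length_nil]
      omega
    | cons b s2 =>
      have h4 := ih h3 hs2 hi2 (v := b) (by
        intro a ha
        rcases List.mem_cons.mp ha with rfl | ha
        · exact le_rfl
        · exact ((List.pairwise_cons.mp hi2).1 a ha).le)
      have h5 := h2.countP_le b
      have h6 : (s1.filter fun a => ¬ b ≤ a).length = s1.length := by
        rw [List.filter_eq_self.mpr]
        intro a ha
        simpa using hi3 a ha b (by simp)
      have h7 := (hs1.filter (fun a => decide (v ≤ a))).countP_le (p := fun a => decide (¬ b ≤ a))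
      have hvb : v ≤ b := hv b (by simp)
      have h8 : c.countP (fun a => v ≤ a) =
          c.countP (fun a => b ≤ a) + (c.filter fun a => v ≤ a).countP (fun a => ¬ b ≤ a) := by
        clear * - hvb
        induction c with
        | nil => rfl
        | cons x c ih =>
          rcases lt_or_ge x v with h1 | h1
          · simpa [h1.not_ge, (h1.trans_le hvb).not_ge] using ih
          · rcases lt_or_ge x b with h2 | h2
            · simp [h1, h2, h2.not_ge] at ih ⊢; omega
            · simp [h1, h2, h2.not_gt] at ih ⊢; omega
      have h9 : s1.filter (fun a => decide (v ≤ a)) = s1 := by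
        rw [List.filter_eq_self]
        intro a ha
        simpa using hv a (by simp [ha])
      rw [h9, List.countP_eq_length_filter, h6, List.filter_reverse, List.countP_reverse] at h7
      omega

/-- With `v = 1` every letter counts. The first column, read upwards, attains the bound. -/
theorem IsRSSYT.incBound {T : List (List ℕ+)} (hT : IsRSSYT T) :
    IncBound (word T) (T.headD []).length := fun _ hs hi =>
  (hT.length_le_countP (v := 1) hs hi (fun _ _ => one_le)).trans List.countP_le_length

/-! ### The order-reversing involution -/

/-- The order-reversing involution of the letters at most `N`. -/
def flipLetter (N : ℕ) (a : ℕ+) : ℕ+ := (N + 1 - a : ℕ).toPNat'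

/-- Reverse a word, and flip its letters. -/
def star (N : ℕ) (w : List ℕ+) : List ℕ+ := (w.map (flipLetter N)).reverse

/-- Reverse a list of columns, and flip the entries. -/
def starColumns (N : ℕ) (V : List (List ℕ+)) : List (List ℕ+) := (V.map (star N)).reverse

/-- For letters above `N` the truncated subtraction gives the default value 1, so the facts about
flipping carry a bound by `N`. -/
theorem coe_flipLetter {N : ℕ} {a : ℕ+} (ha : (a : ℕ) ≤ N) : (flipLetter N a : ℕ) = N + 1 - a := by
  rw [flipLetter, Nat.toPNat'_coe, if_pos (by omega)]

theorem flipLetter_le {N : ℕ} {a : ℕ+} (ha : (a : ℕ) ≤ N) : (flipLetter N a : ℕ) ≤ N := by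
  have := a.pos
  rw [coe_flipLetter ha]; omega

theorem flipLetter_flipLetter {N : ℕ} {a : ℕ+} (ha : (a : ℕ) ≤ N) :
    flipLetter N (flipLetter N a) = a := by
  apply PNat.coe_injective
  have := a.pos
  rw [coe_flipLetter (flipLetter_le ha), coe_flipLetter ha]; omega

theorem flipLetter_lt {N : ℕ} {a b : ℕ+} (h : a < b) (hb : (b : ℕ) ≤ N) :
    flipLetter N b < flipLetter N a := by
  have h' : (a : ℕ) < b := h
  change (flipLetter N b : ℕ) < flipLetter N a
  rw [coe_flipLetter hb, coe_flipLetter (by omega)]; omega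

theorem flipLetter_mono {N : ℕ} {a b : ℕ+} (h : a ≤ b) (hb : (b : ℕ) ≤ N) :
    flipLetter N b ≤ flipLetter N a := by
  rcases h.eq_or_lt with rfl | h
  · exact le_rfl
  · exact (flipLetter_lt h hb).le

@[simp] theorem star_nil (N : ℕ) : star N [] = [] := rfl

theorem star_append (N : ℕ) (u v : List ℕ+) : star N (u ++ v) = star N v ++ star N u := by
  simp [star]

theorem star_reverse (N : ℕ) (u : List ℕ+) : star N u.reverse = (star N u).reverse := by
  simp [star]

@[simp] theorem length_star (N : ℕ) (u : List ℕ+) : (star N u).length = u.length := by simp [star]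

theorem mem_star {N : ℕ} {a : ℕ+} {w : List ℕ+} : a ∈ star N w ↔ ∃ b ∈ w, flipLetter N b = a := by
  simp [star]

theorem star_le {N : ℕ} {w : List ℕ+} (hw : ∀ a ∈ w, (a : ℕ) ≤ N) :
    ∀ a ∈ star N w, (a : ℕ) ≤ N := by
  intro a ha
  obtain ⟨b, hb, rfl⟩ := mem_star.mp ha
  exact flipLetter_le (hw b hb)

theorem star_star {N : ℕ} {w : List ℕ+} (hw : ∀ a ∈ w, (a : ℕ) ≤ N) : star N (star N w) = w := by
  simp only [star, List.map_reverse, List.reverse_reverse, List.map_map]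
  refine (List.map_congr_left (g := id) fun a ha => ?_).trans (List.map_id _)
  exact flipLetter_flipLetter (hw a ha)

theorem pairwise_gt_star {N : ℕ} {w : List ℕ+} (hw : ∀ a ∈ w, (a : ℕ) ≤ N) (h : Desc w) :
    Desc (star N w) := by
  rw [Desc, star, List.pairwise_reverse, List.pairwise_map]
  refine h.imp_of_mem ?_
  intro a b ha hb hab
  exact flipLetter_lt hab (hw a ha)

theorem pairwise_lt_star {N : ℕ} {w : List ℕ+} (hw : ∀ a ∈ w, (a : ℕ) ≤ N)
    (h : w.Pairwise (· < ·)) : (star N w).Pairwise (· < ·) := by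
  rw [star, List.pairwise_reverse, List.pairwise_map]
  refine h.imp_of_mem ?_
  intro a b ha hb hab
  exact flipLetter_lt hab (hw b hb)

/-- Reversal and complement exchange the two kinds of Knuth relations. -/
theorem KnuthTriple.star {N : ℕ} {t t' : List ℕ+} (h : KnuthTriple t t')
    (ht : ∀ a ∈ t, (a : ℕ) ≤ N) :
    KnuthTriple (star N t) (star N t') := by
  cases h with
  | first x y z hxy hyz =>
    simp only [List.mem_cons, List.not_mem_nil, or_false, forall_eq_or_imp, forall_eq] at ht
    simpa [PlacticKeys.star] using KnuthTriple.second (flipLetter N z) (flipLetter N y)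
      (flipLetter N x) (flipLetter_mono hyz ht.1) (flipLetter_lt hxy ht.2.1)
  | second x y z hxy hyz =>
    simp only [List.mem_cons, List.not_mem_nil, or_false, forall_eq_or_imp, forall_eq] at ht
    simpa [PlacticKeys.star] using KnuthTriple.first (flipLetter N z) (flipLetter N y)
      (flipLetter N x) (flipLetter_lt hyz ht.2.2) (flipLetter_mono hxy ht.1)

theorem KnuthEquiv.star {N : ℕ} {w w' : List ℕ+} (h : KnuthEquiv w w')
    (hw : ∀ a ∈ w, (a : ℕ) ≤ N) : KnuthEquiv (star N w) (star N w') := by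
  induction h with
  | rel a b hab =>
    obtain ⟨u, v, t, t', rfl, rfl, h⟩ := hab.exists_triple
    simp only [star_append, ← List.append_assoc]
    have ht : ∀ a ∈ t, (a : ℕ) ≤ N := fun a ha => hw a (by simp [ha])
    exact (h.star ht).knuthEquiv _ _
  | refl a => exact KnuthEquiv.refl _
  | symm a b h ih => exact (ih fun x hx => hw x ((KnuthEquiv.perm h).mem_iff.mp hx)).symm
  | trans a b c h1 h2 ih1 ih2 =>
    exact (ih1 hw).trans (ih2 fun x hx => hw x ((KnuthEquiv.perm h1).mem_iff.mpr hx))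

theorem star_sublist {s w : List ℕ+} (N : ℕ) (h : s.Sublist w) :
    (star N s).Sublist (star N w) := (h.map _).reverse

theorem IncBound.star {N n : ℕ} {w : List ℕ+} (h : IncBound w n) (hw : ∀ a ∈ w, (a : ℕ) ≤ N) :
    IncBound (star N w) n := by
  intro s hs hi
  have h1 : (PlacticKeys.star N s).Sublist w := by
    have := star_sublist N hs
    rwa [star_star hw] at this
  have h2 : ∀ a ∈ s, (a : ℕ) ≤ N := fun a ha => star_le hw a (hs.subset ha)
  simpa using h _ h1 (pairwise_lt_star h2 hi)

theorem word_starColumns (N : ℕ) (V : List (List ℕ+)) :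
    word (starColumns N V) = star N (word V) := by
  induction V with
  | nil => rfl
  | cons c V ih =>
    rw [word_cons, star_append, ← ih, starColumns, starColumns, List.map_cons, List.reverse_cons,
      word_append, star_reverse]
    simp

theorem mem_word {V : List (List ℕ+)} {a : ℕ+} : a ∈ word V ↔ ∃ c ∈ V, a ∈ c := by
  induction V with
  | nil => simp
  | cons c V ih => simp [ih]

theorem isColumn_star {N : ℕ} {c : List ℕ+} (hw : ∀ a ∈ c, (a : ℕ) ≤ N) (h : IsColumn c) :
    IsColumn (star N c) :=
  ⟨by simpa [star] using h.1, pairwise_gt_star hw h.2⟩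

theorem isColumn_starColumns {N : ℕ} {V : List (List ℕ+)} (hw : ∀ a ∈ word V, (a : ℕ) ≤ N)
    (hV : ∀ c ∈ V, IsColumn c) : ∀ c ∈ starColumns N V, IsColumn c := by
  intro c hc
  simp only [starColumns, List.mem_reverse, List.mem_map] at hc
  obtain ⟨d, hd, rfl⟩ := hc
  exact isColumn_star (fun a ha => hw a (mem_word.mpr ⟨d, hd, ha⟩)) (hV d hd)

theorem shape_starColumns (N : ℕ) (V : List (List ℕ+)) :
    shape (starColumns N V) = (shape V).reverse := by
  simp [shape, starColumns, Function.comp_def]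

/-! ### Moving columns -/

theorem isColumn_of_length {c d : List ℕ+} (hc : IsColumn c) (hd : Desc d)
    (h : d.length = c.length) : IsColumn d :=
  ⟨by rintro rfl; exact hc.1 (List.length_eq_zero_iff.mp h.symm), hd⟩

/-- The merged left column is at least as long as `B`, and by the bound on increasing subwords it
cannot be longer. So the two lengths trade places. -/
theorem exists_swap_left {A B : List ℕ+} (hA : IsColumn A) (hB : IsColumn B)
    (h : IncBound (A.reverse ++ B.reverse) B.length) :
    ∃ B' A', IsColumn B' ∧ IsColumn A' ∧ B'.length = B.length ∧ A'.length = A.length ∧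
      KnuthEquiv (A.reverse ++ B.reverse) (B'.reverse ++ A'.reverse) := by
  have hk := mergeColumns_knuth hA.2 hB.2
  have h1 : (mergeColumns A B).1.length ≤ B.length := by
    have := h.knuthEquiv hk (mergeColumns A B).1.reverse (List.sublist_append_left _ _)
      (pairwise_reverse_of_desc (desc_mergeColumns_fst hA.2 hB.2))
    simpa using this
  have h2 := length_le_mergeColumns_right A B
  have h3 := length_mergeColumns A B
  have h4 : (mergeColumns A B).1.length = B.length := by omega
  have h5 : (mergeColumns A B).2.length = A.length := by omega
  exact ⟨_, _, isColumn_of_length hB (desc_mergeColumns_fst hA.2 hB.2) h4,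
    isColumn_of_length hA (desc_mergeColumns_snd hB.2) h5, h4, h5, hk⟩

/-- The mirror image of `exists_swap_left` under `star`, for a longest column on the left. -/
theorem exists_swap_right {A B : List ℕ+} (hA : IsColumn A) (hB : IsColumn B)
    (h : IncBound (A.reverse ++ B.reverse) A.length) :
    ∃ B' A', IsColumn B' ∧ IsColumn A' ∧ B'.length = B.length ∧ A'.length = A.length ∧
      KnuthEquiv (A.reverse ++ B.reverse) (B'.reverse ++ A'.reverse) := by
  obtain ⟨N, hN⟩ := exists_bound (A.reverse ++ B.reverse)
  have hNA : ∀ a ∈ A, (a : ℕ) ≤ N := fun a ha => hN a (by simp [ha])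
  have hNB : ∀ a ∈ B, (a : ℕ) ≤ N := fun a ha => hN a (by simp [ha])
  have h1 := h.star hN
  rw [star_append, star_reverse, star_reverse, ← length_star N A] at h1
  obtain ⟨A', B', hA', hB', hlA, hlB, hk⟩ :=
    exists_swap_left (isColumn_star hNB hB) (isColumn_star hNA hA) h1
  rw [← star_reverse, ← star_reverse, ← star_append] at hk
  have hN' : ∀ a ∈ A'.reverse ++ B'.reverse, (a : ℕ) ≤ N := fun a ha =>
    star_le hN a (hk.perm.mem_iff.mpr ha)
  have hk' := hk.star (star_le hN)
  rw [star_star hN, star_append, star_reverse, star_reverse] at hk'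
  refine ⟨star N B', star N A', isColumn_star (fun a ha => hN' a (by simp [ha])) hB',
    isColumn_star (fun a ha => hN' a (by simp [ha])) hA', by simpa using hlB, by simpa using hlA,
    hk'⟩

/-- A column of maximal length can be swapped past all its neighbours, because the bound on
increasing subwords is a plactic invariant and passes to factors. -/
theorem exists_move_left {V : List (List ℕ+)} {B : List ℕ+} (hV : ∀ c ∈ V, IsColumn c)
    (hB : IsColumn B) (h : IncBound (word V ++ B.reverse) B.length) :
    ∃ B' V', IsColumn B' ∧ (∀ c ∈ V', IsColumn c) ∧ B'.length = B.length ∧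
      shape V' = shape V ∧ KnuthEquiv (word V ++ B.reverse) (B'.reverse ++ word V') := by
  induction V with
  | nil => exact ⟨B, [], hB, by simp, rfl, rfl, by simpa using KnuthEquiv.refl _⟩
  | cons A V ih =>
    simp only [List.mem_cons, forall_eq_or_imp] at hV
    rw [word_cons, List.append_assoc] at h
    obtain ⟨B1, V1, hB1, hV1, hl1, hs1, hk1⟩ := ih hV.2 (h.sublist (List.sublist_append_right _ _))
    have h' := h.knuthEquiv (hk1.append_left A.reverse)
    rw [← List.append_assoc, ← hl1] at h'
    obtain ⟨B2, A2, hB2, hA2, hl2, hlA, hk2⟩ :=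
      exists_swap_left hV.1 hB1 (h'.sublist (List.sublist_append_left _ _))
    refine ⟨B2, A2 :: V1, hB2, by simpa using ⟨hA2, hV1⟩, hl2.trans hl1, ?_, ?_⟩
    · simp only [shape, List.map_cons, hlA] at hs1 ⊢
      rw [hs1]
    · rw [word_cons, word_cons, List.append_assoc]
      refine (hk1.append_left A.reverse).trans ?_
      simpa using hk2.append_right (word V1)

theorem exists_move_right {V : List (List ℕ+)} {B : List ℕ+} (hV : ∀ c ∈ V, IsColumn c)
    (hB : IsColumn B) (h : IncBound (B.reverse ++ word V) B.length) :
    ∃ B' V', IsColumn B' ∧ (∀ c ∈ V', IsColumn c) ∧ B'.length = B.length ∧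
      shape V' = shape V ∧ KnuthEquiv (B.reverse ++ word V) (word V' ++ B'.reverse) := by
  induction V generalizing B with
  | nil => exact ⟨B, [], hB, by simp, rfl, rfl, by simpa using KnuthEquiv.refl _⟩
  | cons A V ih =>
    simp only [List.mem_cons, forall_eq_or_imp] at hV
    rw [word_cons, ← List.append_assoc] at h
    obtain ⟨A1, B1, hA1, hB1, hlA, hl1, hk1⟩ :=
      exists_swap_right hB hV.1 (h.sublist (List.sublist_append_left _ _))
    have h' := h.knuthEquiv (hk1.append_right (word V))
    rw [List.append_assoc, ← hl1] at h'
    obtain ⟨B2, V2, hB2, hV2, hl2, hs2, hk2⟩ :=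
      ih hV.2 hB1 (h'.sublist (List.sublist_append_right _ _))
    refine ⟨B2, A1 :: V2, hB2, by simpa using ⟨hA1, hV2⟩, hl2.trans hl1, ?_, ?_⟩
    · simp only [shape, List.map_cons, hlA] at hs2 ⊢
      rw [hs2]
    · rw [word_cons, word_cons, ← List.append_assoc]
      refine (hk1.append_right (word V)).trans ?_
      simpa using hk2.append_left A1.reverse

/-! ### Frank words -/

theorem exists_last_column {c : List ℕ+} {T : List (List ℕ+)} (hT : IsRSSYT (c :: T)) :
    ∃ K V, IsColumn K ∧ (∀ c ∈ V, IsColumn c) ∧ K.length = c.length ∧ shape V = shape T ∧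
      KnuthEquiv (word (c :: T)) (word V ++ K.reverse) := by
  obtain ⟨h1, h2, h3⟩ := isRSSYT_cons.mp hT
  exact exists_move_right h3.1 h1 hT.incBound

theorem maxInc_eq_of_last_column {c K w : List ℕ+} {T : List (List ℕ+)} (hT : IsRSSYT (c :: T))
    (hK : Desc K) (hl : K.length = c.length) (hk : KnuthEquiv (word (c :: T)) (w ++ K.reverse))
    (k : ℕ) : maxInc k (word (c :: T)) = K.countP (fun a : ℕ+ => (a : ℕ) ≤ k) := by
  rw [hk.maxInc_eq]
  apply maxInc_eq_countP hK
  rw [hl]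
  exact hT.incBound.knuthEquiv hk

/-- Some factor other than the last has the length of the first column `C`. Being of maximal length,
it can be moved to the front, where `insTab_strip` identifies it with `C`; what follows is a frank
word of `T` with the last factor untouched. -/
theorem IsFrank.exists_strip {C c : List ℕ+} {T v : List (List ℕ+)} (hT : IsRSSYT (C :: T))
    (h : IsFrank (C :: T) (v ++ [c])) (hc : c.length ≠ C.length) :
    ∃ v', IsFrank T (v' ++ [c]) := by
  obtain ⟨h1, h2, h3⟩ := h
  have hmem : C.length ∈ shape (v ++ [c]) := h2.mem_iff.mpr (by simp [shape])
  obtain ⟨B, hB, hBl⟩ : ∃ B ∈ v, B.length = C.length := by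
    simp only [shape, List.map_append, List.map_cons, List.map_nil, List.mem_append, List.mem_map,
      List.mem_singleton] at hmem
    rcases hmem with h | h
    · exact h
    · exact absurd h.symm hc
  obtain ⟨a, b, rfl⟩ := List.append_of_mem hB
  have hbound : IncBound (word (a ++ B :: b ++ [c])) B.length := by
    rw [hBl]
    exact IncBound.knuthEquiv (hT.incBound) h3.symm
  have hw : word (a ++ B :: b ++ [c]) = (word a ++ B.reverse) ++ word (b ++ [c]) := by
    simp [word_append]
  rw [hw] at h3 hbound
  obtain ⟨B', a', hB', ha', hl', hs', hk'⟩ := exists_move_left (V := a) (B := B)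
    (fun d hd => h1 d (by simp [hd])) (h1 B (by simp))
    (hbound.sublist (List.sublist_append_left _ _))
  have h4 : KnuthEquiv (B'.reverse ++ word (a' ++ b ++ [c])) (word (C :: T)) := by
    refine KnuthEquiv.trans ?_ h3
    have := (hk'.append_right (word (b ++ [c]))).symm
    simpa [word_append] using this
  have hC := (isRSSYT_cons.mp hT).1.1
  obtain ⟨h5, h6⟩ := insTab_strip hB'.2 (h4.insTab_eq_of_isRSSYT hT) (hl'.trans hBl) hC
  refine ⟨a' ++ b, ?_, ?_, ?_⟩
  · intro d hd
    simp only [List.mem_append, List.mem_singleton] at hd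
    rcases hd with (hd | hd) | rfl
    · exact ha' d hd
    · exact h1 d (by simp [hd])
    · exact h1 d (by simp)
  · have h7 : (shape (a ++ B :: b ++ [c])).Perm (C.length :: shape (a' ++ b ++ [c])) := by
      simp only [shape, List.map_append, List.map_cons, hBl] at hs' ⊢
      rw [hs']
      simp
    have h8 := h7.symm.trans h2
    simpa [shape] using h8
  · have := word_insTab_knuth (word (a' ++ b ++ [c]))
    rw [h6] at this
    exact this.symm

/-- Uniqueness of the columns of the right key: columns of other lengths are stripped from the
tableau until the last factor is as long as the first column, and then `maxInc` determines it. -/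
theorem IsFrank.last_count_eq {T v v' : List (List ℕ+)} {c c' : List ℕ+} (hT : IsRSSYT T)
    (h : IsFrank T (v ++ [c])) (h' : IsFrank T (v' ++ [c'])) (hc : c.length = c'.length) (k : ℕ) :
    c.countP (fun a : ℕ+ => (a : ℕ) ≤ k) = c'.countP (fun a : ℕ+ => (a : ℕ) ≤ k) := by
  induction T generalizing v v' with
  | nil =>
    have := h.2.1.length_eq
    simp [shape] at this
  | cons C T ih =>
    by_cases hl : c.length = C.length
    · have e (v : List (List ℕ+)) (c : List ℕ+) : word (v ++ [c]) = word v ++ c.reverse := by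
        simp [word_append]
      have e1 := h.2.2.symm
      have e2 := h'.2.2.symm
      rw [e] at e1 e2
      rw [← maxInc_eq_of_last_column hT (h.1 c (by simp)).2 hl e1,
        ← maxInc_eq_of_last_column hT (h'.1 c' (by simp)).2 (hc.symm.trans hl) e2]
    · obtain ⟨v1, h1⟩ := h.exists_strip hT hl
      obtain ⟨v2, h2⟩ := h'.exists_strip hT (hc ▸ hl)
      exact ih (isRSSYT_cons.mp hT).2.2 h1 h2

theorem IsRSSYT.exists_frank_last {T : List (List ℕ+)} (hT : IsRSSYT T) {j : ℕ}
    (hj : j < T.length) : ∃ v K, IsFrank T (v ++ [K]) ∧ K.length = T[j].length ∧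
      ∀ k, K.countP (fun a : ℕ+ => (a : ℕ) ≤ k) = maxInc k (word (T.drop j)) := by
  have hd := hT.drop j
  rw [List.drop_eq_getElem_cons hj] at hd ⊢
  obtain ⟨K, V, hK, hV, hl, hs, hk⟩ := exists_last_column hd
  -- The columns left of `j` stay, and column `j` is moved to the right end of the others.
  refine ⟨T.take j ++ V, K, ⟨?_, ?_, ?_⟩, hl, fun k => (maxInc_eq_of_last_column hd hK.2 hl hk k).symm⟩
  · intro c hc
    simp only [List.mem_append, List.mem_singleton] at hc
    rcases hc with (hc | hc) | rfl
    · exact hT.1 c (List.mem_of_mem_take hc)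
    · exact hV c hc
    · exact hK
  · have h1 : T = T.take j ++ (T[j] :: T.drop (j + 1)) := by
      rw [← List.drop_eq_getElem_cons hj, List.take_append_drop]
    have h2 : shape T = shape (T.take j) ++ (T[j].length :: shape (T.drop (j + 1))) :=
      (congrArg shape h1).trans (by simp only [shape, List.map_append, List.map_cons])
    have h3 : shape (T.take j ++ V ++ [K]) = shape (T.take j) ++ (shape V ++ [K.length]) := by
      simp [shape]
    rw [h2, h3, hs, hl]
    exact (List.perm_append_singleton _ _).append_left _
  · have h1 : word T = word (T.take j) ++ word (T[j] :: T.drop (j + 1)) := by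
      rw [← word_append, ← List.drop_eq_getElem_cons hj, List.take_append_drop]
    have h3 : word (T.take j ++ V ++ [K]) = word (T.take j) ++ (word V ++ K.reverse) := by
      simp [word_append]
    rw [h1, h3]
    exact (hk.append_left _).symm

/-- The choice in `lastFrankColumn` is harmless: a suitable column exists by `exists_frank_last`,
and all of them have the same counts by `last_count_eq`. -/
theorem IsRSSYT.lastFrankColumn_spec {T : List (List ℕ+)} (hT : IsRSSYT T) {j : ℕ}
    (hj : j < T.length) : (lastFrankColumn T T[j].length).length = T[j].length ∧
      Desc (lastFrankColumn T T[j].length) ∧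
      ∀ k, (lastFrankColumn T T[j].length).countP (fun a : ℕ+ => (a : ℕ) ≤ k) =
        maxInc k (word (T.drop j)) := by
  obtain ⟨v, K, h1, h2, h3⟩ := hT.exists_frank_last hj
  have h4 : (lastFrankColumn T T[j].length).length = T[j].length ∧
      ∃ v, IsFrank T (v ++ [lastFrankColumn T T[j].length]) :=
    Classical.epsilon_spec (p := fun c : List ℕ+ => c.length = T[j].length ∧
      ∃ v, IsFrank T (v ++ [c])) ⟨K, h2, v, h1⟩
  obtain ⟨h5, v', h6⟩ := h4
  refine ⟨h5, (h6.1 _ (by simp)).2, fun k => ?_⟩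
  rw [← h3 k]
  exact h6.last_count_eq hT h1 (h5.trans h2.symm) k

/-! ### Insertion and increasing subwords -/

theorem maxInc_cons_le (k : ℕ) (x : ℕ+) (w : List ℕ+) :
    maxInc k (x :: w) ≤ maxInc k w + 1 := by
  obtain ⟨s, hs, hl⟩ := exists_isIncSubword k (x :: w)
  rw [← hl]
  rcases List.sublist_cons_iff.mp hs.1 with h | ⟨r, rfl, h⟩
  · have := IsIncSubword.length_le ⟨h, hs.2⟩
    omega
  · have := IsIncSubword.length_le (k := k) (w := w) (s := r)
      ⟨h, (List.pairwise_cons.mp hs.2.1).2, fun a ha => hs.2.2 a (by simp [ha])⟩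
    simpa using this

/-- A longest increasing subword of `c ++ v` either starts in `c`, and then `x` can be put in front
of it, or lies in `v`, and then dropping `c` loses nothing. -/
theorem maxInc_cons_smaller (k : ℕ) {x : ℕ+} {c : List ℕ+} (v : List ℕ+) (hx : ∀ a ∈ c, x < a) :
    maxInc k (x :: (c ++ v)) = maxInc k (c ++ v) + 1 ∨
      (maxInc k (x :: (c ++ v)) = maxInc k (c ++ v) ∧ maxInc k v = maxInc k (c ++ v)) := by
  have h1 := maxInc_cons_le k x (c ++ v)
  have h2 := maxInc_mono k (List.sublist_cons_self x (c ++ v))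
  have h3 := maxInc_mono k (List.sublist_append_right c v)
  obtain ⟨s, ⟨hs1, hs2, hs3⟩, hl⟩ := exists_isIncSubword k (c ++ v)
  obtain ⟨s1, s2, rfl, hc, hv⟩ := List.sublist_append_iff.mp hs1
  cases s1 with
  | nil =>
    have := IsIncSubword.length_le (k := k) (w := v) (s := s2)
      ⟨hv, by simpa using hs2, by simpa using hs3⟩
    rw [List.nil_append] at hl
    omega
  | cons a s1 =>
    have hxa := hx a (hc.subset (by simp))
    have := IsIncSubword.length_le (k := k) (w := x :: (c ++ v)) (s := x :: (a :: s1 ++ s2)) (by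
      refine ⟨hs1.cons_cons x, ?_, ?_⟩
      · rw [List.pairwise_cons]
        refine ⟨?_, hs2⟩
        intro b hb
        rcases List.mem_cons.mp hb with rfl | hb
        · exact hxa
        · exact hxa.trans ((List.pairwise_cons.mp hs2).1 b hb)
      · intro b hb
        rcases List.mem_cons.mp hb with rfl | hb
        · have h4 := hs3 a (by simp)
          have h5 : (b : ℕ) < a := hxa
          omega
        · exact hs3 b hb)
    rw [List.length_cons, hl] at this
    omega

theorem insertTableau_of_none {x : ℕ+} {c : List ℕ+} (T : List (List ℕ+))
    (h : (insertColumn x c).2 = none) : insertTableau x (c :: T) = ((insertColumn x c).1 :: T, 0) := by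
  rw [insertTableau]
  generalize insertColumn x c = p at *
  obtain ⟨c', o⟩ := p
  subst h
  rfl

theorem insertTableau_of_some {x y : ℕ+} {c : List ℕ+} (T : List (List ℕ+))
    (h : (insertColumn x c).2 = some y) : insertTableau x (c :: T) =
      ((insertColumn x c).1 :: (insertTableau y T).1, (insertTableau y T).2 + 1) := by
  rw [insertTableau]
  generalize insertColumn x c = p at *
  obtain ⟨c', o⟩ := p
  subst h
  rfl

theorem insertColumn_of_none {x : ℕ+} {c : List ℕ+} (h : (insertColumn x c).2 = none) :
    (∀ a ∈ c, x < a) ∧ (insertColumn x c).1 = c ++ [x] := by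
  rcases insertColumn_cases x c with ⟨h1, h2⟩ | ⟨a, y, b, rfl, hy, hu, h2⟩
  · exact ⟨h1, by rw [h2]⟩
  · simp [h2] at h

theorem length_insertColumn_of_some {x y : ℕ+} {c : List ℕ+} (h : (insertColumn x c).2 = some y) :
    (insertColumn x c).1.length = c.length := by
  rcases insertColumn_cases x c with ⟨h1, h2⟩ | ⟨a, y, b, rfl, hy, hu, h2⟩
  · simp [h2] at h
  · simp [h2]

/-- The effect of an insertion on the counts of the right key. Columns passed by the bumping route
keep theirs, columns to the right of the new box do not change at all, and in the column of the new
box the inserted letter is smaller than all entries, so `maxInc_cons_smaller` applies. -/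
theorem maxInc_insertTableau {T : List (List ℕ+)} (hT : IsRSSYT T) (x : ℕ+) (k : ℕ) :
    (∀ j, j ≠ (insertTableau x T).2 →
      maxInc k (word ((insertTableau x T).1.drop j)) = maxInc k (word (T.drop j))) ∧
    (maxInc k (word ((insertTableau x T).1.drop (insertTableau x T).2)) =
        maxInc k (word (T.drop (insertTableau x T).2)) + 1 ∨
      (maxInc k (word ((insertTableau x T).1.drop (insertTableau x T).2)) =
          maxInc k (word (T.drop (insertTableau x T).2)) ∧
        maxInc k (word (T.drop ((insertTableau x T).2 + 1))) =
          maxInc k (word (T.drop (insertTableau x T).2)))) := by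
  induction T generalizing x with
  | nil =>
    simp only [insertTableau]
    refine ⟨?_, ?_⟩
    · intro j hj
      obtain ⟨j, rfl⟩ := Nat.exists_eq_succ_of_ne_zero hj
      simp
    · simpa using maxInc_cons_smaller k (x := x) (c := []) [] (by simp)
  | cons c T ih =>
    obtain ⟨hc, hr, hT'⟩ := isRSSYT_cons.mp hT
    cases hy : (insertColumn x c).2 with
    | none =>
      obtain ⟨h1, h2⟩ := insertColumn_of_none hy
      rw [insertTableau_of_none T hy]
      simp only
      refine ⟨?_, ?_⟩
      · intro j hj
        obtain ⟨j, rfl⟩ := Nat.exists_eq_succ_of_ne_zero hj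
        simp
      · have := maxInc_cons_smaller k (x := x) (c := c.reverse) (word T) (by simpa using h1)
        simpa [h2] using this
    | some y =>
      have hT1 := hT.insertTableau x
      have hk1 := insertTableau_knuth x hT.desc
      rw [insertTableau_of_some T hy] at hT1 hk1 ⊢
      obtain ⟨ih1, ih2⟩ := ih hT' y
      refine ⟨?_, ?_⟩
      · intro j hj
        cases j with
        | zero =>
          simp only [List.drop_zero] at hT1 hk1 ⊢
          obtain ⟨K, V, hK, hV, hl, hs, hk⟩ := exists_last_column hT
          rw [maxInc_eq_of_last_column hT hK.2 hl hk]
          -- From `word (c :: T) ≡ V K` the new word is `≡ x V K`. The first column has kept its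
          -- length, so `K` is still a last column of maximal length.
          refine maxInc_eq_of_last_column (w := x :: word V) hT1 hK.2
            (hl.trans (length_insertColumn_of_some hy).symm) (hk1.trans ?_) k
          simpa using hk.cons x
        | succ j => simpa using ih1 j (by simpa using hj)
      · simpa using ih2

/-! ### Shapes -/

/-- The lengths of the columns, with `0` for the missing columns. -/
def colLength (T : List (List ℕ+)) (j : ℕ) : ℕ := (T.getD j []).length

theorem shape_insertTableau {T Q : List (List ℕ+)} (h : shape T = shape Q) (x y : ℕ+) :
    shape (insertTableau x T).1 = shape (appendBox y (insertTableau x T).2 Q) := by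
  induction T generalizing Q x with
  | nil =>
    cases Q with
    | nil => rfl
    | cons d Q => simp [shape] at h
  | cons c T ih =>
    cases Q with
    | nil => simp [shape] at h
    | cons d Q =>
      simp only [shape, List.map_cons, List.cons.injEq] at h ih ⊢
      cases hy : (insertColumn x c).2 with
      | none =>
        rw [insertTableau_of_none T hy, (insertColumn_of_none hy).2]
        simp [appendBox, h]
      | some z =>
        rw [insertTableau_of_some T hy]
        simp [appendBox, h, length_insertColumn_of_some hy, ih h.2]

theorem insertTableau_snd_le (x : ℕ+) (T : List (List ℕ+)) : (insertTableau x T).2 ≤ T.length := by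
  induction T generalizing x with
  | nil => simp [insertTableau]
  | cons c T ih =>
    cases hy : (insertColumn x c).2 with
    | none => rw [insertTableau_of_none T hy]; simp
    | some z =>
      rw [insertTableau_of_some T hy]
      simpa using ih z

/-! ### Removing a largest letter -/

/-- The largest letter of the triple is `x`. If `y = x` in the second relation, `x` is the left one
of the two, and this is the occurrence that `erase` removes on both sides. -/
theorem KnuthTriple.erase_eq {t t' : List ℕ+} {M : ℕ+} (h : KnuthTriple t t')
    (ht : ∀ a ∈ t, a ≤ M) (hM : M ∈ t) : t.erase M = t'.erase M := by
  cases h with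
  | first x y z hxy hyz =>
    simp only [List.mem_cons, List.not_mem_nil, or_false, forall_eq_or_imp, forall_eq] at ht hM
    have hxM : x = M := by
      rcases hM with rfl | rfl | rfl
      · exact absurd ht.2.1 hxy.not_ge
      · rfl
      · exact absurd ht.2.1 (hyz.trans_lt hxy).not_ge
    subst hxM
    have h1 : y ≠ x := hxy.ne
    have h2 : z ≠ x := (hyz.trans_lt hxy).ne
    simp [h1, h2]
  | second x y z hxy hyz =>
    simp only [List.mem_cons, List.not_mem_nil, or_false, forall_eq_or_imp, forall_eq] at ht hM
    have hxM : x = M := by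
      rcases hM with rfl | rfl | rfl
      · rfl
      · exact absurd ht.1 (hyz.trans_le hxy).not_ge
      · exact le_antisymm ht.1 hxy
    subst hxM
    have h2 : z ≠ x := (hyz.trans_le hxy).ne
    simp [h2]

theorem KnuthTriple.perm {t t' : List ℕ+} (h : KnuthTriple t t') : t.Perm t' := by
  simpa using (h.knuthEquiv [] []).perm

theorem KnuthEquiv.erase {w w' : List ℕ+} {M : ℕ+} (h : KnuthEquiv w w') (hw : ∀ a ∈ w, a ≤ M) :
    KnuthEquiv (w.erase M) (w'.erase M) := by
  induction h with
  | rel a b hab =>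
    obtain ⟨u, v, t, t', rfl, rfl, h⟩ := hab.exists_triple
    by_cases hu : M ∈ u
    · simp only [List.append_assoc]
      rw [List.erase_append_left _ hu, List.erase_append_left _ hu]
      simpa [List.append_assoc] using h.knuthEquiv (u.erase M) v
    · simp only [List.append_assoc]
      rw [List.erase_append_right _ hu, List.erase_append_right _ hu]
      by_cases ht : M ∈ t
      · rw [List.erase_append_left _ ht, List.erase_append_left _ (h.perm.mem_iff.mp ht),
          h.erase_eq (fun a ha => hw a (by simp [ha])) ht]
        exact KnuthEquiv.refl _
      · rw [List.erase_append_right _ ht,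
          List.erase_append_right _ (fun h' => ht (h.perm.mem_iff.mpr h'))]
        simpa [List.append_assoc] using h.knuthEquiv u (v.erase M)
  | refl a => exact KnuthEquiv.refl _
  | symm a b h ih => exact (ih fun x hx => hw x ((KnuthEquiv.perm h).mem_iff.mp hx)).symm
  | trans a b c h1 h2 ih1 ih2 =>
    exact (ih1 hw).trans (ih2 fun x hx => hw x ((KnuthEquiv.perm h1).mem_iff.mpr hx))

/-! ### Sliding an empty box out of a tableau -/

/-- Without its top entry the left column moves up by one row. Both columns are split at the first
row where the shifted entry is missing or smaller than its right neighbour `z'`; below that row `B`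
and `B'` are in their original relative position. -/
theorem exists_first_violation_aux {x : ℕ+} {c d : List ℕ+} (hc : Desc (x :: c))
    (hr : RowsWeaklyDecrease (x :: c) d) (hn : ¬ RowsWeaklyDecrease c d) :
    ∃ A B A' z' B', c = A ++ B ∧ d = A' ++ z' :: B' ∧ A.length = A'.length ∧
      RowsWeaklyDecrease A A' ∧ RowsWeaklyDecrease B B' ∧ (∀ b ∈ B, b < z') ∧ z' ≤ x := by
  induction c generalizing x d with
  | nil =>
    cases d with
    | nil => exact absurd (rowsWeaklyDecrease_nil _) hn
    | cons g d =>
      obtain ⟨h1, h2⟩ := rowsWeaklyDecrease_cons.mp hr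
      cases d with
      | nil =>
        exact ⟨[], [], [], g, [], rfl, rfl, rfl, rowsWeaklyDecrease_nil _,
          rowsWeaklyDecrease_nil _, by simp, h1⟩
      | cons g' d => exact absurd h2 (rowsWeaklyDecrease_nil_cons _ _)
  | cons x' c ih =>
    cases d with
    | nil => exact absurd (rowsWeaklyDecrease_nil _) hn
    | cons g d =>
      obtain ⟨h1, h2⟩ := rowsWeaklyDecrease_cons.mp hr
      have hc1 := List.pairwise_cons.mp hc
      have hc2 := List.pairwise_cons.mp hc1.2
      rcases le_or_gt g x' with hg | hg
      · have hn' : ¬ RowsWeaklyDecrease c d := fun h => hn (rowsWeaklyDecrease_cons.mpr ⟨hg, h⟩)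
        obtain ⟨A, B, A', z', B', rfl, rfl, hl, hA, hB, hb, hz⟩ := ih hc1.2 h2 hn'
        exact ⟨x' :: A, B, g :: A', z', B', rfl, rfl, by simp [hl],
          rowsWeaklyDecrease_cons.mpr ⟨hg, hA⟩, hB, hb, hz.trans (hc1.1 x' (by simp)).le⟩
      · refine ⟨[], x' :: c, [], g, d, rfl, rfl, rfl, rowsWeaklyDecrease_nil _, h2, ?_, h1⟩
        intro b hb
        rcases List.mem_cons.mp hb with rfl | hb
        · exact hg
        · exact (hc2.1 b hb).trans hg

theorem exists_first_violation {c d : List ℕ+} {z : ℕ+} (hc : Desc c)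
    (hr : RowsWeaklyDecrease c d) (hz : z ∈ c) (hn : ¬ RowsWeaklyDecrease (c.erase z) d) :
    ∃ A B A' z' B', c.erase z = A ++ B ∧ d = A' ++ z' :: B' ∧ A.length = A'.length ∧
      RowsWeaklyDecrease A A' ∧ RowsWeaklyDecrease B B' ∧ (∀ b ∈ B, b < z') ∧ z' ≤ z := by
  induction c generalizing d with
  | nil => simp at hz
  | cons x c ih =>
    by_cases hxz : x = z
    · subst hxz
      rw [List.erase_cons_head] at hn ⊢
      exact exists_first_violation_aux hc hr hn
    · have hz' : z ∈ c := by
        rcases List.mem_cons.mp hz with rfl | h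
        · exact absurd rfl hxz
        · exact h
      have he : (x :: c).erase z = x :: c.erase z := by simp [hxz]
      rw [he] at hn ⊢
      cases d with
      | nil => exact absurd (rowsWeaklyDecrease_nil _) hn
      | cons g d =>
        obtain ⟨h1, h2⟩ := rowsWeaklyDecrease_cons.mp hr
        obtain ⟨A, B, A', z', B', hA1, rfl, hl, hA, hB, hb, hz⟩ :=
          ih (List.pairwise_cons.mp hc).2 h2 hz' fun h => hn (rowsWeaklyDecrease_cons.mpr ⟨h1, h⟩)
        exact ⟨x :: A, B, g :: A', z', B', by simp [hA1], rfl, by simp [hl],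
          rowsWeaklyDecrease_cons.mpr ⟨h1, hA⟩, hB, hb, hz⟩

/-- Merging performs the jeu de taquin slide: `z'` moves left into the gap between `A` and `B`, and
everything else stays. -/
theorem mergeColumns_of_violation {A B A' B' : List ℕ+} {z : ℕ+} (hl : A.length = A'.length)
    (hA : RowsWeaklyDecrease A A') (hB : RowsWeaklyDecrease B B') (hb : ∀ b ∈ B, b < z) :
    mergeColumns (A ++ B) (A' ++ z :: B') = (A ++ z :: B, A' ++ B') := by
  induction A generalizing A' with
  | nil =>
    obtain rfl : A' = [] := List.length_eq_zero_iff.mp hl.symm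
    cases B with
    | nil =>
      cases B' with
      | nil => simp [mergeColumns]
      | cons g d => exact absurd hB (rowsWeaklyDecrease_nil_cons _ _)
    | cons b B =>
      have := hb b (by simp)
      simp [mergeColumns, this.not_ge, hB.mergeColumns_eq]
  | cons x A ih =>
    cases A' with
    | nil => simp at hl
    | cons g A' =>
      obtain ⟨h1, h2⟩ := rowsWeaklyDecrease_cons.mp hA
      simp [mergeColumns, h1, ih (by simpa using hl) h2]

/-- When an entry `z` is missing in the left one of two neighboring columns, then either nothing
happens, or an entry `z'` of the right column moves to the left. -/
theorem exists_slide {c d : List ℕ+} {z : ℕ+} (hc : Desc c) (hd : Desc d)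
    (hr : RowsWeaklyDecrease c d) (hz : z ∈ c) (hn : ¬ RowsWeaklyDecrease (c.erase z) d) :
    ∃ z' ∈ d, z' ≤ z ∧ (mergeColumns (c.erase z) d).1.length = c.length ∧
      (mergeColumns (c.erase z) d).2 = d.erase z' ∧
      ((c.erase z).filter fun b => b < z').length + d.countP (fun a => z' ≤ a) = c.length := by
  obtain ⟨A, B, A', z', B', h1, rfl, hl, hA, hB, hb, hz'⟩ := exists_first_violation hc hr hz hn
  have hlen := List.length_erase_of_mem hz
  have hpos : 0 < c.length := List.length_pos_of_mem hz
  obtain ⟨hd1, hd2, hd3⟩ := List.pairwise_append.mp hd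
  have hd4 := List.pairwise_cons.mp hd2
  have hz'A : ∀ a ∈ A', z' < a := fun a ha => hd3 a ha z' (by simp)
  have hAz : ∀ a ∈ A, ¬ a < z' := by
    intro a ha
    obtain ⟨i, hi, rfl⟩ := List.mem_iff_getElem.mp ha
    obtain ⟨_, h2⟩ := hA i (hl ▸ hi)
    exact ((hz'A _ (List.getElem_mem _)).le.trans h2).not_gt
  refine ⟨z', by simp, hz', ?_, ?_, ?_⟩
  · rw [h1, mergeColumns_of_violation hl hA hB hb]
    rw [h1] at hlen
    simp at hlen ⊢
    omega
  · rw [h1, mergeColumns_of_violation hl hA hB hb,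
      List.erase_append_right _ (fun h => lt_irrefl _ (hz'A _ h)), List.erase_cons_head]
  -- `B` contains the entries below `z'`, and `A'` together with `z'` the entries of `d` that are at
  -- least `z'`; `A` and `A'` have equal length.
  · rw [h1] at hlen ⊢
    rw [List.filter_append, List.filter_eq_nil_iff.mpr (by simpa using hAz),
      List.filter_eq_self.mpr (by simpa using hb), List.countP_append, List.countP_cons,
      List.countP_eq_length.mpr (by simpa using fun a ha => (hz'A a ha).le),
      List.countP_eq_zero.mpr (by simpa using hd4.1)]
    simp at hlen ⊢
    omega

theorem sublist_erase_of_notMem {s l : List ℕ+} {z : ℕ+} (h : s.Sublist l) (hz : z ∉ s) :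
    s.Sublist (l.erase z) := by
  have := h.erase z
  rwa [List.erase_of_not_mem hz] at this

theorem desc_reverse_erase {c : List ℕ+} (hc : Desc c) (z : ℕ+) :
    (c.erase z).reverse = c.reverse.erase z := by
  induction c with
  | nil => rfl
  | cons x c ih =>
    have hc' := List.pairwise_cons.mp hc
    by_cases hx : x = z
    · subst hx
      have : x ∉ c.reverse := fun h => lt_irrefl _ (hc'.1 x (by simpa using h))
      simp [List.erase_append_right _ this]
    · have he : (x :: c).erase z = x :: c.erase z := by simp [hx]
      rw [he, List.reverse_cons, List.reverse_cons, ih hc'.2]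
      by_cases hz : z ∈ c.reverse
      · rw [List.erase_append_left _ hz]
      · rw [List.erase_append_right _ hz, List.erase_of_not_mem hz]
        simp [hx]

/-- A subword through `z` is rerouted. If `a` is its largest letter in `c`, then its part in `c` is
replaced by the entries of `c` below `z'` followed by the entries of `d` in `[z', a]`. By `hcount`
these number `|c|` minus the entries of `d` above `a`, hence at least as many as the entries `≤ a`
of `c`. -/
theorem maxInc_slide_past {c d v : List ℕ+} {z z' : ℕ+} (k : ℕ) (hc : Desc c) (hd : Desc d)
    (hr : RowsWeaklyDecrease c d) (hz : z' ≤ z)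
    (hcount : ((c.erase z).filter fun b => b < z').length + d.countP (fun a => z' ≤ a) = c.length) :
    maxInc k (c.reverse ++ (d.reverse ++ v)) =
      maxInc k ((c.erase z).reverse ++ (d.reverse ++ v)) := by
  apply le_antisymm
  swap
  · apply maxInc_mono
    exact (List.erase_sublist.reverse).append (List.Sublist.refl _)
  obtain ⟨s, ⟨hs1, hs2, hs3⟩, hl⟩ := exists_isIncSubword k (c.reverse ++ (d.reverse ++ v))
  rw [← hl]
  obtain ⟨s1, s23, rfl, h1, h23⟩ := List.sublist_append_iff.mp hs1
  by_cases hzs : z ∈ s1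
  swap
  · refine IsIncSubword.length_le ⟨?_, hs2, hs3⟩
    rw [desc_reverse_erase hc]
    exact (sublist_erase_of_notMem h1 hzs).append h23
  obtain ⟨s2, s3, rfl, h2, h3⟩ := List.sublist_append_iff.mp h23
  obtain ⟨p1, p23, p4⟩ := List.pairwise_append.mp hs2
  obtain ⟨p2, p3, p5⟩ := List.pairwise_append.mp p23
  obtain ⟨a, ha, hmax⟩ : ∃ a ∈ s1, ∀ b ∈ s1, b ≤ a := by
    have hne : s1 ≠ [] := by rintro rfl; simp at hzs
    refine ⟨s1.getLast hne, List.getLast_mem hne, ?_⟩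
    intro b hb
    rcases List.eq_nil_or_concat' s1 with rfl | ⟨l, e, rfl⟩
    · simp at hne
    · rw [List.getLast_append_singleton]
      rcases List.mem_append.mp hb with hb | hb
      · exact ((List.pairwise_append.mp p1).2.2 b hb e (by simp)).le
      · simp at hb; exact hb.le
  have hza : z' ≤ a := hz.trans (hmax z hzs)
  have hak : (a : ℕ) ≤ k := hs3 a (by simp [ha])
  have hdr := pairwise_reverse_of_desc hd
  set B := (c.erase z).filter (fun b => b < z') with hB
  set D := (d.reverse.filter fun u : ℕ+ => (u : ℕ) ≤ a).filter (fun u => z' ≤ u) with hD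
  have hDmem : ∀ u ∈ D, z' ≤ u ∧ u ≤ a := by
    intro u hu
    simp only [hD, List.mem_filter, decide_eq_true_eq] at hu
    exact ⟨hu.2, hu.1.2⟩
  have hBmem : ∀ b ∈ B, b < z' := by
    intro b hb
    simpa using (List.mem_filter.mp hb).2
  have hBsub : B.reverse.Sublist (c.erase z).reverse := List.filter_sublist.reverse
  have hDsub : (D ++ s2).Sublist d.reverse := by
    have e1 : s2.Sublist (d.reverse.filter fun u : ℕ+ => ¬ (u : ℕ) ≤ a) := by
      have := h2.filter (fun u : ℕ+ => decide (¬ (u : ℕ) ≤ a))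
      rwa [List.filter_eq_self.mpr] at this
      intro u hu
      have h7 : (a : ℕ) < u := p4 a ha u (by simp [hu])
      simpa using h7
    have e2 := (List.filter_sublist (p := fun u => decide (z' ≤ u))
      (l := d.reverse.filter fun u : ℕ+ => (u : ℕ) ≤ a)).append e1
    rwa [filter_le_append_filter_not_le hdr] at e2
  have hnew : IsIncSubword k ((c.erase z).reverse ++ (d.reverse ++ v)) (B.reverse ++ ((D ++ s2) ++ s3)) := by
    refine ⟨hBsub.append (hDsub.append h3), ?_, ?_⟩
    · simp only [List.pairwise_append, List.mem_append]
      refine ⟨?_, ⟨⟨?_, p2, ?_⟩, p3, ?_⟩, ?_⟩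
      · exact pairwise_reverse_of_desc ((hc.sublist List.erase_sublist).sublist List.filter_sublist)
      · exact (hdr.sublist List.filter_sublist).sublist List.filter_sublist
      · intro u hu b hb
        exact (hDmem u hu).2.trans_lt (p4 a ha b (by simp [hb]))
      · rintro u (hu | hu) b hb
        · exact (hDmem u hu).2.trans_lt (p4 a ha b (by simp [hb]))
        · exact p5 u hu b hb
      · intro b hb u hu
        have hb' := hBmem b (by simpa using hb)
        rcases hu with (hu | hu) | hu
        · exact hb'.trans_le (hDmem u hu).1
        · exact (hb'.trans_le hza).trans (p4 a ha u (by simp [hu]))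
        · exact (hb'.trans_le hza).trans (p4 a ha u (by simp [hu]))
    · intro u hu
      simp only [List.mem_append] at hu
      rcases hu with hu | (hu | hu) | hu
      · have : (u : ℕ) ≤ a := ((hBmem u (by simpa using hu)).trans_le hza).le
        omega
      · have : (u : ℕ) ≤ a := (hDmem u hu).2
        omega
      · exact hs3 u (by simp [hu])
      · exact hs3 u (by simp [hu])
  have hlen := hnew.length_le
  have hcd := hr.countP_le (a + 1)
  have hs1len : s1.length ≤ c.countP (fun u => u ≤ a) := by
    have := h1.countP_le (p := fun u => decide (u ≤ a))
    rw [List.countP_reverse, List.countP_eq_length.mpr (by simpa using hmax)] at this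
    exact this
  have hcc : c.length = c.countP (fun u => u ≤ a) + c.countP (fun u => a + 1 ≤ u) := by
    rw [List.length_eq_countP_add_countP (fun u => decide (u ≤ a))]
    congr 1
    apply List.countP_congr
    intro u _
    simp
  have hDlen : D.length + d.countP (fun u => a + 1 ≤ u) = d.countP (fun u => z' ≤ u) := by
    rw [hD, List.filter_filter, ← List.countP_eq_length_filter, List.countP_reverse]
    clear * - hza
    induction d with
    | nil => rfl
    | cons x d ih =>
      simp only [List.countP_cons, PNat.add_one_le_iff, Bool.and_eq_true, decide_eq_true_eq,
        PNat.coe_le_coe] at ih ⊢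
      rcases le_or_gt x a with h1 | h1
      · rcases le_or_gt z' x with h2 | h2
        · simp [h1, h2, h1.not_gt]; omega
        · simp [h1, h2.not_ge, h1.not_gt]; omega
      · have h2 : z' ≤ x := hza.trans h1.le
        simp [h1, h2, h1.not_ge]; omega
  simp only [List.length_append, List.length_reverse] at hlen ⊢
  omega

/-- If a longest subword uses `z'`, its letters in `d` below `z'` can be traded for all entries of
`c.erase z` below `z'`. By `hcount` the length changes by at least `|c| - |d|`. -/
theorem maxInc_slide_end {c d v : List ℕ+} {z z' : ℕ+} (k : ℕ) (hc : Desc c) (hd : Desc d)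
    (hcount : ((c.erase z).filter fun b => b < z').length + d.countP (fun a => z' ≤ a) = c.length) :
    maxInc k (d.reverse ++ v) = maxInc k ((d.erase z').reverse ++ v) ∨
      maxInc k (d.reverse ++ v) + c.length ≤
        maxInc k (c.reverse ++ (d.reverse ++ v)) + d.length := by
  obtain ⟨s, ⟨hs1, hs2, hs3⟩, hl⟩ := exists_isIncSubword k (d.reverse ++ v)
  obtain ⟨s2, s3, rfl, h2, h3⟩ := List.sublist_append_iff.mp hs1
  by_cases hzs : z' ∈ s2
  swap
  · left
    apply le_antisymm
    · rw [← hl]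
      refine IsIncSubword.length_le ⟨?_, hs2, hs3⟩
      rw [desc_reverse_erase hd]
      exact (sublist_erase_of_notMem h2 hzs).append h3
    · apply maxInc_mono
      exact (List.erase_sublist.reverse).append (List.Sublist.refl _)
  · right
    obtain ⟨p2, p3, p5⟩ := List.pairwise_append.mp hs2
    set B := (c.erase z).filter (fun b => b < z') with hB
    have hBmem : ∀ b ∈ B, b < z' := by
      intro b hb
      simpa using (List.mem_filter.mp hb).2
    have hz'k : (z' : ℕ) ≤ k := hs3 z' (by simp [hzs])
    have hBsub : B.reverse.Sublist c.reverse :=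
      (List.filter_sublist.trans List.erase_sublist).reverse
    have hnew : IsIncSubword k (c.reverse ++ (d.reverse ++ v))
        (B.reverse ++ (s2.filter (fun u => z' ≤ u) ++ s3)) := by
      refine ⟨hBsub.append ((List.filter_sublist.trans h2).append h3), ?_, ?_⟩
      · simp only [List.pairwise_append, List.mem_append]
        refine ⟨?_, ⟨p2.sublist List.filter_sublist, p3, ?_⟩, ?_⟩
        · exact pairwise_reverse_of_desc
            ((hc.sublist List.erase_sublist).sublist List.filter_sublist)
        · intro u hu b hb
          exact p5 u (List.mem_of_mem_filter hu) b hb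
        · intro b hb u hu
          have hb' := hBmem b (by simpa using hb)
          rcases hu with hu | hu
          · exact hb'.trans_le (by simpa using (List.mem_filter.mp hu).2)
          · exact hb'.trans (p5 z' hzs u hu)
      · intro u hu
        simp only [List.mem_append] at hu
        rcases hu with hu | hu | hu
        · have : (u : ℕ) < z' := hBmem u (by simpa using hu)
          omega
        · exact hs3 u (by simp [List.mem_of_mem_filter hu])
        · exact hs3 u (by simp [hu])
    have hlen := hnew.length_le
    have e1 : s2.length = s2.countP (fun u => z' ≤ u) + s2.countP (fun u => ¬ z' ≤ u) := by
      simpa using List.length_eq_countP_add_countP (fun u => decide (z' ≤ u)) (l := s2)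
    have e2 : d.length = d.countP (fun u => z' ≤ u) + d.countP (fun u => ¬ z' ≤ u) := by
      simpa using List.length_eq_countP_add_countP (fun u => decide (z' ≤ u)) (l := d)
    have e3 := h2.countP_le (p := fun u => decide (¬ z' ≤ u))
    rw [List.countP_reverse] at e3
    simp only [List.length_append, List.length_reverse, ← List.countP_eq_length_filter] at hlen hl ⊢
    simp only [hB, ← List.countP_eq_length_filter] at hcount hlen
    omega

theorem maxInc_le_erase_add_one (k : ℕ) (w : List ℕ+) (z : ℕ+) :
    maxInc k w ≤ maxInc k (w.erase z) + 1 := by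
  obtain ⟨s, ⟨hs1, hs2, hs3⟩, hl⟩ := exists_isIncSubword k w
  have h1 := IsIncSubword.length_le (k := k) (w := w.erase z) (s := s.erase z)
    ⟨hs1.erase z, hs2.sublist List.erase_sublist, fun a ha => hs3 a (List.mem_of_mem_erase ha)⟩
  have h2 := List.length_erase_add_one (a := z) (l := s)
  by_cases hz : z ∈ s
  · have := h2 hz
    omega
  · rw [List.erase_of_not_mem hz] at h1
    omega

theorem maxInc_reverse_erase_append {c : List ℕ+} (hc : Desc c) {z : ℕ+} (hz : z ∈ c) (k : ℕ)
    (v : List ℕ+) : maxInc k ((c.erase z).reverse ++ v) ≤ maxInc k (c.reverse ++ v) ∧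
      maxInc k (c.reverse ++ v) ≤ maxInc k ((c.erase z).reverse ++ v) + 1 := by
  have := maxInc_le_erase_add_one k (c.reverse ++ v) z
  rw [List.erase_append_left _ (by simpa using hz), ← desc_reverse_erase hc] at this
  exact ⟨maxInc_mono k (List.erase_sublist.reverse.append (List.Sublist.refl _)), this⟩

@[simp] theorem colLength_nil (j : ℕ) : colLength [] j = 0 := by simp [colLength]

@[simp] theorem colLength_cons_zero (c : List ℕ+) (T : List (List ℕ+)) :
    colLength (c :: T) 0 = c.length := rfl

@[simp] theorem colLength_cons_succ (c : List ℕ+) (T : List (List ℕ+)) (j : ℕ) :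
    colLength (c :: T) (j + 1) = colLength T j := by simp [colLength]

/-- The hole left by `z` slides to the right and leaves the diagram in column `e`. The columns it
passes keep their counts by `maxInc_slide_past`. The last clause comes from `maxInc_slide_end`; in
terms of `colLength - maxInc`, the count of the left key, it compares column `e` with its left
neighbour. -/
theorem exists_slide_tableau {c : List ℕ+} {T : List (List ℕ+)} {z : ℕ+} (hT : IsRSSYT (c :: T))
    (hz : z ∈ c) : ∃ e,
      (∀ j, colLength (c :: T) j =
        colLength (insTab (c.erase z).reverse T) j + if j = e then 1 else 0) ∧
      (∀ k j, j ≠ e → maxInc k (word ((insTab (c.erase z).reverse T).drop j)) =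
        maxInc k (word ((c :: T).drop j))) ∧
      (∀ k, maxInc k (word ((insTab (c.erase z).reverse T).drop e)) ≤
          maxInc k (word ((c :: T).drop e)) ∧ maxInc k (word ((c :: T).drop e)) ≤
            maxInc k (word ((insTab (c.erase z).reverse T).drop e)) + 1) ∧
      (∀ k i, i + 1 = e → maxInc k (word ((c :: T).drop e)) =
          maxInc k (word ((insTab (c.erase z).reverse T).drop e)) ∨
        maxInc k (word ((c :: T).drop e)) + colLength (c :: T) i ≤
          maxInc k (word ((c :: T).drop i)) + colLength (c :: T) e) := by
  have hlen := List.length_erase_of_mem hz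
  have hpos : 0 < c.length := List.length_pos_of_mem hz
  induction T generalizing c z with
  | nil =>
    obtain ⟨hc, -, -⟩ := isRSSYT_cons.mp hT
    refine ⟨0, ?_, ?_, ?_, by simp⟩
    · intro j
      by_cases he : c.erase z = []
      · rw [he] at hlen ⊢
        cases j with
        | zero => simp at hlen ⊢; omega
        | succ j => simp
      · rw [insTab_reverse_nil ⟨he, hc.2.sublist List.erase_sublist⟩]
        cases j with
        | zero => simp; omega
        | succ j => simp
    · intro k j hj
      obtain ⟨j, rfl⟩ := Nat.exists_eq_succ_of_ne_zero hj
      by_cases he : c.erase z = []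
      · rw [he]; simp
      · rw [insTab_reverse_nil ⟨he, hc.2.sublist List.erase_sublist⟩]; simp
    · intro k
      have := maxInc_reverse_erase_append hc.2 hz k []
      by_cases he : c.erase z = []
      · rw [he] at this ⊢; simpa using this
      · rw [insTab_reverse_nil ⟨he, hc.2.sublist List.erase_sublist⟩]; simpa using this
  | cons d T ih =>
    obtain ⟨hc, hr, hT'⟩ := isRSSYT_cons.mp hT
    obtain ⟨hd, -, hT''⟩ := isRSSYT_cons.mp hT'
    rw [List.headD_cons] at hr
    have hce : Desc (c.erase z) := hc.2.sublist List.erase_sublist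
    have hk := insTab_knuth (c.erase z).reverse hT'.desc
    rw [insTab_reverse_cons hce] at hk ⊢
    by_cases hn : RowsWeaklyDecrease (c.erase z) d
    · rw [hn.mergeColumns_eq, hT'.insTab_reverse]
      refine ⟨0, ?_, ?_, ?_, by simp⟩
      · intro j
        cases j with
        | zero => simp; omega
        | succ j => simp
      · intro k j hj
        obtain ⟨j, rfl⟩ := Nat.exists_eq_succ_of_ne_zero hj
        simp
      · intro k
        simpa using maxInc_reverse_erase_append hc.2 hz k (d.reverse ++ word T)
    · obtain ⟨z', hz'd, hz'z, h1, h2, h3⟩ := exists_slide hc.2 hd.2 hr hz hn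
      rw [h2] at hk ⊢
      obtain ⟨e, i1, i2, i4, i3⟩ := ih hT' hz'd (List.length_erase_of_mem hz'd)
        (List.length_pos_of_mem hz'd)
      refine ⟨e + 1, ?_, ?_, fun k => by simpa using i4 k, ?_⟩
      · intro j
        cases j with
        | zero => simp [h1]
        | succ j => simpa using i1 j
      · intro k j hj
        cases j with
        | zero =>
          rw [List.drop_zero, List.drop_zero, hk.maxInc_eq]
          simp only [word_cons]
          rw [maxInc_slide_past k hc.2 hd.2 hr hz'z h3]
        | succ j => simpa using i2 k j (by simpa using hj)
      · intro k i hi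
        obtain rfl : i = e := by omega
        cases i with
        | zero =>
          have hk2 := insTab_knuth (d.erase z').reverse hT''.desc
          have := maxInc_slide_end (v := word T) k hc.2 hd.2 h3
          simpa [hk2.maxInc_eq] using this
        | succ i => simpa using i3 k i rfl

/-! ### Monotonicity in the columns -/

theorem word_drop_sublist (T : List (List ℕ+)) {i j : ℕ} (h : i ≤ j) :
    (word (T.drop j)).Sublist (word (T.drop i)) := by
  obtain ⟨e, rfl⟩ := Nat.exists_eq_add_of_le h
  have : word (T.drop i) = word ((T.drop i).take e) ++ word (T.drop (i + e)) := by
    rw [← word_append, ← List.drop_drop, List.take_append_drop]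
  rw [this]
  exact List.sublist_append_right _ _

theorem maxInc_drop_anti (k : ℕ) (T : List (List ℕ+)) {i j : ℕ} (h : i ≤ j) :
    maxInc k (word (T.drop j)) ≤ maxInc k (word (T.drop i)) :=
  maxInc_mono k (word_drop_sublist T h)

theorem colLength_drop (T : List (List ℕ+)) (i j : ℕ) :
    colLength (T.drop i) j = colLength T (i + j) := by
  simp [colLength, List.getD_eq_getElem?_getD]

theorem colLength_zero (T : List (List ℕ+)) : colLength T 0 = (T.headD []).length := by
  cases T <;> rfl

theorem IsRSSYT.maxInc_le_colLength {T : List (List ℕ+)} (hT : IsRSSYT T) (k j : ℕ) :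
    maxInc k (word (T.drop j)) ≤ colLength T j := by
  have := maxInc_le_of_incBound k (hT.drop j).incBound
  rwa [← colLength_zero, colLength_drop, Nat.add_zero] at this

theorem IsRSSYT.colLength_anti {T : List (List ℕ+)} (hT : IsRSSYT T) :
    Antitone (colLength T) := by
  apply antitone_nat_of_succ_le
  intro j
  have h1 := hT.drop j
  have e1 := colLength_drop T j 0
  rw [Nat.add_zero] at e1
  rw [← e1, ← colLength_drop T j 1]
  cases h : T.drop j with
  | nil => simp
  | cons c S =>
    rw [h] at h1
    rw [colLength_cons_zero, colLength_cons_succ, colLength_zero]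
    exact (isRSSYT_cons.mp h1).2.1.length_le

/-- Let `K` be the last column obtained from the second of the two columns. Entries of `K` above `k`
extend any increasing subword with letters `≤ k`, and the total length is bounded by the first
column. -/
theorem IsRSSYT.maxInc_add_colLength_le {T : List (List ℕ+)} (hT : IsRSSYT T) (k j : ℕ) :
    maxInc k (word (T.drop j)) + colLength T (j + 1) ≤
      maxInc k (word (T.drop (j + 1))) + colLength T j := by
  have h1 := hT.drop j
  have e1 := colLength_drop T j 0
  have e2 := colLength_drop T j 1
  rw [Nat.add_zero] at e1
  rw [← e1, ← e2, ← List.drop_drop]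
  generalize T.drop j = S at h1
  cases S with
  | nil => simp
  | cons c S =>
    have hb := h1.incBound
    cases S with
    | nil =>
      have := maxInc_le_of_incBound k hb
      simp at this ⊢
      omega
    | cons d S =>
      have h2 := (isRSSYT_cons.mp h1).2.2
      obtain ⟨K, V, hK, hV, hl, hs, hk⟩ := exists_last_column h2
      have h3 := maxInc_eq_of_last_column h2 hK.2 hl hk k
      have hk' : KnuthEquiv (word (c :: d :: S)) ((c.reverse ++ word V) ++ K.reverse) := by
        rw [word_cons, List.append_assoc]
        exact hk.append_left _
      have h4 := maxInc_add_countP_le hK.2 (hb.knuthEquiv hk') k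
      have h5 := length_eq_countP_le_add K k
      rw [← hk'.maxInc_eq] at h4
      simp only [List.drop_zero, List.drop_succ_cons, colLength_cons_zero, colLength_cons_succ,
        List.headD_cons] at h4 ⊢
      omega

/-! ### Shapes and column lengths -/

theorem squareSum_eq_sum {T : List (List ℕ+)} {n : ℕ} (h : T.length ≤ n) :
    squareSum T = ∑ j ∈ Finset.range n, colLength T j ^ 2 := by
  induction T generalizing n with
  | nil => simp [squareSum]
  | cons c T ih =>
    cases n with
    | zero => simp at h
    | succ n =>
      rw [Finset.sum_range_succ']
      have := ih (n := n) (by simpa using h)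
      simp only [colLength_cons_succ, colLength_cons_zero, ← this]
      simp [squareSum, Nat.add_comm]

theorem colLength_appendBox (y : ℕ+) {c : ℕ} {Q : List (List ℕ+)} (hc : c ≤ Q.length) (j : ℕ) :
    colLength (appendBox y c Q) j = colLength Q j + if j = c then 1 else 0 := by
  induction Q generalizing c j with
  | nil =>
    obtain rfl : c = 0 := by simpa using hc
    cases j <;> simp [appendBox]
  | cons d Q ih =>
    cases c with
    | zero => cases j <;> simp [appendBox]
    | succ c =>
      cases j with
      | zero => simp [appendBox]
      | succ j => simpa [appendBox] using ih (by simpa using hc) j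

theorem word_appendBox (y : ℕ+) {c : ℕ} {Q : List (List ℕ+)} (hc : c ≤ Q.length) :
    word (appendBox y c Q) = word (Q.take c) ++ y :: word (Q.drop c) := by
  induction Q generalizing c with
  | nil => simp [appendBox]
  | cons d Q ih =>
    cases c with
    | zero => simp [appendBox]
    | succ c => simp [appendBox, ih (by simpa using hc)]

/-! ### Evacuation and its change when a smallest letter is added -/

/-- The tableau of the reversed and flipped word of `Q` (evacuation). -/
def evacuation (N : ℕ) (Q : List (List ℕ+)) : List (List ℕ+) := insTab (star N (word Q)) []

theorem isRSSYT_evacuation (N : ℕ) (Q : List (List ℕ+)) : IsRSSYT (evacuation N Q) :=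
  isRSSYT_nil.insTab _

theorem word_evacuation_knuth (N : ℕ) (Q : List (List ℕ+)) :
    KnuthEquiv (word (evacuation N Q)) (star N (word Q)) := word_insTab_knuth _

theorem squareSum_starColumns (N : ℕ) (Q : List (List ℕ+)) :
    squareSum (starColumns N Q) = squareSum Q := by
  simp [squareSum, starColumns, Function.comp_def]

/-- The flipped columns of `Q` factor a word of the class of its evacuation, which gives one
inequality by `squareSum_le_insTab`. As `star` is an involution, the roles can be exchanged. -/
theorem squareSum_evacuation {N : ℕ} {Q : List (List ℕ+)} (hQ : IsRSSYT Q)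
    (hN : ∀ a ∈ word Q, (a : ℕ) ≤ N) : squareSum (evacuation N Q) = squareSum Q := by
  apply le_antisymm
  · have h1 : ∀ a ∈ word (evacuation N Q), (a : ℕ) ≤ N := fun a ha =>
      star_le hN a ((word_evacuation_knuth N Q).perm.mem_iff.mp ha)
    have h2 : KnuthEquiv (star N (word (evacuation N Q))) (word Q) := by
      have := (word_evacuation_knuth N Q).star h1
      rwa [star_star hN] at this
    have h3 := squareSum_le_insTab (V := starColumns N (evacuation N Q)) fun c hc =>
      (isColumn_starColumns h1 (isRSSYT_evacuation N Q).1 c hc).2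
    rwa [word_starColumns, h2.insTab_eq_of_isRSSYT hQ, squareSum_starColumns] at h3
  · have h3 := squareSum_le_insTab (V := starColumns N Q) fun c hc =>
      (isColumn_starColumns hN hQ.1 c hc).2
    rwa [word_starColumns, squareSum_starColumns] at h3

/-- A box added in column `e` raises the sum of squares by `2 * h e + 1`, so `h e = h c`. Of two
different columns of equal length only the left one can be extended within a partition shape. -/
theorem eq_of_sum_sq {f g h : ℕ → ℕ} {c e n : ℕ} (hf : Antitone f) (hg : Antitone g)
    (hfe : ∀ j, f j = h j + if j = e then 1 else 0) (hgc : ∀ j, g j = h j + if j = c then 1 else 0)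
    (hc : c < n) (he : e < n)
    (hs : ∑ j ∈ Finset.range n, f j ^ 2 = ∑ j ∈ Finset.range n, g j ^ 2) : e = c := by
  have key (f : ℕ → ℕ) (e : ℕ) (he : e < n) (hfe : ∀ j, f j = h j + if j = e then 1 else 0) :
      ∑ j ∈ Finset.range n, f j ^ 2 = ∑ j ∈ Finset.range n, h j ^ 2 + (2 * h e + 1) := by
    have : ∀ j ∈ Finset.range n, f j ^ 2 = h j ^ 2 + if j = e then 2 * h e + 1 else 0 := by
      intro j _
      rw [hfe j]
      split_ifs with hj
      · subst hj; ring
      · ring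
    rw [Finset.sum_congr rfl this, Finset.sum_add_distrib, Finset.sum_ite_eq',
      if_pos (Finset.mem_range.mpr he)]
  rw [key f e he hfe, key g c hc hgc] at hs
  by_contra hne
  rcases lt_or_gt_of_ne hne with hlt | hlt
  · have h1 := hg hlt.le
    rw [hgc, hgc, if_pos rfl, if_neg hne] at h1
    omega
  · have h1 := hf hlt.le
    rw [hfe, hfe, if_pos rfl, if_neg (Ne.symm hne)] at h1
    omega

/-- The number of entries at most `k` in column `j` of the left key of `Q`. -/
noncomputable def leftCount (N : ℕ) (Q : List (List ℕ+)) (k j : ℕ) : ℕ :=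
  colLength Q j - maxInc (N - k) (word ((evacuation N Q).drop j))

/-- Under `star` a smallest letter of `Q'` becomes a largest one, and erasing largest letters
respects Knuth equivalence. So evacuating `Q` means deleting the largest letter from the evacuation
of `Q'` and rectifying. -/
theorem exists_evacuation_cons {N : ℕ} {Q Q' : List (List ℕ+)} {a b : List ℕ+} {y : ℕ+}
    (hw : word Q' = a ++ y :: b) (hw' : word Q = a ++ b) (hb : y ∉ b)
    (hy : ∀ u ∈ word Q', y ≤ u) (hN : ∀ u ∈ word Q', (u : ℕ) ≤ N) :
    ∃ c T, evacuation N Q' = c :: T ∧ flipLetter N y ∈ c ∧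
      evacuation N Q = insTab (c.erase (flipLetter N y)).reverse T := by
  have hkn := word_evacuation_knuth N Q'
  have hyw : y ∈ word Q' := by simp [hw]
  have hmem : flipLetter N y ∈ word (evacuation N Q') :=
    hkn.perm.mem_iff.mpr (mem_star.mpr ⟨y, hyw, rfl⟩)
  have hmax : ∀ u ∈ word (evacuation N Q'), u ≤ flipLetter N y := by
    intro u hu
    obtain ⟨v, hv, rfl⟩ := mem_star.mp (hkn.perm.mem_iff.mp hu)
    exact flipLetter_mono (hy v hv) (hN v hv)
  have hU := isRSSYT_evacuation N Q'
  have herase : (star N (word Q')).erase (flipLetter N y) = star N (word Q) := by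
    rw [hw, hw', star_append, star_append]
    have h1 : star N (y :: b) = star N b ++ [flipLetter N y] := by simp [star]
    -- `star` puts `b` in front, so this makes the flipped `y` the leftmost occurrence, the one
    -- removed by `erase`.
    have h2 : flipLetter N y ∉ star N b := by
      intro h
      obtain ⟨v, hv, hvy⟩ := mem_star.mp h
      have h3 := congrArg (flipLetter N) hvy
      rw [flipLetter_flipLetter (hN v (by simp [hw, hv])), flipLetter_flipLetter (hN y hyw)] at h3
      exact hb (h3 ▸ hv)
    rw [h1, List.append_assoc, List.erase_append_right _ h2]
    simp
  have hk := hkn.erase hmax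
  rw [herase] at hk
  cases hE : evacuation N Q' with
  | nil => rw [hE] at hmem; simp at hmem
  | cons c T =>
    rw [hE] at hmem hmax hU hk
    have hc : flipLetter N y ∈ c := by
      -- A largest letter, seen as a subword of length 1, forces an equally large entry in the first
      -- column.
      have h1 := hU.length_le_countP (s := [flipLetter N y]) (v := flipLetter N y)
        (by simpa using hmem) (by simp) (by simp)
      obtain ⟨u, hu, hyu⟩ := List.countP_pos_iff.mp (Nat.lt_of_lt_of_le Nat.zero_lt_one h1)
      simp only [List.headD_cons, decide_eq_true_eq] at hu hyu
      have h2 := hmax u (by simp [hu])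
      rwa [le_antisymm hyu h2]
    refine ⟨c, T, rfl, hc, ?_⟩
    have hcol := (isRSSYT_cons.mp hU).1
    rw [word_cons, List.erase_append_left _ (by simpa using hc), ← desc_reverse_erase hcol.2] at hk
    rw [evacuation, ← hk.insTab_eq, insTab_append, (isRSSYT_cons.mp hU).2.2.insTab_word]

/-- The evacuations of `Q` and of the extended tableau differ by a slide, whose clauses are
translated into `leftCount`. If `maxInc` stays at `c`, the longer column gains a count; if it grows
with the column, the count stays and the slide supplies the comparison with column `c - 1`. -/
theorem evacuation_step {N c : ℕ} {Q : List (List ℕ+)} {y : ℕ+} (hQ' : IsRSSYT (appendBox y c Q))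
    (hc : c ≤ Q.length) (hb : y ∉ word (Q.drop c)) (hy : ∀ u ∈ word (appendBox y c Q), y ≤ u)
    (hN : ∀ u ∈ word (appendBox y c Q), (u : ℕ) ≤ N)
    (hsh : ∀ j, colLength (evacuation N Q) j = colLength Q j) :
    (∀ j, colLength (evacuation N (appendBox y c Q)) j = colLength (appendBox y c Q) j) ∧
    (∀ k : ℕ, (y : ℕ) ≤ k → (∀ j, j ≠ c → leftCount N (appendBox y c Q) k j = leftCount N Q k j) ∧
      (leftCount N (appendBox y c Q) k c = leftCount N Q k c + 1 ∨
        ∃ i, i + 1 = c ∧ leftCount N (appendBox y c Q) k c = leftCount N Q k c ∧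
          leftCount N Q k i ≤ leftCount N Q k c)) := by
  have hw := word_appendBox y hc
  have hw' : word Q = word (Q.take c) ++ word (Q.drop c) := by
    rw [← word_append, List.take_append_drop]
  have hcl := colLength_appendBox y hc
  obtain ⟨d, T, hE, hyd, hE'⟩ := exists_evacuation_cons hw hw' hb hy hN
  have hU := isRSSYT_evacuation N (appendBox y c Q)
  have hUQ := isRSSYT_evacuation N Q
  have hsq := squareSum_evacuation hQ' hN
  have hUw := word_evacuation_knuth N (appendBox y c Q)
  have hyN : (y : ℕ) ≤ N := hN y (by simp [hw])
  rw [hE] at hU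
  obtain ⟨e, s1, s2, s4, s3⟩ := exists_slide_tableau hU hyd
  rw [← hE] at s1 s2 s3 s4 hU
  rw [← hE'] at s1 s2 s3 s4
  -- The slide frees a box in some column `e`. Evacuation preserves the sum of squares, which forces
  -- `e` to be the column of the new box.
  have hec : e = c := by
    set n := (evacuation N (appendBox y c Q)).length + (appendBox y c Q).length + c + e + 1
    rw [squareSum_eq_sum (n := n) (by omega), squareSum_eq_sum (n := n) (by omega)] at hsq
    refine eq_of_sum_sq (n := n) hU.colLength_anti hQ'.colLength_anti (h := colLength Q) ?_ hcl
      (by omega) (by omega) hsq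
    intro j
    rw [s1 j, hsh j]
  subst hec
  have hsh' : ∀ j, colLength (evacuation N (appendBox y e Q)) j = colLength (appendBox y e Q) j := by
    intro j
    rw [s1 j, hsh j, hcl j]
  refine ⟨hsh', fun k hk => ⟨?_, ?_⟩⟩
  · intro j hj
    rw [leftCount, leftCount, s2 _ j hj, hcl j, if_neg hj, Nat.add_zero]
  · have hle : ∀ j, maxInc (N - k) (word ((evacuation N Q).drop j)) ≤ colLength Q j := by
      intro j
      rw [← hsh j]
      exact hUQ.maxInc_le_colLength _ j
    have hle' : ∀ j, maxInc (N - k) (word ((evacuation N (appendBox y e Q)).drop j)) ≤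
        colLength (appendBox y e Q) j := by
      intro j
      rw [← hsh' j]
      exact hU.maxInc_le_colLength _ j
    have same (h : maxInc (N - k) (word ((evacuation N (appendBox y e Q)).drop e)) =
        maxInc (N - k) (word ((evacuation N Q).drop e))) :
        leftCount N (appendBox y e Q) k e = leftCount N Q k e + 1 := by
      have h1 := hle e
      rw [leftCount, leftCount, h, hcl e, if_pos rfl]
      omega
    cases e with
    | zero =>
      left
      apply same
      have hk2 := insTab_knuth (d.erase (flipLetter N y)).reverse (T := T)
        (fun c hc => hU.desc c (by rw [hE]; simp [hc]))
      rw [← hE'] at hk2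
      have hcol := (isRSSYT_cons.mp (hE ▸ hU)).1
      rw [List.drop_zero, List.drop_zero, hk2.maxInc_eq, hE, word_cons, desc_reverse_erase hcol.2]
      -- Since `y ≤ k`, the erased letter exceeds the cut-off and is invisible to the subwords
      -- considered.
      have hlt : N - k < (flipLetter N y : ℕ) := by
        rw [coe_flipLetter hyN]; omega
      apply le_antisymm
      · obtain ⟨s, ⟨t1, t2, t3⟩, hl⟩ := exists_isIncSubword (N - k) (d.reverse ++ word T)
        rw [← hl]
        refine IsIncSubword.length_le ⟨?_, t2, t3⟩
        rw [← List.erase_append_left _ (by simpa using hyd)]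
        exact sublist_erase_of_notMem t1 fun h => absurd (t3 _ h) (by omega)
      · exact maxInc_mono _ (List.erase_sublist.append (List.Sublist.refl _))
    | succ i =>
      rcases s3 (N - k) i rfl with h | h
      · exact Or.inl (same h)
      · have h1 := s2 (N - k) i (by omega)
        have h2 := hle i
        have h3 := hle (i + 1)
        have h4 := hle' (i + 1)
        have h5 := hle' i
        by_cases hs : maxInc (N - k) (word ((evacuation N (appendBox y (i + 1) Q)).drop (i + 1))) =
            maxInc (N - k) (word ((evacuation N Q).drop (i + 1)))
        · exact Or.inl (same hs)
        · right
          have h6 : maxInc (N - k) (word ((evacuation N Q).drop (i + 1))) + 1 =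
              maxInc (N - k) (word ((evacuation N (appendBox y (i + 1) Q)).drop (i + 1))) := by
            have := s4 (N - k)
            omega
          rw [hsh', hsh'] at h
          have h7 := hcl i
          have h8 := hcl (i + 1)
          rw [if_neg (by omega)] at h7
          rw [if_pos rfl] at h8
          refine ⟨i, rfl, ?_, ?_⟩
          · simp only [leftCount]; omega
          · simp only [leftCount]; omega

/-! ### Successive insertions -/

/-- Row bumping: a weakly larger letter leaves each column with a weakly larger bumped letter, and
still bumps in the column where the earlier route ended. -/
theorem insertTableau_snd_lt {x x' : ℕ+} (h : x' ≤ x) (T : List (List ℕ+)) :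
    (insertTableau x' T).2 < (insertTableau x (insertTableau x' T).1).2 := by
  induction T generalizing x x' with
  | nil =>
    have h1 : (insertColumn x [x']).2 = some x' := by rw [insertColumn_cons_of_le _ h]
    rw [insertTableau, insertTableau_of_some _ h1]
    simp
  | cons c T ih =>
    obtain ⟨a, h1, h2, -⟩ := exists_insertColumn_insertColumn h (t := c)
    cases hy : (insertColumn x' c).2 with
    | none =>
      rw [insertTableau_of_none T hy, insertTableau_of_some _ h1]
      simp
    | some y =>
      rw [insertTableau_of_some T hy, insertTableau_of_some _ h1]
      simpa using ih (h2 y hy)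

/-- The complementary case: a smaller second letter stops no later than the first one. This recovers
the Knuth condition on a biword from its recording tableau. -/
theorem insertTableau_snd_le_of_lt {x x' : ℕ+} (h : x < x') {T : List (List ℕ+)}
    (hT : ∀ c ∈ T, Desc c) :
    (insertTableau x (insertTableau x' T).1).2 ≤ (insertTableau x' T).2 := by
  induction T generalizing x x' with
  | nil =>
    have h1 : (insertColumn x [x']).2 = none := by
      rw [insertColumn_cons_of_lt _ h]; rfl
    rw [insertTableau, insertTableau_of_none _ h1]
  | cons c T ih =>
    simp only [List.mem_cons, forall_eq_or_imp] at hT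
    cases hy : (insertColumn x (insertColumn x' c).1).2 with
    | none =>
      cases hz : (insertColumn x' c).2 with
      | none => rw [insertTableau_of_none T hz, insertTableau_of_none _ hy]
      | some z => rw [insertTableau_of_some T hz, insertTableau_of_none _ hy]; simp
    | some b =>
      obtain ⟨e, h1, h2, -⟩ := exists_of_insertColumn_insertColumn h hT.1 hy
      rw [insertTableau_of_some T h1, insertTableau_of_some _ hy]
      simpa using ih h2 hT.2

/-! ### Reverse insertion undoes insertion -/

theorem revInsertColumn_append {a b : List ℕ+} {x z : ℕ+} (hx : z ≤ x) (hb : ∀ v ∈ b, v < z) :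
    revInsertColumn z (a ++ x :: b) = (a ++ z :: b, x) := by
  induction a with
  | nil =>
    have : ¬ ∃ v ∈ b, z ≤ v := by
      rintro ⟨v, hv, hzv⟩
      exact (hb v hv).not_ge hzv
    simp only [List.nil_append, revInsertColumn, if_neg this]
  | cons h a ih =>
    have : ∃ v ∈ a ++ x :: b, z ≤ v := ⟨x, by simp, hx⟩
    simp only [List.cons_append, revInsertColumn, if_pos this, ih]

theorem revInsertColumn_insertColumn {x y : ℕ+} {c : List ℕ+} (hc : Desc c)
    (h : (insertColumn x c).2 = some y) : revInsertColumn y (insertColumn x c).1 = (c, x) := by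
  rcases insertColumn_cases x c with ⟨h1, h2⟩ | ⟨a, y', b, rfl, hy, hu, h2⟩
  · simp [h2] at h
  · rw [h2] at h ⊢
    obtain rfl : y' = y := by simpa using h
    rw [revInsertColumn_append hy]
    exact (List.pairwise_cons.mp (List.pairwise_append.mp hc).2.1).1

theorem removeBox_zero_append {d : List ℕ+} (hd : d ≠ []) (y : ℕ+) (T : List (List ℕ+)) :
    removeBox 0 ((d ++ [y]) :: T) = (d :: T, y) := by
  have : ¬ d.length = 0 := fun h => hd (List.length_eq_zero_iff.mp h)
  simp [removeBox, hd]

theorem removeBox_appendBox (y : ℕ+) {c : ℕ} {Q : List (List ℕ+)} (hQ : ∀ d ∈ Q, d ≠ [])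
    (hc : c ≤ Q.length) : removeBox c (appendBox y c Q) = (Q, y) := by
  induction Q generalizing c with
  | nil =>
    obtain rfl : c = 0 := by simpa using hc
    simp [appendBox, removeBox]
  | cons d Q ih =>
    simp only [List.mem_cons, forall_eq_or_imp] at hQ
    cases c with
    | zero => exact removeBox_zero_append hQ.1 y Q
    | succ c => simp [appendBox, removeBox, ih hQ.2 (by simpa using hc)]

theorem revInsertTableau_insertTableau {T : List (List ℕ+)} (hT : IsRSSYT T) (x : ℕ+) :
    revInsertTableau (insertTableau x T).2 (insertTableau x T).1 = (T, x) := by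
  induction T generalizing x with
  | nil => simp [insertTableau, revInsertTableau, removeBox]
  | cons c T ih =>
    obtain ⟨hc, hr, hT'⟩ := isRSSYT_cons.mp hT
    cases hy : (insertColumn x c).2 with
    | none =>
      rw [insertTableau_of_none T hy, (insertColumn_of_none hy).2, revInsertTableau,
        removeBox_zero_append hc.1]
    | some y =>
      rw [insertTableau_of_some T hy, revInsertTableau, ih hT' y,
        revInsertColumn_insertColumn hc.2 hy]

/-! ### The box of the rightmost smallest entry -/

theorem minEntry_eq {Q : List (List ℕ+)} {y : ℕ+} (hy : y ∈ Q.flatten)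
    (hmin : ∀ u ∈ Q.flatten, y ≤ u) : minEntry Q = y := by
  have : Q.flatten.min? = some y := List.min?_eq_some_iff.mpr ⟨hy, hmin⟩
  rw [minEntry, this]; rfl

theorem minColumn_eq {Q : List (List ℕ+)} {c : ℕ} (hc : minEntry Q ∈ Q.getD c [])
    (hr : ∀ j, minEntry Q ∈ Q.getD j [] → j ≤ c) : minColumn Q = c := by
  have hlt : c < Q.length := by
    by_contra hge
    rw [List.getD_eq_default _ _ (not_lt.mp hge)] at hc
    simp at hc
  obtain ⟨n, hn⟩ := Nat.exists_eq_add_of_lt hlt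
  have hsplit : List.range Q.length = List.range c ++ [c] ++ (List.range n).map (c + 1 + ·) := by
    rw [hn, Nat.add_right_comm, List.range_add, List.range_succ]
  have h2 : ((List.range n).map (c + 1 + ·)).filter (fun k => decide (minEntry Q ∈ Q.getD k [])) =
      [] := by
    rw [List.filter_eq_nil_iff]
    intro j hj
    obtain ⟨i, -, rfl⟩ := List.mem_map.mp hj
    intro h
    have := hr _ (by simpa using h)
    omega
  rw [minColumn, hsplit, List.filter_append, List.filter_append, h2, List.append_nil,
    List.filter_cons_of_pos (by simpa using hc), List.filter_nil, List.getLastD_eq_getLast?,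
    List.getLast?_append]
  simp

theorem mem_flatten_iff_mem_word {Q : List (List ℕ+)} {u : ℕ+} : u ∈ Q.flatten ↔ u ∈ word Q := by
  rw [mem_word, List.mem_flatten]

theorem mem_word_drop {Q : List (List ℕ+)} {c : ℕ} {u : ℕ+} :
    u ∈ word (Q.drop c) ↔ ∃ j, c ≤ j ∧ u ∈ Q.getD j [] := by
  rw [mem_word]
  constructor
  · rintro ⟨d, hd, hu⟩
    obtain ⟨i, hi, rfl⟩ := List.mem_iff_getElem.mp hd
    rw [List.length_drop] at hi
    refine ⟨c + i, by omega, ?_⟩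
    rw [List.getD_eq_getElem _ _ (by omega)]
    simpa using hu
  · rintro ⟨j, hj, hu⟩
    have hlt : j < Q.length := by
      by_contra hge
      rw [List.getD_eq_default _ _ (not_lt.mp hge)] at hu
      simp at hu
    rw [List.getD_eq_getElem _ _ hlt] at hu
    refine ⟨Q[j], ?_, hu⟩
    rw [List.mem_iff_getElem]
    refine ⟨j - c, by simp; omega, ?_⟩
    simp [Nat.add_sub_cancel' hj]

theorem getD_appendBox (y : ℕ+) {c : ℕ} {Q : List (List ℕ+)} (hc : c ≤ Q.length) (j : ℕ) :
    (appendBox y c Q).getD j [] = if j = c then Q.getD c [] ++ [y] else Q.getD j [] := by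
  induction Q generalizing c j with
  | nil =>
    obtain rfl : c = 0 := by simpa using hc
    cases j <;> simp [appendBox]
  | cons d Q ih =>
    cases c with
    | zero => cases j <;> simp [appendBox]
    | succ c =>
      cases j with
      | zero => simp [appendBox]
      | succ j => simpa [appendBox] using ih (by simpa using hc) j

theorem perm_word_appendBox (y : ℕ+) {c : ℕ} {Q : List (List ℕ+)} (hc : c ≤ Q.length) :
    (word (appendBox y c Q)).Perm (y :: word Q) := by
  have : word Q = word (Q.take c) ++ word (Q.drop c) := by
    rw [← word_append, List.take_append_drop]
  rw [word_appendBox y hc, this]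
  exact List.perm_middle

/-- The box added last is the one that reverse insertion looks for. -/
theorem min_of_appendBox {y : ℕ+} {c : ℕ} {Q : List (List ℕ+)} (hc : c ≤ Q.length)
    (hy : ∀ u ∈ word Q, y ≤ u) (hn : y ∉ word (Q.drop c)) :
    minEntry (appendBox y c Q) = y ∧ minColumn (appendBox y c Q) = c := by
  have h1 : minEntry (appendBox y c Q) = y := by
    apply minEntry_eq
    · rw [mem_flatten_iff_mem_word, (perm_word_appendBox y hc).mem_iff]; simp
    · intro u hu
      rw [mem_flatten_iff_mem_word, (perm_word_appendBox y hc).mem_iff] at hu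
      rcases List.mem_cons.mp hu with rfl | hu
      · exact le_rfl
      · exact hy u hu
  refine ⟨h1, minColumn_eq ?_ ?_⟩
  · rw [h1, getD_appendBox y hc, if_pos rfl]; simp
  · intro j hj
    rw [h1, getD_appendBox y hc] at hj
    by_contra hlt
    rw [if_neg (by omega)] at hj
    exact hn (mem_word_drop.mpr ⟨j, by omega, hj⟩)

theorem RowsWeaklyDecrease.append_right {d e : List ℕ+} {y : ℕ+} (h : RowsWeaklyDecrease d e)
    (hl : e.length < d.length) (hy : ∀ u ∈ d, y ≤ u) : RowsWeaklyDecrease d (e ++ [y]) := by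
  intro r hr
  simp only [List.length_append, List.length_singleton] at hr
  refine ⟨by omega, ?_⟩
  by_cases hre : r < e.length
  · rw [List.getElem_append_left hre]
    exact (h r hre).2
  · obtain rfl : r = e.length := by omega
    simp [hy]

theorem headD_appendBox_succ (y : ℕ+) {c : ℕ} {Q : List (List ℕ+)} (hc : c + 1 ≤ Q.length) :
    (appendBox y (c + 1) Q).headD [] = Q.headD [] := by
  cases Q with
  | nil => simp at hc
  | cons d Q => rfl

theorem headD_appendBox_zero (y : ℕ+) (Q : List (List ℕ+)) :
    (appendBox y 0 Q).headD [] = Q.headD [] ++ [y] := by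
  cases Q <;> rfl

theorem IsRSSYT.appendBox {Q : List (List ℕ+)} {c : ℕ} {y : ℕ+} (hQ : IsRSSYT Q)
    (hc : c ≤ Q.length) (hy : ∀ u ∈ word Q, y ≤ u) (hn : y ∉ word (Q.drop c))
    (hsh : Antitone (colLength (appendBox y c Q))) : IsRSSYT (appendBox y c Q) := by
  induction Q generalizing c with
  | nil =>
    simp only [PlacticKeys.appendBox]
    exact isRSSYT_cons.mpr ⟨⟨by simp, by simp⟩, rowsWeaklyDecrease_nil _, isRSSYT_nil⟩
  | cons d Q ih =>
    obtain ⟨hd, hr, hQ'⟩ := isRSSYT_cons.mp hQ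
    cases c with
    | zero =>
      simp only [PlacticKeys.appendBox]
      refine isRSSYT_cons.mpr ⟨⟨by simp, ?_⟩, hr.append_left _, hQ'⟩
      rw [List.pairwise_append]
      refine ⟨hd.2, by simp, ?_⟩
      intro a ha b hb
      obtain rfl : b = y := by simpa using hb
      exact lt_of_le_of_ne (hy a (by simp [ha])) fun h => hn (by simp [h, ha])
    | succ c =>
      simp only [PlacticKeys.appendBox] at hsh ⊢
      have hc' : c ≤ Q.length := by simpa using hc
      refine isRSSYT_cons.mpr ⟨hd, ?_, ih hQ' hc' (fun u hu => hy u (by simp [hu]))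
        (by simpa using hn) ?_⟩
      · cases c with
        | zero =>
          rw [headD_appendBox_zero]
          apply hr.append_right
          · have := hsh (Nat.zero_le 1)
            rw [colLength_cons_zero, colLength_cons_succ, colLength_zero, headD_appendBox_zero] at this
            simp at this ⊢
            omega
          · exact fun u hu => hy u (by simp [hu])
        | succ c =>
          rw [headD_appendBox_succ y hc']
          exact hr
      · intro i j hij
        simpa using hsh (Nat.succ_le_succ hij)

theorem colLength_eq_of_shape_eq {T Q : List (List ℕ+)} (h : shape T = shape Q) (j : ℕ) :
    colLength T j = colLength Q j := by
  have e (T : List (List ℕ+)) : colLength T j = (shape T).getD j 0 := by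
    simp only [colLength, shape, List.getD_eq_getElem?_getD, List.getElem?_map]
    cases T[j]? <;> simp
  rw [e, e, h]

theorem length_eq_of_shape_eq {T Q : List (List ℕ+)} (h : shape T = shape Q) :
    T.length = Q.length := by
  simpa [shape] using congrArg List.length h

/-! ### The insertion of Knuth biwords -/

theorem rskInsert_append_singleton (w : List (ℕ+ × ℕ+)) (p : ℕ+ × ℕ+) :
    rskInsert (w ++ [p]) = insertStep (rskInsert w) p := by
  simp [rskInsert]

theorem isKnuthBiword_append_singleton {w : List (ℕ+ × ℕ+)} {p : ℕ+ × ℕ+} :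
    IsKnuthBiword (w ++ [p]) ↔ IsKnuthBiword w ∧
      ∀ q ∈ w.getLast?, p.2 ≤ q.2 ∧ (q.2 = p.2 → q.1 ≤ p.1) := by
  simp [IsKnuthBiword, List.isChain_append]

theorem IsKnuthBiword.le_of_mem {w : List (ℕ+ × ℕ+)} {p : ℕ+ × ℕ+} (h : IsKnuthBiword (w ++ [p])) :
    ∀ q ∈ w, p.2 ≤ q.2 := by
  induction w using List.reverseRecOn generalizing p with
  | nil => simp
  | append_singleton w p' ih =>
    obtain ⟨h1, h2⟩ := isKnuthBiword_append_singleton.mp h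
    have h3 := (h2 p' (by simp)).1
    intro q hq
    rcases List.mem_append.mp hq with hq | hq
    · exact h3.trans (ih h1 q hq)
    · obtain rfl : q = p' := by simpa using hq
      exact h3

/-- The properties of the tableaux `(P, Q)` of a Knuth biword that allow one more insertion. -/
structure InsertionInvariant (w : List (ℕ+ × ℕ+)) : Prop where
  left : IsRSSYT (rskInsert w).1
  right : IsRSSYT (rskInsert w).2
  shape_eq : shape (rskInsert w).1 = shape (rskInsert w).2
  perm_left : (word (rskInsert w).1).Perm (w.map Prod.fst)
  perm_right : (word (rskInsert w).2).Perm (w.map Prod.snd)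

theorem InsertionInvariant.snd_le {w : List (ℕ+ × ℕ+)} (h : InsertionInvariant w) (x : ℕ+) :
    (insertTableau x (rskInsert w).1).2 ≤ (rskInsert w).2.length :=
  (insertTableau_snd_le _ _).trans (length_eq_of_shape_eq h.shape_eq).le

theorem InsertionInvariant.min_le {w : List (ℕ+ × ℕ+)} {p : ℕ+ × ℕ+} (h : InsertionInvariant w)
    (hw : IsKnuthBiword (w ++ [p])) : ∀ u ∈ word (rskInsert w).2, p.2 ≤ u := by
  intro u hu
  obtain ⟨q, hq, rfl⟩ := List.mem_map.mp (h.perm_right.mem_iff.mp hu)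
  exact hw.le_of_mem q hq

theorem IsRSSYT.ne_nil {Q : List (List ℕ+)} (hQ : IsRSSYT Q) : ∀ d ∈ Q, d ≠ [] :=
  fun d hd => (hQ.1 d hd).1

theorem InsertionInvariant.append_singleton {w : List (ℕ+ × ℕ+)} {p : ℕ+ × ℕ+}
    (h : InsertionInvariant w) (hw : IsKnuthBiword (w ++ [p]))
    (hn : p.2 ∉ word ((rskInsert w).2.drop (insertTableau p.1 (rskInsert w).1).2)) :
    InsertionInvariant (w ++ [p]) := by
  have hc := h.snd_le p.1
  have hsh := shape_insertTableau h.shape_eq p.1 p.2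
  have hP := h.left.insertTableau p.1
  have hanti : Antitone (colLength (appendBox p.2 (insertTableau p.1 (rskInsert w).1).2
      (rskInsert w).2)) := by
    have := hP.colLength_anti
    rwa [funext (colLength_eq_of_shape_eq hsh)] at this
  constructor
  · rw [rskInsert_append_singleton]; exact hP
  · rw [rskInsert_append_singleton]
    exact h.right.appendBox hc (h.min_le hw) hn hanti
  · rw [rskInsert_append_singleton]; exact hsh
  · rw [rskInsert_append_singleton, List.map_append]
    refine (insertTableau_knuth p.1 h.left.desc).perm.trans ?_
    exact (h.perm_left.cons _).trans (List.perm_append_singleton _ _).symm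
  · rw [rskInsert_append_singleton, List.map_append]
    refine (perm_word_appendBox p.2 hc).trans ?_
    exact (h.perm_right.cons _).trans (List.perm_append_singleton _ _).symm

/-- The second claim is made for all possible next pairs, so that the induction can use it for the
last pair. An occurrence of the next recorded letter at or right of its box would have to equal the
letter recorded last; then the new box is strictly right of the previous one, and the occurrence
contradicts the claim one step earlier. -/
theorem insertionInvariant_and_notMem {w : List (ℕ+ × ℕ+)} (hw : IsKnuthBiword w) :
    InsertionInvariant w ∧ ∀ p, IsKnuthBiword (w ++ [p]) →
      p.2 ∉ word ((rskInsert w).2.drop (insertTableau p.1 (rskInsert w).1).2) := by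
  induction w using List.reverseRecOn with
  | nil =>
    refine ⟨⟨isRSSYT_nil, isRSSYT_nil, rfl, by simp [rskInsert], by simp [rskInsert]⟩, ?_⟩
    simp [rskInsert]
  | append_singleton v q ih =>
    obtain ⟨hv, hvn⟩ := ih (isKnuthBiword_append_singleton.mp hw).1
    have hn := hvn q hw
    refine ⟨hv.append_singleton hw hn, ?_⟩
    intro p hp
    obtain ⟨h3, h4⟩ := (isKnuthBiword_append_singleton.mp hp).2 q (by simp)
    rw [rskInsert_append_singleton, insertStep]
    intro hmem
    obtain ⟨j, hj, hmem⟩ := mem_word_drop.mp hmem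
    simp only at hj hmem
    have hsnd := hv.snd_le q.1
    have hqp : q.2 ≤ p.2 := by
      have h5 : p.2 ∈ word (appendBox q.2 (insertTableau q.1 (rskInsert v).1).2 (rskInsert v).2) := by
        have := mem_word_drop (c := 0).mpr ⟨j, Nat.zero_le _, hmem⟩
        simpa using this
      rw [(perm_word_appendBox _ hsnd).mem_iff] at h5
      rcases List.mem_cons.mp h5 with h5 | h5
      · exact h5.ge
      · exact hv.min_le hw _ h5
    have heq : q.2 = p.2 := le_antisymm hqp h3
    have hlt := insertTableau_snd_lt (h4 heq) (rskInsert v).1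
    rw [getD_appendBox _ hsnd, if_neg (by omega), ← heq] at hmem
    exact hn (mem_word_drop.mpr ⟨j, by omega, hmem⟩)

theorem IsKnuthBiword.invariant {w : List (ℕ+ × ℕ+)} (hw : IsKnuthBiword w) :
    InsertionInvariant w := (insertionInvariant_and_notMem hw).1

theorem IsKnuthBiword.notMem {w : List (ℕ+ × ℕ+)} {p : ℕ+ × ℕ+} (hw : IsKnuthBiword (w ++ [p])) :
    p.2 ∉ word ((rskInsert w).2.drop (insertTableau p.1 (rskInsert w).1).2) :=
  (insertionInvariant_and_notMem (isKnuthBiword_append_singleton.mp hw).1).2 p hw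

theorem length_flatten_eq (Q : List (List ℕ+)) : Q.flatten.length = (word Q).length := by
  induction Q with
  | nil => rfl
  | cons d Q ih => simp only [List.flatten_cons, word_cons, List.length_append, ih,
      List.length_reverse]

theorem IsKnuthBiword.rskReverse_rskInsert {w : List (ℕ+ × ℕ+)} (hw : IsKnuthBiword w) :
    rskReverse (rskInsert w) = w := by
  induction w using List.reverseRecOn with
  | nil => rfl
  | append_singleton v q ih =>
    have hv := (isKnuthBiword_append_singleton.mp hw).1
    have hi := hv.invariant
    have hc := hi.snd_le q.1
    obtain ⟨h1, h2⟩ := min_of_appendBox hc (hi.min_le hw) hw.notMem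
    rw [rskReverse, rskInsert_append_singleton]
    simp only [insertStep]
    rw [length_flatten_eq, (perm_word_appendBox _ hc).length_eq, List.length_cons,
      rskReverseSteps, h1, h2, revInsertTableau_insertTableau hi.left,
      removeBox_appendBox _ hi.right.ne_nil hc, ← length_flatten_eq]
    have := ih hv
    rw [rskReverse] at this
    rw [this]

/-! ### Insertion undoes reverse insertion -/

theorem revInsertColumn_cases {z : ℕ+} {c : List ℕ+} (h : ∃ v ∈ c, z ≤ v) :
    ∃ a v b, c = a ++ v :: b ∧ z ≤ v ∧ (∀ u ∈ b, u < z) ∧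
      revInsertColumn z c = (a ++ z :: b, v) := by
  induction c with
  | nil => simp at h
  | cons x c ih =>
    by_cases hc : ∃ v ∈ c, z ≤ v
    · obtain ⟨a, v, b, rfl, h1, h2, h3⟩ := ih hc
      refine ⟨x :: a, v, b, rfl, h1, h2, ?_⟩
      simp only [revInsertColumn, if_pos hc, h3, List.cons_append]
    · refine ⟨[], x, c, rfl, ?_, ?_, by simp only [revInsertColumn, if_neg hc, List.nil_append]⟩
      · obtain ⟨v, hv, hz⟩ := h
        rcases List.mem_cons.mp hv with rfl | hv
        · exact hz
        · exact absurd ⟨v, hv, hz⟩ hc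
      · intro u hu
        by_contra hlt
        exact hc ⟨u, hu, not_lt.mp hlt⟩

theorem revInsertColumn_spec {z : ℕ+} {c : List ℕ+} (hc : Desc c) (h : ∃ v ∈ c, z ≤ v) :
    Desc (revInsertColumn z c).1 ∧ (revInsertColumn z c).1.length = c.length ∧
      insertColumn (revInsertColumn z c).2 (revInsertColumn z c).1 = (c, some z) := by
  obtain ⟨a, v, b, rfl, h1, h2, h3⟩ := revInsertColumn_cases h
  rw [h3]
  obtain ⟨p1, p2, p3⟩ := List.pairwise_append.mp hc
  have hav : ∀ u ∈ a, v < u := fun u hu => p3 u hu v (by simp)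
  refine ⟨?_, by simp, ?_⟩
  · simp only [Desc, List.pairwise_append, List.pairwise_cons, List.mem_cons]
    refine ⟨p1, ⟨h2, (List.pairwise_cons.mp p2).2⟩, ?_⟩
    rintro u hu w (rfl | hw)
    · exact h1.trans_lt (hav u hu)
    · exact p3 u hu w (by simp [hw])
  · simp only
    clear h h3 hc p1 p2 p3 h2
    induction a with
    | nil => simp [insertColumn, h1]
    | cons x a ih =>
      have hx := hav x (by simp)
      rw [List.cons_append, insertColumn_cons_of_lt _ hx, ih fun u hu => hav u (by simp [hu])]
      rfl

theorem RowsWeaklyDecrease.revInsertColumn_of_le {z : ℕ+} {c d : List ℕ+}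
    (h : RowsWeaklyDecrease c d) (hd : ∀ u ∈ d, u ≤ z) :
    RowsWeaklyDecrease (revInsertColumn z c).1 d := by
  induction c generalizing d with
  | nil =>
    cases d with
    | nil => exact rowsWeaklyDecrease_nil _
    | cons g d => exact absurd h (rowsWeaklyDecrease_nil_cons _ _)
  | cons x c ih =>
    cases d with
    | nil => exact rowsWeaklyDecrease_nil _
    | cons g d =>
      obtain ⟨h1, h2⟩ := rowsWeaklyDecrease_cons.mp h
      rw [revInsertColumn]
      split_ifs with hv
      · exact rowsWeaklyDecrease_cons.mpr ⟨h1, ih h2 fun u hu => hd u (by simp [hu])⟩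
      · exact rowsWeaklyDecrease_cons.mpr ⟨hd g (by simp), h2⟩

theorem mem_insertColumn_fst (z : ℕ+) (d : List ℕ+) : z ∈ (insertColumn z d).1 := by
  rcases insertColumn_cases z d with ⟨h1, h2⟩ | ⟨a, y, b, rfl, hy, hu, h2⟩ <;> simp [h2]

theorem RowsWeaklyDecrease.exists_le {c d : List ℕ+} (h : RowsWeaklyDecrease c d) {z : ℕ+}
    (hz : z ∈ d) : ∃ v ∈ c, z ≤ v := by
  obtain ⟨r, hr, rfl⟩ := List.mem_iff_getElem.mp hz
  obtain ⟨hb, h1⟩ := h r hr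
  exact ⟨(c)[r], List.getElem_mem _, h1⟩

/-- The inverse of the bumping step: `z` lands in `c` no higher than its row in the right column,
and from that row on all entries of `d` are at most `z`. -/
theorem RowsWeaklyDecrease.revInsertColumn {z : ℕ+} {c d : List ℕ+} (hd : Desc d)
    (h : RowsWeaklyDecrease c (insertColumn z d).1) :
    RowsWeaklyDecrease (revInsertColumn z c).1 d := by
  induction c generalizing d with
  | nil =>
    obtain ⟨v, hv, -⟩ := h.exists_le (mem_insertColumn_fst z d)
    simp at hv
  | cons x c ih =>
    cases d with
    | nil => exact rowsWeaklyDecrease_nil _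
    | cons g d =>
      have hd' := List.pairwise_cons.mp hd
      rcases le_or_gt g z with hg | hg
      · rw [insertColumn_cons_of_le _ hg] at h
        obtain ⟨h1, h2⟩ := rowsWeaklyDecrease_cons.mp h
        have h3 : ∀ u ∈ d, u ≤ z := fun u hu => (hd'.1 u hu).le.trans hg
        rw [PlacticKeys.revInsertColumn]
        split_ifs with hv
        · exact rowsWeaklyDecrease_cons.mpr ⟨hg.trans h1, h2.revInsertColumn_of_le h3⟩
        · exact rowsWeaklyDecrease_cons.mpr ⟨hg, h2⟩
      · rw [insertColumn_cons_of_lt _ hg] at h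
        obtain ⟨h1, h2⟩ := rowsWeaklyDecrease_cons.mp h
        have hv : ∃ v ∈ c, z ≤ v := h2.exists_le (mem_insertColumn_fst z d)
        rw [PlacticKeys.revInsertColumn, if_pos hv]
        exact rowsWeaklyDecrease_cons.mpr ⟨h1, ih hd'.2 h2⟩

/-- Removing a corner box by reverse insertion. -/
theorem revInsertTableau_spec {T : List (List ℕ+)} (hT : IsRSSYT T) {k : ℕ} (hk : k < T.length)
    (hcorner : colLength T (k + 1) < colLength T k) :
    IsRSSYT (revInsertTableau k T).1 ∧
      insertTableau (revInsertTableau k T).2 (revInsertTableau k T).1 = (T, k) := by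
  induction T generalizing k with
  | nil => simp at hk
  | cons c T ih =>
    obtain ⟨hc, hr, hT'⟩ := isRSSYT_cons.mp hT
    cases k with
    | zero =>
      obtain ⟨e, x, rfl⟩ : ∃ e x, c = e ++ [x] := by
        rcases List.eq_nil_or_concat' c with rfl | h
        · exact absurd rfl hc.1
        · exact h
      rw [colLength_cons_succ, colLength_zero, colLength_cons_zero] at hcorner
      rw [revInsertTableau]
      by_cases he : e = []
      · subst he
        cases T with
        | nil => simpa [removeBox, insertTableau] using isRSSYT_nil
        | cons d T =>
          have := List.length_pos_iff.mpr (isRSSYT_cons.mp hT').1.1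
          simp only [List.headD_cons, List.nil_append, List.length_singleton] at hcorner
          omega
      · rw [removeBox_zero_append he]
        obtain ⟨p1, p2, p3⟩ := List.pairwise_append.mp hc.2
        have hxe : ∀ a ∈ e, x < a := fun a ha => p3 a ha x (by simp)
        constructor
        · refine isRSSYT_cons.mpr ⟨⟨he, p1⟩, ?_, hT'⟩
          intro r hrd
          have hre : r < e.length := by
            rw [List.length_append, List.length_singleton] at hcorner; omega
          obtain ⟨h1, h2⟩ := hr r hrd
          rw [List.getElem_append_left hre] at h2
          exact ⟨hre, h2⟩
        · have h1 : insertColumn x e = (e ++ [x], none) := by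
            rcases insertColumn_cases x e with ⟨_, h2⟩ | ⟨a, y, b, rfl, hy, hu, h2⟩
            · exact h2
            · exact absurd (hxe y (by simp)) hy.not_gt
          rw [insertTableau_of_none _ (by rw [h1]), h1]
    | succ k =>
      obtain ⟨h1, h2⟩ := ih hT' (k := k) (by simpa using hk) (by simpa using hcorner)
      rw [revInsertTableau]
      set z := (revInsertTableau k T).2
      set T' := (revInsertTableau k T).1
      have h3 : T = (insertTableau z T').1 := by rw [h2]
      have h4 : RowsWeaklyDecrease c (insertColumn z (T'.headD [])).1 := by
        rw [← insertTableau_headD, ← h3]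
        exact hr
      have hd : Desc (T'.headD []) := by
        cases hT'' : T' with
        | nil => simp
        | cons d S => exact (isRSSYT_cons.mp (hT'' ▸ h1)).1.2
      obtain ⟨g1, g2, g3⟩ := revInsertColumn_spec hc.2 (h4.exists_le (mem_insertColumn_fst z _))
      constructor
      · exact isRSSYT_cons.mpr ⟨isColumn_of_length hc g1 g2, h4.revInsertColumn hd, h1⟩
      · rw [insertTableau_of_some _ (by rw [g3] : _ = some z), g3, h2]

theorem appendBox_removeBox {Q : List (List ℕ+)} {c : ℕ} (hQ : ∀ d ∈ Q, d ≠ []) (hc : c < Q.length)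
    (hcorner : colLength Q (c + 1) < colLength Q c) :
    appendBox (removeBox c Q).2 c (removeBox c Q).1 = Q ∧ c ≤ (removeBox c Q).1.length := by
  induction Q generalizing c with
  | nil => simp at hc
  | cons d Q ih =>
    simp only [List.mem_cons, forall_eq_or_imp] at hQ
    cases c with
    | zero =>
      obtain ⟨e, x, rfl⟩ : ∃ e x, d = e ++ [x] := by
        rcases List.eq_nil_or_concat' d with rfl | h
        · exact absurd rfl hQ.1
        · exact h
      by_cases he : e = []
      · subst he
        cases Q with
        | nil => simp [removeBox, appendBox]
        | cons g Q =>
          have := List.length_pos_iff.mpr (hQ.2 g (by simp))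
          simp only [colLength_cons_zero, colLength_cons_succ, List.nil_append,
            List.length_singleton] at hcorner
          omega
      · rw [removeBox_zero_append he]
        simp [appendBox]
    | succ c =>
      have := ih hQ.2 (c := c) (by simpa using hc) (by simpa using hcorner)
      simpa [removeBox, appendBox] using this

theorem isRSSYT_of_appendBox {Q : List (List ℕ+)} {c : ℕ} {y : ℕ+} (h : IsRSSYT (appendBox y c Q))
    (hQ : ∀ d ∈ Q, d ≠ []) (hc : c ≤ Q.length)
    (hsh : Antitone (colLength Q)) : IsRSSYT Q := by
  induction Q generalizing c with
  | nil => exact isRSSYT_nil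
  | cons d Q ih =>
    simp only [List.mem_cons, forall_eq_or_imp] at hQ
    have hl : (Q.headD []).length ≤ d.length := by
      have := hsh (Nat.zero_le 1)
      rwa [colLength_cons_succ, colLength_zero, colLength_cons_zero] at this
    cases c with
    | zero =>
      simp only [appendBox] at h
      obtain ⟨h1, h2, h3⟩ := isRSSYT_cons.mp h
      refine isRSSYT_cons.mpr ⟨⟨hQ.1, h1.2.sublist (List.sublist_append_left _ _)⟩, ?_, h3⟩
      intro r hr
      obtain ⟨h4, h5⟩ := h2 r hr
      rw [List.getElem_append_left (by omega)] at h5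
      exact ⟨by omega, h5⟩
    | succ c =>
      simp only [appendBox] at h
      obtain ⟨h1, h2, h3⟩ := isRSSYT_cons.mp h
      have hc' : c ≤ Q.length := by simpa using hc
      refine isRSSYT_cons.mpr ⟨h1, ?_, ih h3 hQ.2 hc' fun i j hij => by
        simpa using hsh (Nat.succ_le_succ hij)⟩
      cases c with
      | zero =>
        rw [headD_appendBox_zero] at h2
        intro r hr
        obtain ⟨h4, h5⟩ := h2 r (by rw [List.length_append]; omega)
        rw [List.getElem_append_left hr] at h5
        exact ⟨h4, h5⟩
      | succ c =>
        rwa [headD_appendBox_succ y hc'] at h2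

/-! ### Reverse insertion of pairs of tableaux -/

theorem IsRSSYT.rows_getD {T : List (List ℕ+)} (hT : IsRSSYT T) (j : ℕ) :
    RowsWeaklyDecrease (T.getD j []) (T.getD (j + 1) []) := by
  induction T generalizing j with
  | nil => simpa using rowsWeaklyDecrease_nil _
  | cons c T ih =>
    obtain ⟨h1, h2, h3⟩ := isRSSYT_cons.mp hT
    cases j with
    | zero => cases T <;> simpa using h2
    | succ j => simpa using ih h3 j

theorem IsRSSYT.desc_getD {T : List (List ℕ+)} (hT : IsRSSYT T) (j : ℕ) : Desc (T.getD j []) := by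
  by_cases hj : j < T.length
  · rw [List.getD_eq_getElem _ _ hj]
    exact hT.desc _ (List.getElem_mem _)
  · rw [List.getD_eq_default _ _ (not_lt.mp hj)]
    exact List.Pairwise.nil

theorem shape_eq_of_colLength_eq {T Q : List (List ℕ+)} (hT : ∀ d ∈ T, d ≠ []) (hQ : ∀ d ∈ Q, d ≠ [])
    (h : ∀ j, colLength T j = colLength Q j) : shape T = shape Q := by
  induction T generalizing Q with
  | nil =>
    cases Q with
    | nil => rfl
    | cons d Q =>
      have h1 := h 0
      have := List.length_pos_iff.mpr (hQ d (by simp))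
      simp at h1
      simp [h1] at this
  | cons c T ih =>
    have h1 := h 0
    have := List.length_pos_iff.mpr (hT c (by simp))
    cases Q with
    | nil => simp at h1; simp [h1] at this
    | cons d Q =>
      have h2 := ih (Q := Q) (fun e he => hT e (by simp [he])) (fun e he => hQ e (by simp [he]))
        fun j => by simpa using h (j + 1)
      simp only [shape, List.map_cons, colLength_cons_zero] at h1 h2 ⊢
      rw [h1, h2]

theorem removeBox_ne_nil {Q : List (List ℕ+)} (hQ : ∀ d ∈ Q, d ≠ []) (c : ℕ) :
    ∀ d ∈ (removeBox c Q).1, d ≠ [] := by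
  induction Q generalizing c with
  | nil => simp [removeBox]
  | cons e Q ih =>
    simp only [List.mem_cons, forall_eq_or_imp] at hQ
    cases c with
    | zero =>
      simp only [removeBox]
      split_ifs with h
      · exact hQ.2
      · simp only [List.mem_cons, forall_eq_or_imp]
        refine ⟨?_, hQ.2⟩
        intro he
        have := congrArg List.length he
        simp at this
        omega
    | succ c =>
      simp only [removeBox, List.mem_cons, forall_eq_or_imp]
      exact ⟨hQ.1, ih hQ.2 c⟩

theorem colLength_insertTableau (x : ℕ+) (T : List (List ℕ+)) (j : ℕ) :
    colLength (insertTableau x T).1 j =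
      colLength T j + if j = (insertTableau x T).2 then 1 else 0 := by
  rw [colLength_eq_of_shape_eq (shape_insertTableau rfl x x),
    colLength_appendBox _ (insertTableau_snd_le x T)]

theorem exists_minColumn {Q : List (List ℕ+)} (hne : word Q ≠ []) :
    (∀ u ∈ word Q, minEntry Q ≤ u) ∧ minEntry Q ∈ Q.getD (minColumn Q) [] ∧
      ∀ j, minEntry Q ∈ Q.getD j [] → j ≤ minColumn Q := by
  have hne' : Q.flatten ≠ [] := by
    intro h
    have := length_flatten_eq Q
    rw [h] at this
    exact hne (List.length_eq_zero_iff.mp this.symm)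
  obtain ⟨y, hy⟩ : ∃ y, Q.flatten.min? = some y := by
    cases h : Q.flatten.min? with
    | none => exact absurd (List.min?_eq_none_iff.mp h) hne'
    | some y => exact ⟨y, rfl⟩
  have hmin : minEntry Q = y := by rw [minEntry, hy]; rfl
  obtain ⟨h1, h2⟩ := List.min?_eq_some_iff.mp hy
  rw [← hmin] at h1 h2
  have h3 : minEntry Q ∈ word (Q.drop 0) := by
    rw [List.drop_zero, ← mem_flatten_iff_mem_word]; exact h1
  obtain ⟨j, -, hj⟩ := mem_word_drop.mp h3
  have hb (i : ℕ) (hi : minEntry Q ∈ Q.getD i []) : i ≤ Q.length := by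
    by_contra hge
    rw [List.getD_eq_default _ _ (by omega)] at hi
    simp at hi
  classical
  have hg := Nat.findGreatest_spec (P := fun i => minEntry Q ∈ Q.getD i []) (hb j hj) hj
  have hmax (i : ℕ) (hi : minEntry Q ∈ Q.getD i []) :
      i ≤ Nat.findGreatest (fun i => minEntry Q ∈ Q.getD i []) Q.length :=
    Nat.le_findGreatest (hb i hi) hi
  rw [minColumn_eq hg hmax]
  exact ⟨fun u hu => h2 u (mem_flatten_iff_mem_word.mpr hu), hg, hmax⟩

/-- The last pair is peeled off. The box removed must be a corner, and the pair must continue the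
remaining biword in the Knuth order; both follow from the choice of the rightmost smallest entry. -/
theorem rskReverseSteps_spec (n : ℕ) {P Q : List (List ℕ+)} (hP : IsRSSYT P) (hQ : IsRSSYT Q)
    (hsh : shape P = shape Q) (hn : (word Q).length = n) :
    IsKnuthBiword (rskReverseSteps n P Q) ∧ rskInsert (rskReverseSteps n P Q) = (P, Q) := by
  induction n generalizing P Q with
  | zero =>
    have hQ0 : Q = [] := by
      cases Q with
      | nil => rfl
      | cons d Q =>
        have := List.length_pos_iff.mpr (hQ.ne_nil d (by simp))
        simp only [word_cons, List.length_append, List.length_reverse] at hn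
        omega
    subst hQ0
    have : P = [] := by
      have := length_eq_of_shape_eq hsh
      exact List.length_eq_zero_iff.mp this
    subst this
    exact ⟨by simp [rskReverseSteps, IsKnuthBiword], rfl⟩
  | succ n ih =>
    have hne : word Q ≠ [] := by
      intro h
      rw [h] at hn
      simp at hn
    obtain ⟨hmin, hmem, hright⟩ := exists_minColumn hne
    rw [rskReverseSteps]
    set c := minColumn Q
    set y := minEntry Q
    have hcQ : c < Q.length := by
      by_contra hge
      rw [List.getD_eq_default _ _ (not_lt.mp hge)] at hmem
      simp at hmem
    -- Otherwise the smallest entry would have a right neighbour, which would be equally small and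
    -- further right.
    have hcorner : colLength Q (c + 1) < colLength Q c := by
      by_contra hge
      obtain ⟨r, hr, hry⟩ := List.mem_iff_getElem.mp hmem
      have hr' : r < (Q.getD (c + 1) []).length := by
        simp only [colLength] at hge
        omega
      obtain ⟨_, h1⟩ := hQ.rows_getD c r hr'
      rw [hry] at h1
      have h2 : (Q.getD (c + 1) [])[r] ∈ word Q := by
        have := mem_word_drop (c := 0).mpr ⟨c + 1, Nat.zero_le _, List.getElem_mem hr'⟩
        simpa using this
      have h3 := le_antisymm h1 (hmin _ h2)
      have := hright (c + 1) (h3 ▸ List.getElem_mem hr')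
      omega
    have hcornerP : colLength P (c + 1) < colLength P c := by
      rw [colLength_eq_of_shape_eq hsh, colLength_eq_of_shape_eq hsh]
      exact hcorner
    obtain ⟨hP', hins⟩ := revInsertTableau_spec hP (by rw [length_eq_of_shape_eq hsh]; exact hcQ)
      hcornerP
    obtain ⟨happ, hlen⟩ := appendBox_removeBox hQ.ne_nil hcQ hcorner
    have hQne := removeBox_ne_nil hQ.ne_nil c
    set x := (revInsertTableau c P).2
    set P' := (revInsertTableau c P).1
    set Q' := (removeBox c Q).1
    have hy : (removeBox c Q).2 = y := by
      have h1 := getD_appendBox (removeBox c Q).2 hlen c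
      rw [happ, if_pos rfl] at h1
      have h2 := hQ.desc_getD c
      rw [h1] at hmem h2
      rcases List.mem_append.mp hmem with h3 | h3
      · have h4 := (List.pairwise_append.mp h2).2.2 y h3 (removeBox c Q).2 (by simp)
        have h5 : (removeBox c Q).2 ∈ word Q := by
          have := mem_word_drop (Q := Q) (c := 0) (u := (removeBox c Q).2).mpr
            ⟨c, Nat.zero_le _, by rw [h1]; simp⟩
          simpa using this
        exact absurd (hmin _ h5) h4.not_ge
      · exact (List.mem_singleton.mp h3).symm
    rw [hy] at happ
    have hcol : ∀ j, colLength P' j = colLength Q' j := by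
      intro j
      have h1 := colLength_insertTableau x P' j
      have h2 := colLength_appendBox y hlen j
      rw [hins] at h1
      rw [happ, ← colLength_eq_of_shape_eq hsh] at h2
      simp only at h1
      omega
    have hsh' : shape P' = shape Q' := shape_eq_of_colLength_eq hP'.ne_nil hQne hcol
    have hQ' : IsRSSYT Q' := by
      apply isRSSYT_of_appendBox (happ.symm ▸ hQ) hQne hlen
      rw [← funext hcol]
      exact hP'.colLength_anti
    have hperm := perm_word_appendBox y hlen
    rw [happ] at hperm
    obtain ⟨hk, hi⟩ := ih hP' hQ' hsh' (by
      have := hperm.length_eq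
      rw [List.length_cons] at this
      omega)
    set w := rskReverseSteps n P' Q'
    refine ⟨?_, ?_⟩
    · refine isKnuthBiword_append_singleton.mpr ⟨hk, ?_⟩
      intro q hq
      obtain ⟨v, hv⟩ : ∃ v, w = v ++ [q] := by
        rw [Option.mem_def, List.getLast?_eq_some_iff] at hq
        exact hq
      have hk' := hk
      rw [hv] at hk' hi
      have hinv := (isKnuthBiword_append_singleton.mp hk').1.invariant
      have hsnd := hinv.snd_le q.1
      rw [rskInsert_append_singleton, insertStep] at hi
      simp only [Prod.mk.injEq] at hi
      obtain ⟨hiP, hiQ⟩ := hi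
      have hcc := getD_appendBox q.2 hsnd (insertTableau q.1 (rskInsert v).1).2
      rw [hiQ, if_pos rfl] at hcc
      have hqQ' : q.2 ∈ Q'.getD (insertTableau q.1 (rskInsert v).1).2 [] := by
        rw [hcc]; simp
      have hqQ : q.2 ∈ word Q := by
        rw [hperm.mem_iff]
        have := mem_word_drop (c := 0).mpr ⟨_, Nat.zero_le _, hqQ'⟩
        simp at this ⊢
        exact Or.inr this
      refine ⟨hmin _ hqQ, ?_⟩
      intro hqy
      simp only at hqy ⊢
      by_contra hlt
      -- If the first letters decreased, the earlier box with entry `y`, in column `e`, would be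
      -- weakly right of `c`. For `e = c` the column contains `y` twice; for `e > c` column `c` was
      -- not rightmost.
      have h1 := insertTableau_snd_le_of_lt (not_le.mp hlt) hinv.left.desc
      rw [hiP, hins] at h1
      simp only at h1
      set e := (insertTableau q.1 (rskInsert v).1).2
      have h2 := getD_appendBox y hlen e
      rw [happ] at h2
      rw [hqy] at hqQ'
      by_cases hec : e = c
      · rw [if_pos hec] at h2
        have h3 := hQ.desc_getD e
        rw [h2, ← hec] at h3
        exact lt_irrefl _ ((List.pairwise_append.mp h3).2.2 y hqQ' y (by simp))
      · rw [if_neg hec] at h2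
        have := hright e (h2 ▸ hqQ')
        omega
    · rw [rskInsert_append_singleton, hi, insertStep]
      simp only [hins, happ]

/-! ### The left key -/

theorem starColumns_append_singleton (N : ℕ) (v : List (List ℕ+)) (c : List ℕ+) :
    starColumns N (v ++ [c]) = star N c :: starColumns N v := by
  simp [starColumns]

theorem starColumns_cons (N : ℕ) (v : List (List ℕ+)) (c : List ℕ+) :
    starColumns N (c :: v) = starColumns N v ++ [star N c] := by
  simp [starColumns]

theorem IsFrank.starColumns {N : ℕ} {T T' v : List (List ℕ+)} (h : IsFrank T v)
    (hN : ∀ a ∈ word T, (a : ℕ) ≤ N) (hs : shape T' = shape T)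
    (hk : KnuthEquiv (word T') (star N (word T))) : IsFrank T' (starColumns N v) := by
  obtain ⟨h1, h2, h3⟩ := h
  have hv : ∀ a ∈ word v, (a : ℕ) ≤ N := fun a ha => hN a (h3.perm.mem_iff.mp ha)
  refine ⟨isColumn_starColumns hv h1, ?_, ?_⟩
  · rw [shape_starColumns, hs]
    exact (List.reverse_perm _).trans h2
  · rw [word_starColumns]
    exact (KnuthEquiv.star h3 hv).trans hk.symm

theorem countP_star {N : ℕ} {c : List ℕ+} (hN : ∀ a ∈ c, (a : ℕ) ≤ N) (k : ℕ) :
    c.countP (fun a : ℕ+ => (a : ℕ) ≤ k) =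
      c.length - (star N c).countP (fun a : ℕ+ => (a : ℕ) ≤ N - k) := by
  have h1 := List.length_eq_countP_add_countP (fun a : ℕ+ => decide ((a : ℕ) ≤ k)) (l := c)
  have h2 : (star N c).countP (fun a : ℕ+ => (a : ℕ) ≤ N - k) =
      c.countP (fun a : ℕ+ => ¬ decide ((a : ℕ) ≤ k) = true) := by
    rw [star, List.countP_reverse, List.countP_map]
    apply List.countP_congr
    intro a ha
    have h3 := hN a ha
    have := a.pos
    simp only [Function.comp_apply, coe_flipLetter h3, decide_eq_true_eq]
    omega
  rw [h2]
  omega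

/-- `star` turns first factors of frank words of `Q` into last factors for its evacuation, and an
entry is at most `k` iff its flip exceeds `N - k`. So `lastFrankColumn` theory for the evacuation
gives existence and uniqueness. -/
theorem IsRSSYT.firstFrankColumn_spec {N : ℕ} {Q : List (List ℕ+)} (hQ : IsRSSYT Q)
    (hN : ∀ a ∈ word Q, (a : ℕ) ≤ N) (hsh : ∀ j, colLength (evacuation N Q) j = colLength Q j)
    {j : ℕ} (hj : j < Q.length) : (firstFrankColumn Q Q[j].length).length = Q[j].length ∧
      Desc (firstFrankColumn Q Q[j].length) ∧
      ∀ k, (firstFrankColumn Q Q[j].length).countP (fun a : ℕ+ => (a : ℕ) ≤ k) =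
        leftCount N Q k j := by
  have hU := isRSSYT_evacuation N Q
  have hkn := word_evacuation_knuth N Q
  have hs : shape (evacuation N Q) = shape Q :=
    shape_eq_of_colLength_eq hU.ne_nil hQ.ne_nil hsh
  have hjU : j < (evacuation N Q).length := by rw [length_eq_of_shape_eq hs]; exact hj
  have hNU : ∀ a ∈ word (evacuation N Q), (a : ℕ) ≤ N := fun a ha =>
    star_le hN a (hkn.perm.mem_iff.mp ha)
  have hlj : colLength Q j = Q[j].length := by rw [colLength, List.getD_eq_getElem _ _ hj]
  obtain ⟨v, K, h1, h2, h3⟩ := hU.exists_frank_last hjU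
  have h2' : K.length = Q[j].length := by
    rw [h2, ← hlj, ← hsh, colLength, List.getD_eq_getElem _ _ hjU]
  have h4 : IsFrank Q (star N K :: starColumns N v) := by
    rw [← starColumns_append_singleton]
    refine h1.starColumns hNU hs.symm ?_
    have := (hkn.star hNU).symm
    rwa [star_star hN] at this
  have h5 : (firstFrankColumn Q Q[j].length).length = Q[j].length ∧
      ∃ v, IsFrank Q (firstFrankColumn Q Q[j].length :: v) :=
    Classical.epsilon_spec (p := fun c : List ℕ+ => c.length = Q[j].length ∧
      ∃ v, IsFrank Q (c :: v)) ⟨star N K, by simpa using h2', _, h4⟩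
  obtain ⟨h6, v', h7⟩ := h5
  refine ⟨h6, (h7.1 _ (by simp)).2, fun k => ?_⟩
  have h8 := h7.starColumns hN hs hkn
  rw [starColumns_cons] at h8
  have h9 := h8.last_count_eq hU h1 (by rw [length_star, h6, h2']) (N - k)
  rw [countP_star (N := N), h9, h3, h6, leftCount, hlj]
  intro a ha
  exact hN a (h7.2.2.perm.mem_iff.mp (by simp [ha]))

/-- All flipped letters are at most `N - k`, so the cut-off is void and a whole column of the
evacuation is an admissible subword. -/
theorem leftCount_eq_zero {N k : ℕ} {Q : List (List ℕ+)} (hN : ∀ a ∈ word Q, (a : ℕ) ≤ N)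
    (hk : ∀ a ∈ word Q, k < (a : ℕ)) (hsh : ∀ j, colLength (evacuation N Q) j = colLength Q j)
    (j : ℕ) : leftCount N Q k j = 0 := by
  have hU := isRSSYT_evacuation N Q
  have hkn := word_evacuation_knuth N Q
  rw [leftCount, ← hsh, Nat.sub_eq_zero_iff_le]
  have e := colLength_drop (evacuation N Q) j 0
  rw [Nat.add_zero] at e
  rw [← e]
  have hd := hU.drop j
  have hm : ∀ a ∈ word ((evacuation N Q).drop j), (a : ℕ) ≤ N - k := by
    intro a ha
    have ha' := (word_drop_sublist (evacuation N Q) (Nat.zero_le j)).subset ha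
    rw [List.drop_zero, hkn.perm.mem_iff] at ha'
    obtain ⟨b, hb, rfl⟩ := mem_star.mp ha'
    have := hk b hb
    rw [coe_flipLetter (hN b hb)]
    omega
  generalize (evacuation N Q).drop j = S at hd hm
  cases S with
  | nil => simp
  | cons c S =>
    have := IsIncSubword.length_le (k := N - k) (w := word (c :: S)) (s := c.reverse)
      ⟨by simp, pairwise_reverse_of_desc (isRSSYT_cons.mp hd).1.2, fun a ha => hm a (by
        rw [word_cons]; exact List.mem_append_left _ ha)⟩
    simpa using this

theorem leftCount_anti {N k : ℕ} {Q : List (List ℕ+)}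
    (hsh : ∀ j, colLength (evacuation N Q) j = colLength Q j) : Antitone (leftCount N Q k) := by
  apply antitone_nat_of_succ_le
  intro j
  have hU := isRSSYT_evacuation N Q
  have h1 := hU.maxInc_add_colLength_le (N - k) j
  have h2 := hU.maxInc_le_colLength (N - k) j
  rw [hsh, hsh] at h1
  rw [hsh] at h2
  simp only [leftCount]
  omega

/-! ### Comparison of the keys -/

theorem forall₂_ge_iff_countP {K L : List ℕ+} (hK : Desc K) (hL : Desc L)
    (hl : K.length = L.length) : List.Forall₂ (· ≥ ·) K L ↔
      ∀ k : ℕ, K.countP (fun a : ℕ+ => (a : ℕ) ≤ k) ≤ L.countP (fun a : ℕ+ => (a : ℕ) ≤ k) := by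
  constructor
  · intro h k
    clear hK hL hl
    induction h with
    | nil => rfl
    | @cons a b K L hab _ ih =>
      have hab' : (b : ℕ) ≤ a := hab
      simp only [List.countP_cons, decide_eq_true_eq]
      split_ifs <;> omega
  · intro h
    induction K generalizing L with
    | nil =>
      rw [List.length_nil] at hl
      rw [List.length_eq_zero_iff.mp hl.symm]
      exact List.Forall₂.nil
    | cons a K ih =>
      cases L with
      | nil => simp at hl
      | cons b L =>
        have hK' := List.pairwise_cons.mp hK
        have hL' := List.pairwise_cons.mp hL
        have hl' : K.length = L.length := by simpa using hl
        refine List.Forall₂.cons ?_ (ih hK'.2 hL'.2 hl' ?_)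
        · have h1 := h a
          have h2 : (a :: K).countP (fun u : ℕ+ => (u : ℕ) ≤ a) = (a :: K).length := by
            rw [List.countP_eq_length]
            intro u hu
            rcases List.mem_cons.mp hu with rfl | hu
            · simp
            · have h3 : (u : ℕ) < a := hK'.1 u hu
              simp only [decide_eq_true_eq]; omega
          rw [h2, hl] at h1
          have h3 := List.countP_eq_length.mp (le_antisymm List.countP_le_length h1) b (by simp)
          have h4 : (b : ℕ) ≤ a := by simpa using h3
          exact h4
        · intro k
          have h1 := h k
          simp only [List.countP_cons, decide_eq_true_eq] at h1
          by_cases hb : (b : ℕ) ≤ k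
          · rw [List.countP_eq_length (l := L).mpr]
            · rw [← hl']; exact List.countP_le_length
            · intro u hu
              have h3 : (u : ℕ) < b := hL'.1 u hu
              simp only [decide_eq_true_eq]; omega
          · rw [if_neg hb] at h1
            omega

theorem entrywiseGE_iff {N : ℕ} {P Q : List (List ℕ+)} (hP : IsRSSYT P) (hQ : IsRSSYT Q)
    (hs : shape P = shape Q) (hN : ∀ a ∈ word Q, (a : ℕ) ≤ N)
    (hsh : ∀ j, colLength (evacuation N Q) j = colLength Q j) :
    EntrywiseGE (rightKey P) (leftKey Q) ↔
      ∀ k j, maxInc k (word (P.drop j)) ≤ leftCount N Q k j := by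
  have hlen := length_eq_of_shape_eq hs
  have hcol {j : ℕ} (hj : j < P.length) (hj' : j < Q.length) : P[j].length = Q[j].length := by
    have := colLength_eq_of_shape_eq hs j
    rwa [colLength, colLength, List.getD_eq_getElem _ _ hj, List.getD_eq_getElem _ _ hj'] at this
  have key {j : ℕ} (hj : j < P.length) (hj' : j < Q.length) :
      List.Forall₂ (· ≥ ·) (lastFrankColumn P P[j].length) (firstFrankColumn Q Q[j].length) ↔
        ∀ k, maxInc k (word (P.drop j)) ≤ leftCount N Q k j := by
    obtain ⟨a1, a2, a3⟩ := hP.lastFrankColumn_spec hj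
    obtain ⟨b1, b2, b3⟩ := hQ.firstFrankColumn_spec hN hsh hj'
    rw [forall₂_ge_iff_countP a2 b2 (by rw [a1, b1, hcol hj hj'])]
    simp only [a3, b3]
  rw [EntrywiseGE, rightKey, leftKey, List.forall₂_iff_get]
  constructor
  · rintro ⟨-, h⟩ k j
    by_cases hj : j < P.length
    · have hj' : j < Q.length := hlen ▸ hj
      have := h j (by simpa using hj) (by simpa using hj')
      simp only [List.get_eq_getElem, List.getElem_map] at this
      exact (key hj hj').mp this k
    · rw [List.drop_eq_nil_of_le (not_lt.mp hj), word_nil, maxInc_eq_zero (by simp)]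
      exact Nat.zero_le _
  · intro h
    refine ⟨by simpa using hlen, ?_⟩
    intro j hj hj'
    simp only [List.length_map] at hj hj'
    simp only [List.get_eq_getElem, List.getElem_map]
    exact (key hj hj').mpr fun k => h k j

/-- The combinatorial core. When `p` stays at `c` but `q` grows, the old inequality is recovered
from column `c + 1`, where `p` has the same value; when `p` grows but `q` stays, the new inequality
comes from column `c - 1`, where `q` is not larger. -/
theorem step_iff {p p' q q' : ℕ → ℕ} {c : ℕ} (hp' : Antitone p')
    (hq : Antitone q) (h1 : ∀ j, j ≠ c → p' j = p j)
    (h2 : p' c = p c + 1 ∨ (p' c = p c ∧ p (c + 1) = p c)) (h3 : ∀ j, j ≠ c → q' j = q j)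
    (h4 : q' c = q c + 1 ∨ ∃ i, i + 1 = c ∧ q' c = q c ∧ q i ≤ q c) :
    (∀ j, p' j ≤ q' j) ↔ ∀ j, p j ≤ q j := by
  have hqc := hq (Nat.le_succ c)
  constructor
  · intro h j
    have hj := h j
    by_cases hjc : j = c
    · subst hjc
      have h5 := h (j + 1)
      rw [h1 _ (by omega), h3 _ (by omega)] at h5
      rcases h2 with h2 | ⟨h2, h2'⟩
      · rcases h4 with h4 | ⟨i, rfl, h4, h4'⟩ <;> omega
      · exact h2' ▸ h5.trans hqc
    · rwa [h1 j hjc, h3 j hjc] at hj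
  · intro h j
    have hj := h j
    by_cases hjc : j = c
    · subst hjc
      rcases h4 with h4 | ⟨i, rfl, h4, h4'⟩
      · rcases h2 with h2 | ⟨h2, h2'⟩ <;> omega
      · rcases h2 with h2 | ⟨h2, h2'⟩
        · have h6 := hp' (Nat.le_succ i)
          have h7 := h i
          rw [h1 i (by omega)] at h6
          exact h6.trans (h7.trans (h4'.trans h4.ge))
        · omega
    · rwa [h1 j hjc, h3 j hjc]

/-- Induction over the biword. That evacuation keeps the shape is carried along, since
`evacuation_step` needs it for `Q` and provides it for the extended tableau. -/
theorem IsKnuthBiword.key_iff {N : ℕ} {w : List (ℕ+ × ℕ+)} (hw : IsKnuthBiword w)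
    (hN : ∀ q ∈ w, (q.2 : ℕ) ≤ N) :
    (∀ j, colLength (evacuation N (rskInsert w).2) j = colLength (rskInsert w).2 j) ∧
      ((∀ k j, maxInc k (word ((rskInsert w).1.drop j)) ≤ leftCount N (rskInsert w).2 k j) ↔
        IsBounded w) := by
  induction w using List.reverseRecOn with
  | nil =>
    refine ⟨fun j => rfl, ?_⟩
    simp [rskInsert, IsBounded, maxInc_eq_zero]
  | append_singleton w p ih =>
    obtain ⟨hsh, ih2⟩ := ih (isKnuthBiword_append_singleton.mp hw).1
      fun q hq => hN q (by simp [hq])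
    have hinv := (isKnuthBiword_append_singleton.mp hw).1.invariant
    have hinv' := hw.invariant
    have hc := hinv.snd_le p.1
    have hmin := hinv.min_le hw
    have hperm := perm_word_appendBox p.2 hc
    have hNQ : ∀ u ∈ word (rskInsert (w ++ [p])).2, (u : ℕ) ≤ N := by
      intro u hu
      obtain ⟨q, hq, rfl⟩ := List.mem_map.mp (hinv'.perm_right.mem_iff.mp hu)
      exact hN q hq
    have hNQ0 : ∀ u ∈ word (rskInsert w).2, (u : ℕ) ≤ N := by
      intro u hu
      obtain ⟨q, hq, rfl⟩ := List.mem_map.mp (hinv.perm_right.mem_iff.mp hu)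
      exact hN q (by simp [hq])
    have hR' := hinv'.right
    have hL' := hinv'.left
    rw [rskInsert_append_singleton, insertStep] at hNQ hR' hL' ⊢
    simp only at hNQ hR' hL' ⊢
    set c := (insertTableau p.1 (rskInsert w).1).2
    set P := (rskInsert w).1
    set Q := (rskInsert w).2
    set Q' := appendBox p.2 c Q
    have hmin' : ∀ u ∈ word Q', p.2 ≤ u := by
      intro u hu
      rcases List.mem_cons.mp (hperm.mem_iff.mp hu) with rfl | hu
      · exact le_rfl
      · exact hmin u hu
    obtain ⟨hsh', hrule⟩ := evacuation_step hR' hc hw.notMem hmin' hNQ hsh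
    refine ⟨hsh', ?_⟩
    have hb : IsBounded (w ++ [p]) ↔ IsBounded w ∧ p.2 ≤ p.1 := by
      simp [IsBounded, or_imp, forall_and]
    rw [hb, ← ih2]
    have hzero (k : ℕ) (hk : k < p.2) (j : ℕ) : leftCount N Q' k j = 0 :=
      leftCount_eq_zero hNQ (fun u hu => lt_of_lt_of_le hk (hmin' u hu)) hsh' j
    have hzero0 (k : ℕ) (hk : k < p.2) (j : ℕ) : leftCount N Q k j = 0 :=
      leftCount_eq_zero hNQ0 (fun u hu => lt_of_lt_of_le hk (hmin u hu)) hsh j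
    have hkP := insertTableau_knuth p.1 hinv.left.desc
    by_cases hxy : p.2 ≤ p.1
    · rw [and_iff_left hxy]
      apply forall_congr'
      intro k
      rcases lt_or_ge k (p.2 : ℕ) with hk | hk
      · have hx : k < p.1 := lt_of_lt_of_le hk hxy
        -- Both left counts vanish, so only the counts of the whole words matter, and the inserted
        -- letter exceeds `k`.
        have h0 : maxInc k (word (insertTableau p.1 P).1) = maxInc k (word P) := by
          rw [hkP.maxInc_eq, maxInc_cons_of_lt _ hx]
        simp only [hzero k hk, hzero0 k hk]
        constructor
        · intro h j
          have h1 := maxInc_drop_anti k P (Nat.zero_le j)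
          have h2 := h 0
          rw [List.drop_zero] at h1 h2
          omega
        · intro h j
          have h1 := maxInc_drop_anti k (insertTableau p.1 P).1 (Nat.zero_le j)
          have h2 := h 0
          rw [List.drop_zero] at h1 h2
          omega
      · obtain ⟨r1, r2⟩ := hrule k hk
        obtain ⟨s1, s2⟩ := maxInc_insertTableau hinv.left p.1 k
        exact step_iff (p := fun j => maxInc k (word (P.drop j)))
          (p' := fun j => maxInc k (word ((insertTableau p.1 P).1.drop j)))
          (q := leftCount N Q k) (q' := leftCount N Q' k) (c := c)
          (fun i j h => maxInc_drop_anti k _ h) (leftCount_anti hsh) s1 s2 r1 r2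
    · refine ⟨fun h => ?_, fun h => absurd h.2 hxy⟩
      exfalso
      -- A pair violating the bound is detected at `k = x` in the first column: `x` itself gives a
      -- count of at least 1 on the right-key side, against 0.
      have h1 := h p.1 0
      rw [hzero p.1 (not_le.mp hxy) 0, List.drop_zero, hkP.maxInc_eq] at h1
      have := maxInc_pos (k := p.1) (w := p.1 :: word P) (a := p.1) (by simp) le_rfl
      exact Nat.not_succ_le_zero _ (this.trans h1)

theorem IsKnuthBiword.entrywiseGE_iff_isBounded {w : List (ℕ+ × ℕ+)} (hw : IsKnuthBiword w) :
    EntrywiseGE (rightKey (rskInsert w).1) (leftKey (rskInsert w).2) ↔ IsBounded w := by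
  obtain ⟨N, hN⟩ := exists_bound (w.map Prod.snd)
  have hN' : ∀ q ∈ w, (q.2 : ℕ) ≤ N := fun q hq => hN _ (List.mem_map_of_mem hq)
  obtain ⟨h1, h2⟩ := hw.key_iff hN'
  have hinv := hw.invariant
  rw [← h2, PlacticKeys.entrywiseGE_iff hinv.left hinv.right hinv.shape_eq _ h1]
  exact fun a ha => hN a (hinv.perm_right.mem_iff.mp ha)

theorem rskReverse_spec {PQ : List (List ℕ+) × List (List ℕ+)} (hP : IsRSSYT PQ.1)
    (hQ : IsRSSYT PQ.2) (hs : shape PQ.1 = shape PQ.2) :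
    IsKnuthBiword (rskReverse PQ) ∧ rskInsert (rskReverse PQ) = PQ :=
  rskReverseSteps_spec _ hP hQ hs (length_flatten_eq _).symm

end PlacticKeys

/-! ### The bijection -/

theorem mainTheorem8 :
    Set.BijOn PlacticKeys.rskInsert PlacticKeys.boundedBiwords PlacticKeys.keyBoundedPairs ∧
      Set.InvOn PlacticKeys.rskReverse PlacticKeys.rskInsert
        PlacticKeys.boundedBiwords PlacticKeys.keyBoundedPairs := by
  have hleft : Set.LeftInvOn PlacticKeys.rskReverse PlacticKeys.rskInsert
      PlacticKeys.boundedBiwords := fun w hw => hw.1.rskReverse_rskInsert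
  have hright : Set.RightInvOn PlacticKeys.rskReverse PlacticKeys.rskInsert
      PlacticKeys.keyBoundedPairs := fun PQ h =>
    (PlacticKeys.rskReverse_spec h.1 h.2.1 h.2.2.1).2
  refine ⟨⟨?_, hleft.injOn, ?_⟩, hleft, hright⟩
  · intro w hw
    have hinv := hw.1.invariant
    exact ⟨hinv.left, hinv.right, hinv.shape_eq, hw.1.entrywiseGE_iff_isBounded.mpr hw.2⟩
  · intro PQ h
    obtain ⟨h1, h2⟩ := PlacticKeys.rskReverse_spec h.1 h.2.1 h.2.2.1
    refine ⟨PlacticKeys.rskReverse PQ, ⟨h1, h1.entrywiseGE_iff_isBounded.mp ?_⟩, h2⟩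
    rw [h2]
    exact h.2.2.2
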